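/- A \emph{system} is a tuple $M=(S,s_0,A,\mathtt{step},\mathtt{obs},\mathtt{dom})$ with finite sets $S$ of states and $A$ of actions, a finite set $D$ of agents, an initial state $s_0\in S$, and functions $\mathtt{step}\colon S\times A\to S$, $\mathtt{obs}\colon S\times D\to O$ (with $O$ a set of observations; write $\mathtt{obs}_u(s)=\mathtt{obs}(s,u)$) and $\mathtt{dom}\colon A\to D$. For $\alpha\in A^*$ let $s\cdot\alpha$ be the state reached from $s$ by performing $\alpha$. A \emph{policy} assigns to each state $s$ a reflexive relation $\rightarrowtail_s$ on $D$; put $u^{\uparrow}_{s}=\{v\in D : v\rightarrowtail_s u\}$. For an agent $u$ let $\mathtt{src}(\epsilon,u,s)=\{u\}$, and let $\mathtt{src}(a\alpha,u,s)=\mathtt{src}(\alpha,u,s\cdot a)\cup\{\mathtt{dom}(a)\}$ if $\mathtt{dom}(a)\rightarrowtail_s v$ for some $v\in\mathtt{src}(\alpha,u,s\cdot a)$, and $\mathtt{src}(a\alpha,u,s)=\mathtt{src}(\alpha,u,s\cdot a)$ otherwise. $M$ is \emph{i-secure} with respect to the policy if for all $u\in D$, $s\in S$, $a\in A$, $\alpha\in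 A^*$ with $\mathtt{dom}(a)\notin\mathtt{src}(a\alpha,u,s)$ we have $\mathtt{obs}_u(s\cdot a\alpha)=\mathtt{obs}_u(s\cdot\alpha)$. For $u\in D$ let $\approx^i_u$ be the smallest equivalence relation on $S$ such that $s\cdot a\alpha\approx^i_u s\cdot\alpha$ whenever $\mathtt{dom}(a)\notin\mathtt{src}(a\alpha,u,s)$. The policy is \emph{intransitively uniform} if $u^{\uparrow}_{s}=u^{\uparrow}_{s'}$ for all agents $u$ and all states $s,s'$ with $s\approx^i_u s'$. Inputs of algorithms are pairs of a system and a policy, where states, actions and agents are numbered consecutively and observations are natural numbers, given as a word consisting of the sizes, the initial state, and the tables of $\mathtt{step}$, $\mathtt{dom}$, $\mathtt{obs}$ and $(\rightarrowtail_s)_{s\in S}$, all numbers being written in binary. $\mathrm{NL}$ is the class of languages accepted by nondeterministic Turing machines with a read-only input tape in work space $O(\log n)$. Then: \begin{enumerate} \item Verifying whether a policy is intransitively uniform can be performed in nondeterministic logarithmic space: the set of encodings of systems with an intransitively uniform policy is in $\mathrm{NL}$. \item For systems with intransitively uniform policies, verifying whether a system is i-secure can be performed in nondeterministic logarithmic space: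 there is a language $L\in\mathrm{NL}$ such that, for every system with an intransitively uniform policy, the encoding of the system and its policy belongs to $L$ if and only if the system is i-secure. \end{enumerate} -/

import Mathlib

/-! ### Systems with local policies -/

namespace Noninterference

/-- A state-observed system with states `S`, actions `A`, agents `D` and observations `O`. -/
structure System (S A D O : Type*) where
  /-- the initial state -/
  init : S
  /-- the transition function -/
  step : S → A → S
  /-- the observation of each agent in each state -/
  obs : S → D → O
  /-- the agent performing an action -/
  dom : A → D

/-- A policy: a reflexive relation on the agents for every state;
`P.edge s u v` says that `u` may interfere with `v` in state `s`. -/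
structure Policy (S D : Type*) where
  edge : S → D → D → Prop
  refl : ∀ s u, edge s u u

/-- The set of agents that may interfere with `u` in state `s`. -/
def Policy.mayInterfere {S D : Type*} (P : Policy S D) (u : D) (s : S) : Set D :=
  {v | P.edge s v u}

namespace System

variable {S A D O : Type*} (M : System S A D O) (P : Policy S D)

/-- The state obtained from `s` by performing the actions of `α` from left to right. -/
def run (s : S) (α : List A) : S := α.foldl M.step s

open Classical in
/-- `M.src P α u s`: the agents that may transmit information to `u` on the run `α` from `s`. -/
noncomputable def src : List A → D → S → Set D
  | [], u, _ => {u}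
  | a :: α, u, s =>
      if ∃ v ∈ src α u (M.step s a), P.edge s (M.dom a) v then
        src α u (M.step s a) ∪ {M.dom a}
      else
        src α u (M.step s a)

/-- i-security of `M` with respect to the policy `P`. -/
def ISecure : Prop :=
  ∀ (u : D) (s : S) (a : A) (α : List A), M.dom a ∉ M.src P (a :: α) u s →
    M.obs (M.run s (a :: α)) u = M.obs (M.run s α) u

/-- The pairs of states that i-similarity for `u` is required to identify. -/
def ISimGen (u : D) (x y : S) : Prop :=
  ∃ (s : S) (a : A) (α : List A), M.dom a ∉ M.src P (a :: α) u s ∧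
    x = M.run s (a :: α) ∧ y = M.run s α

/-- i-similarity for `u`: the smallest equivalence relation containing `ISimGen`. -/
def ISimilar (u : D) : S → S → Prop := Relation.EqvGen (M.ISimGen P u)

/-- The policy `P` of the system `M` is intransitively uniform. -/
def IntransitivelyUniform : Prop :=
  ∀ (u : D) (s t : S), M.ISimilar P u s t → P.mayInterfere u s = P.mayInterfere u t

end System

/-! ### Finite systems with policies as inputs of algorithms -/

/-- An input: a finite system together with a policy. States, actions and agents are numbered
consecutively, observations are named by arbitrary natural numbers. -/
structure Instance where
  numStates : ℕ
  numActions : ℕ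
  numAgents : ℕ
  system : System (Fin numStates) (Fin numActions) (Fin numAgents) ℕ
  policy : Policy (Fin numStates) (Fin numAgents)

/-- The input alphabet: the two binary digits `some false`, `some true` and a separator `none`. -/
abbrev Letter : Type := Option Bool

/-- A natural number in binary (least significant digit first), closed by the separator. -/
def encodeNat (n : ℕ) : List Letter := n.bits.map some ++ [none]

open Classical in
/-- The numbers describing an instance: the sizes, the initial state, and the tables of the
transition function, of `dom`, of the observations, and of the local policies. -/
noncomputable def Instance.table (I : Instance) : List ℕ :=
  [I.numStates, I.numActions, I.numAgents, (I.system.init : ℕ)]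
  ++ ((List.finRange I.numStates).flatMap fun s =>
        (List.finRange I.numActions).map fun a => (I.system.step s a : ℕ))
  ++ ((List.finRange I.numActions).map fun a => (I.system.dom a : ℕ))
  ++ ((List.finRange I.numStates).flatMap fun s =>
        (List.finRange I.numAgents).map fun u => I.system.obs s u)
  ++ ((List.finRange I.numStates).flatMap fun s =>
        (List.finRange I.numAgents).flatMap fun u =>
          (List.finRange I.numAgents).map fun v => if I.policy.edge s u v then 1 else 0)

/-- The input word of an instance. -/
noncomputable def Instance.encode (I : Instance) : List Letter :=
  I.table.flatMap encodeNat

end Noninterference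

/-! ### Nondeterministic space-bounded Turing machines -/

namespace SpaceComplexity

/-- Head movements. -/
inductive Move
  | left
  | stay
  | right

/-- The new head position on a tape with cells `0, 1, 2, …`; a left move from cell `0` has no
effect. -/
def Move.apply : Move → ℕ → ℕ
  | .left, p => p - 1
  | .stay, p => p
  | .right, p => p + 1

/-- What the input head may read: a letter of the input or one of the two end markers. -/
inductive InputSymbol (α : Type)
  | leftEnd
  | letter (a : α)
  | rightEnd

/-- The content of cell `p` of the read-only input tape holding `w`: cell `0` is the left end
marker, cells `1, …, |w|` hold `w`, and then comes the right end marker. -/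
def readInput {α : Type} (w : List α) : ℕ → InputSymbol α
  | 0 => .leftEnd
  | p + 1 => match w[p]? with
    | some a => .letter a
    | none => .rightEnd

/-- A nondeterministic Turing machine with a two-way read-only input tape over `α` and finitely
many read-write work tapes, infinite to the right, indexed by `Work`. -/
structure NTM (α : Type) where
  /-- control states -/
  State : Type
  /-- work alphabet -/
  Symbol : Type
  /-- names of the work tapes -/
  Work : Type
  [finite_State : Finite State]
  [finite_Symbol : Finite Symbol]
  [finite_Work : Finite Work]
  blank : Symbol
  start : State
  accept : Set State
  /-- the possible actions (new state, move of the input head, and for every work tape the symbol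
  to write and the move), given the state and the symbols under the heads -/
  trans : State → InputSymbol α → (Work → Symbol) → Set (State × Move × (Work → Symbol × Move))

namespace NTM

variable {α : Type} (T : NTM α)

/-- Configurations of a machine. -/
structure Cfg where
  state : T.State
  inputHead : ℕ
  tape : T.Work → ℕ → T.Symbol
  head : T.Work → ℕ

/-- The initial configuration: blank work tapes, all heads on cell `0`. -/
def initial : T.Cfg where
  state := T.start
  inputHead := 0
  tape := fun _ _ => T.blank
  head := fun _ => 0

/-- One step on input `w`. The input head does not move beyond the right end marker. -/
def Step (w : List α) (c d : T.Cfg) : Prop :=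
  ∃ (q : T.State) (m : Move) (act : T.Work → T.Symbol × Move),
    (q, m, act) ∈ T.trans c.state (readInput w c.inputHead) (fun i => c.tape i (c.head i)) ∧
    d = { state := q
          inputHead := min (m.apply c.inputHead) (w.length + 1)
          tape := fun i => Function.update (c.tape i) (c.head i) (act i).1
          head := fun i => (act i).2.apply (c.head i) }

/-- The configuration `c` occurs in some computation on input `w`. -/
def Reachable (w : List α) (c : T.Cfg) : Prop :=
  Relation.ReflTransGen (T.Step w) T.initial c

/-- Some computation on input `w` reaches an accepting state. -/
def Accepts (w : List α) : Prop := ∃ c, T.Reachable w c ∧ c.state ∈ T.accept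

/-- On every input `w` and along every computation, accepting or not, each work tape uses only the
first `s |w|` cells. -/
def RunsInSpace (s : ℕ → ℕ) : Prop :=
  ∀ (w : List α) (c : T.Cfg), T.Reachable w c → ∀ i, c.head i < s w.length

end NTM

/-- The languages over a finite alphabet accepted by a nondeterministic Turing machine in
space `O(log n)`. -/
def NL (α : Type) [Finite α] : Set (Language α) :=
  {L | ∃ (T : NTM α) (C : ℕ), T.RunsInSpace (fun n => C * (Nat.log 2 n + 1)) ∧
    ∀ w, w ∈ L ↔ T.Accepts w}

end SpaceComplexity

namespace Noninterference

/-- The encodings of finite systems whose policy is intransitively uniform. -/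
def UniformPolicies : Language Letter :=
  {w | ∃ I : Instance, I.encode = w ∧ I.system.IntransitivelyUniform I.policy}

end Noninterference

/-! ### Flow charts acting on a tape with tracks -/

namespace SpaceComplexity

open Relation

/-! Everything rests on a condition on pairs of runs, `RestrictedAgree`: if in `s` the agent `dom a`
may interfere neither with `u` nor with the domain of any action of `α`, then the runs `aα` and `α`
from `s` look alike to `u`. Only the policy of the one state `s` enters. A counterexample is
therefore a path in the product of the system with itself, from the pair (`s·a`, `s`), along actions
filtered by `s` and `dom a`. This is graph reachability, with no set of sources to be stored.

The condition follows from the one with `src`, because under its hypotheses no source is an agent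
that `dom a` may influence in `s`. Conversely, suppose that `dom a` is not a source, but may
influence in `s` the domain of some action `b` of `α`. Then `b` is not transmitted to `u` either, so
`b` can be deleted from both runs and `a` from the shortened one, by induction on the length
(`RestrictedAgree.of_le`). That the deletions remain allowed uses uniformity for shorter runs
(`UniformBelow.src_eq`). For the local policies the induction supplies this uniformity itself, which
yields `intransitivelyUniform_iff`; for observations it is the assumption of the second claim
(`IntransitivelyUniform.iSecure_iff`).

Both languages are thus given by non-reachability, the first together with a check of the syntax.
Non-reachability is in NL by inductive counting (Immerman–Szelepcsényi): `not_reachable_iff` and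
`Semi.not_tc_fin`. The algorithms are written as first-order formulas with transitive closure, whose
variables are registers of logarithmic size. `Semi` predicates are checked by nondeterministic flow
charts, and `Semi.mem_NL` compiles them to Turing machines. `Dec` predicates, which are `Semi`
together with their complements, are closed under connectives, quantifiers and transitive closure.

Numbers in the input may be too large for a register. They are compared in place, digit by digit
(`blockVal_ne_iff`, `blockVal_lt_iff`), and `IsTerm` tolerates such values. -/

/-- The symbols of a work tape with `m` binary tracks: a left end marker, the blank, which serves
as right end marker, and columns of bits. -/
inductive TrackSymbol (m : ℕ)
  | left
  | blank
  | col (c : Fin m → Bool)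

/-- An instruction for a machine with one work tape: the symbols that have to be under the heads,
the move of the input head, the symbol to write and the move of the work head. -/
structure Act (α : Type) (m : ℕ) where
  input : InputSymbol α
  read : TrackSymbol m
  inputMove : Move
  write : TrackSymbol m
  move : Move

/-- Safe instructions respect the two end markers of the work tape. -/
def Act.Safe {α : Type} {m : ℕ} (a : Act α m) : Prop :=
  match a.read with
  | .left => a.write = .left
  | .blank => a.write = .blank ∧ a.move ≠ .right
  | .col _ => ∃ c, a.write = .col c

/-- The data of a machine with one work tape: a configuration without the control state. -/
structure Raw (m : ℕ) where
  inputHead : ℕ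
  tape : ℕ → TrackSymbol m
  head : ℕ

/-- The effect of a safe instruction. -/
def Act.Exec {α : Type} {m : ℕ} (w : List α) (a : Act α m) (c d : Raw m) : Prop :=
  a.Safe ∧ a.input = readInput w c.inputHead ∧ a.read = c.tape c.head ∧
    d = { inputHead := min (a.inputMove.apply c.inputHead) (w.length + 1)
          tape := Function.update c.tape c.head a.write
          head := a.move.apply c.head }

/-- The effect of an optional instruction. -/
def execOption {α : Type} {m : ℕ} (w : List α) : Option (Act α m) → Raw m → Raw m → Prop
  | none, c, d => d = c
  | some a, c, d => a.Exec w c d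

/-- A nondeterministic flow chart of optional instructions. -/
structure Flow (α : Type) (m : ℕ) where
  State : Type
  [finite_State : Finite State]
  entry : State
  exit : State
  edge : State → Option (Act α m) → State → Prop

namespace Flow

variable {α : Type} {m : ℕ}

/-- One step of a flow chart. -/
def Step (F : Flow α m) (w : List α) (x y : F.State × Raw m) : Prop :=
  ∃ o, F.edge x.1 o y.1 ∧ execOption w o x.2 y.2

/-- The input-output relation of a flow chart. -/
def Run (F : Flow α m) (w : List α) (c d : Raw m) : Prop :=
  ReflTransGen (F.Step w) (F.entry, c) (F.exit, d)

theorem Step.mk {F : Flow α m} {w : List α} {p q : F.State} {c d : Raw m} {o : Option (Act α m)}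
    (h : F.edge p o q) (hx : execOption w o c d) : F.Step w (p, c) (q, d) :=
  ⟨o, h, hx⟩

/-- Sequential composition. -/
def seq (F G : Flow α m) : Flow α m where
  State := F.State ⊕ G.State
  finite_State := by
    have := F.finite_State
    have := G.finite_State
    infer_instance
  entry := .inl F.entry
  exit := .inr G.exit
  edge
    | .inl p, o, .inl q => F.edge p o q
    | .inl p, o, .inr q => p = F.exit ∧ o = none ∧ q = G.entry
    | .inr _, _, .inl _ => False
    | .inr p, o, .inr q => G.edge p o q

/-- Edges lead from the first chart to the second and never back, so every run splits at the one
empty step between them. The inductions run from the head because the final configuration is the one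
that stays fixed. -/
theorem run_seq (F G : Flow α m) (w : List α) (c d : Raw m) :
    (F.seq G).Run w c d ↔ ∃ e, F.Run w c e ∧ G.Run w e d := by
  constructor
  · have right : ∀ x y, ReflTransGen ((F.seq G).Step w) x y → ∀ q e, x = (.inr q, e) →
        y = (.inr G.exit, d) → ReflTransGen (G.Step w) (q, e) (G.exit, d) := by
      intro x y h
      induction h using ReflTransGen.head_induction_on with
      | refl =>
        rintro q e rfl h
        injection h with h1 h2
        injection h1 with h1
        rw [h1, h2]
      | @head a b hab _ ih =>
        rintro q e rfl rfl
        obtain ⟨b1, b2⟩ := b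
        obtain ⟨o, ho, hx⟩ := hab
        cases b1 with
        | inl p => exact ho.elim
        | inr p => exact .head (Step.mk (F := G) ho hx) (ih _ _ rfl rfl)
    have left : ∀ x y, ReflTransGen ((F.seq G).Step w) x y → ∀ q c, x = (.inl q, c) →
        y = (.inr G.exit, d) →
        ∃ e, ReflTransGen (F.Step w) (q, c) (F.exit, e) ∧ G.Run w e d := by
      intro x y h
      induction h using ReflTransGen.head_induction_on with
      | refl =>
        rintro q e rfl h
        injection h with h1 h2
        exact nomatch h1
      | @head a b hab hb ih =>
        rintro q e rfl rfl
        obtain ⟨b1, b2⟩ := b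
        obtain ⟨o, ho, hx⟩ := hab
        cases b1 with
        | inl p =>
          obtain ⟨e', h1, h2⟩ := ih _ _ rfl rfl
          exact ⟨e', .head (Step.mk (F := F) ho hx) h1, h2⟩
        | inr p =>
          obtain ⟨rfl, rfl, rfl⟩ := ho
          simp only [execOption] at hx
          subst hx
          exact ⟨_, .refl, right _ _ hb _ _ rfl rfl⟩
    intro h
    exact left _ _ h _ _ rfl rfl
  · rintro ⟨e, h1, h2⟩
    have g1 : ReflTransGen ((F.seq G).Step w) (.inl F.entry, c) (.inl F.exit, e) :=
      ReflTransGen.lift (r := F.Step w) (p := (F.seq G).Step w)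
        (fun x : F.State × Raw m => ((.inl x.1 : (F.seq G).State), x.2))
        (fun _ _ h => h) _ _ h1
    have g2 : ReflTransGen ((F.seq G).Step w) (.inr G.entry, e) (.inr G.exit, d) :=
      ReflTransGen.lift (r := G.Step w) (p := (F.seq G).Step w)
        (fun x : G.State × Raw m => ((.inr x.1 : (F.seq G).State), x.2))
        (fun _ _ h => h) _ _ h2
    refine g1.trans (.head (b := (.inr G.entry, e)) (Step.mk (o := none) ?_ rfl) g2)
    exact ⟨rfl, rfl, rfl⟩

/-- Nondeterministic choice. -/
def alt (F G : Flow α m) : Flow α m where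
  State := Bool ⊕ F.State ⊕ G.State
  finite_State := by
    have := F.finite_State
    have := G.finite_State
    infer_instance
  entry := .inl false
  exit := .inl true
  edge
    | .inl false, o, .inr (.inl q) => o = none ∧ q = F.entry
    | .inl false, o, .inr (.inr q) => o = none ∧ q = G.entry
    | .inr (.inl p), o, .inl true => o = none ∧ p = F.exit
    | .inr (.inr p), o, .inl true => o = none ∧ p = G.exit
    | .inr (.inl p), o, .inr (.inl q) => F.edge p o q
    | .inr (.inr p), o, .inr (.inr q) => G.edge p o q
    | _, _, _ => False

/-- The fresh entry has no incoming and the fresh exit no outgoing edges, so a run that comes back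
to the entry of one branch cannot switch to the other branch. -/
theorem run_alt (F G : Flow α m) (w : List α) (c d : Raw m) :
    (F.alt G).Run w c d ↔ F.Run w c d ∨ G.Run w c d := by
  constructor
  · have final : ∀ y, ReflTransGen ((F.alt G).Step w) (.inl true, c) y → y = (.inl true, c) := by
      intro y h
      rcases ReflTransGen.cases_head h with h | ⟨b, ⟨o, ho, _⟩, _⟩
      · exact h.symm
      · rcases b with ⟨_ | _ | _, _⟩ <;> exact ho.elim
    have inner : ∀ x y, ReflTransGen ((F.alt G).Step w) x y → y = (.inl true, d) →
        (∀ e, x = (.inl true, e) → e = d) ∧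
        (∀ q e, x = (.inr (.inl q), e) → ReflTransGen (F.Step w) (q, e) (F.exit, d)) ∧
        (∀ q e, x = (.inr (.inr q), e) → ReflTransGen (G.Step w) (q, e) (G.exit, d)) := by
      intro x y h
      induction h using ReflTransGen.head_induction_on with
      | refl =>
        rintro rfl
        refine ⟨?_, ?_, ?_⟩
        · rintro e h
          injection h with _ h
          exact h.symm
        · rintro q e h
          injection h with h
          exact nomatch h
        · rintro q e h
          injection h with h
          exact nomatch h
      | @head a b hab hb ih =>
        intro hy
        obtain ⟨i1, i2, i3⟩ := ih hy
        obtain ⟨b1, b2⟩ := b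
        obtain ⟨o, ho, hx⟩ := hab
        refine ⟨?_, ?_, ?_⟩
        · rintro e rfl
          rcases b1 with _ | _ | _ <;> exact ho.elim
        · rintro q e rfl
          rcases b1 with (_ | _) | p | p
          · exact ho.elim
          · obtain ⟨rfl, rfl⟩ := ho
            simp only [execOption] at hx
            subst hx
            rw [i1 b2 rfl]
          · exact .head (Step.mk (F := F) ho hx) (i2 _ _ rfl)
          · exact ho.elim
        · rintro q e rfl
          rcases b1 with (_ | _) | p | p
          · exact ho.elim
          · obtain ⟨rfl, rfl⟩ := ho
            simp only [execOption] at hx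
            subst hx
            rw [i1 b2 rfl]
          · exact ho.elim
          · exact .head (Step.mk (F := G) ho hx) (i3 _ _ rfl)
    intro h
    rcases ReflTransGen.cases_head h with h | ⟨b, ⟨o, ho, hx⟩, hb⟩
    · exact absurd (congrArg Prod.fst h) (by simp [alt])
    · rcases b with ⟨_ | q | q, e⟩
      · exact ho.elim
      · obtain ⟨rfl, rfl⟩ := ho
        simp only [execOption] at hx
        subst hx
        exact .inl ((inner _ _ hb rfl).2.1 _ _ rfl)
      · obtain ⟨rfl, rfl⟩ := ho
        simp only [execOption] at hx
        subst hx
        exact .inr ((inner _ _ hb rfl).2.2 _ _ rfl)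
  · rintro (h | h)
    · have g : ReflTransGen ((F.alt G).Step w) (.inr (.inl F.entry), c) (.inr (.inl F.exit), d) :=
        ReflTransGen.lift (r := F.Step w) (p := (F.alt G).Step w)
        (fun x : F.State × Raw m => ((.inr (.inl x.1) : (F.alt G).State), x.2))
          (fun _ _ h => h) _ _ h
      exact .head (b := (.inr (.inl F.entry), c))
        (Step.mk (F := F.alt G) (p := .inl false) (q := .inr (.inl F.entry)) (o := none)
          ⟨rfl, rfl⟩ rfl)
        (g.tail (Step.mk (F := F.alt G) (q := .inl true) (o := none) ⟨rfl, rfl⟩ rfl))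
    · have g : ReflTransGen ((F.alt G).Step w) (.inr (.inr G.entry), c) (.inr (.inr G.exit), d) :=
        ReflTransGen.lift (r := G.Step w) (p := (F.alt G).Step w)
        (fun x : G.State × Raw m => ((.inr (.inr x.1) : (F.alt G).State), x.2))
          (fun _ _ h => h) _ _ h
      exact .head (b := (.inr (.inr G.entry), c))
        (Step.mk (F := F.alt G) (p := .inl false) (q := .inr (.inr G.entry)) (o := none)
          ⟨rfl, rfl⟩ rfl)
        (g.tail (Step.mk (F := F.alt G) (q := .inl true) (o := none) ⟨rfl, rfl⟩ rfl))

/-- Iteration. -/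
def star (F : Flow α m) : Flow α m where
  State := Option F.State
  finite_State := by
    have := F.finite_State
    infer_instance
  entry := none
  exit := none
  edge
    | none, o, some q => o = none ∧ q = F.entry
    | some p, o, none => o = none ∧ p = F.exit
    | some p, o, some q => F.edge p o q
    | none, _, none => False

/-- The added state `none` is entry and exit at once; a run splits at its visits to `none` into runs
of `F`. -/
theorem run_star (F : Flow α m) (w : List α) (c d : Raw m) :
    F.star.Run w c d ↔ ReflTransGen (F.Run w) c d := by
  constructor
  · have inner : ∀ x y, ReflTransGen (F.star.Step w) x y → y = (none, d) →
        (∀ e, x = (none, e) → ReflTransGen (F.Run w) e d) ∧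
        (∀ q e, x = (some q, e) → ∃ e', ReflTransGen (F.Step w) (q, e) (F.exit, e') ∧
          ReflTransGen (F.Run w) e' d) := by
      intro x y h
      induction h using ReflTransGen.head_induction_on with
      | refl =>
        rintro rfl
        refine ⟨?_, ?_⟩
        · rintro e h
          injection h with _ h
          rw [h]
        · rintro q e h
          injection h with h
          exact nomatch h
      | @head a b hab hb ih =>
        intro hy
        obtain ⟨i1, i2⟩ := ih hy
        obtain ⟨b1, b2⟩ := b
        obtain ⟨o, ho, hx⟩ := hab
        refine ⟨?_, ?_⟩
        · rintro e rfl
          rcases b1 with _ | p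
          · exact ho.elim
          · obtain ⟨rfl, rfl⟩ := ho
            simp only [execOption] at hx
            subst hx
            obtain ⟨e', h1, h2⟩ := i2 _ _ rfl
            exact .head h1 h2
        · rintro q e rfl
          rcases b1 with _ | p
          · obtain ⟨rfl, rfl⟩ := ho
            simp only [execOption] at hx
            subst hx
            exact ⟨_, .refl, i1 _ rfl⟩
          · obtain ⟨e', h1, h2⟩ := i2 _ _ rfl
            exact ⟨e', .head (Step.mk (F := F) ho hx) h1, h2⟩
    intro h
    exact (inner _ _ h rfl).1 _ rfl
  · intro h
    induction h with
    | refl => exact .refl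
    | @tail b d _ h ih =>
      have g : ReflTransGen (F.star.Step w) (some F.entry, b) (some F.exit, d) :=
        ReflTransGen.lift (r := F.Step w) (p := (F.star).Step w)
        (fun x : F.State × Raw m => ((some x.1 : F.star.State), x.2))
          (fun _ _ h => h) _ _ h
      exact ReflTransGen.trans ih (.head (b := (some F.entry, b))
        (Step.mk (F := F.star) (p := none) (o := none) ⟨rfl, rfl⟩ rfl)
        (g.tail (Step.mk (F := F.star) (q := none) (o := none) ⟨rfl, rfl⟩ rfl)))

/-- A single instruction out of a set of instructions. -/
def single (A : Set (Act α m)) : Flow α m where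
  State := Bool
  entry := false
  exit := true
  edge p o q := p = false ∧ q = true ∧ ∃ a ∈ A, o = some a

theorem run_single (A : Set (Act α m)) (w : List α) (c d : Raw m) :
    (single A).Run w c d ↔ ∃ a ∈ A, a.Exec w c d := by
  constructor
  · intro h
    rcases ReflTransGen.cases_head h with h | ⟨⟨b, e⟩, ⟨o, ⟨_, hb, a, ha, ho⟩, hx⟩, hb2⟩
    · exact absurd (congrArg Prod.fst h) (by simp [single])
    · refine ⟨a, ha, ?_⟩
      dsimp only at ho hb hx
      subst ho hb
      rcases ReflTransGen.cases_head hb2 with h | ⟨⟨b, e⟩, ⟨o, ⟨h, _⟩, _⟩, _⟩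
      · simp only [single, Prod.mk.injEq, true_and] at h
        rw [← h]
        exact hx
      · simp at h
  · rintro ⟨a, ha, h⟩
    exact .single ⟨some a, ⟨rfl, rfl, a, ha, rfl⟩, h⟩

end Flow

/-! ### Registers -/

/-- The number of columns of the work tape on input `w`. -/
def width {α : Type} (w : List α) : ℕ := Nat.size (w.length + 2)

/-- The content of a register on input `w`. -/
abbrev Word {α : Type} (w : List α) : Type := Fin (2 ^ width w)

/-- A tape whose columns are given by `c`. -/
def columns {m : ℕ} (l : ℕ) (c : ℕ → Fin m → Bool) : ℕ → TrackSymbol m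
  | 0 => .left
  | j + 1 => if j < l then .col (c j) else .blank

/-- The content of `m` registers together with the position of the input head. -/
@[ext]
structure Store {α : Type} (w : List α) (m : ℕ) where
  pos : Fin (w.length + 2)
  reg : Fin m → Word w

namespace Store

variable {α : Type} {w : List α} {m : ℕ}

/-- The bits of the registers. -/
def bits (s : Store w m) (j : ℕ) (i : Fin m) : Bool := (s.reg i : ℕ).testBit j

/-- The representation of a store by a tape with the work head on the left end marker. -/
def raw (s : Store w m) : Raw m where
  inputHead := s.pos
  tape := columns (width w) s.bits
  head := 0

/-- Registers range over all of `Fin (2 ^ width w)`, so any bits in the `width w` columns are those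
of some store. Rewriting columns at will therefore never leaves the tapes that represent stores. -/
theorem exists_bits (p : Fin (w.length + 2)) (c : ℕ → Fin m → Bool) :
    ∃ s : Store w m, s.pos = p ∧ ∀ j < width w, ∀ i, s.bits j i = c j i := by
  refine ⟨⟨p, fun i => ⟨Nat.ofBits fun j : Fin (width w) => c j i, Nat.ofBits_lt_two_pow _⟩⟩,
    rfl, ?_⟩
  intro j hj i
  simp only [bits]
  rw [Nat.testBit_ofBits_lt _ _ hj]

theorem columns_congr {l : ℕ} {c c' : ℕ → Fin m → Bool} (h : ∀ j < l, c j = c' j) :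
    columns l c = columns l c' := by
  funext j
  cases j with
  | zero => rfl
  | succ j =>
    simp only [columns]
    split_ifs with hj
    · rw [h j hj]
    · rfl

theorem reg_eq_of_bits {s t : Store w m} {i j : Fin m}
    (h : ∀ k < width w, s.bits k i = t.bits k j) : s.reg i = t.reg j := by
  apply Fin.ext
  apply Nat.eq_of_testBit_eq
  intro k
  by_cases hk : k < width w
  · exact h k hk
  · have : ∀ x : Word w, (x : ℕ).testBit k = false := fun x =>
      Nat.testBit_lt_two_pow (x.2.trans_le (Nat.pow_le_pow_right (by norm_num) (by omega)))
    rw [this, this]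

end Store

/-- `Realizable R`: some flow chart transforms representations of stores according to `R`. -/
def Realizable {α : Type} {m : ℕ} (R : ∀ w : List α, Store w m → Store w m → Prop) : Prop :=
  ∃ F : Flow α m, ∀ (w : List α) (s : Store w m) (d : Raw m),
    F.Run w s.raw d ↔ ∃ t : Store w m, d = t.raw ∧ R w s t

namespace Realizable

variable {α : Type} {m : ℕ} {R S : ∀ w : List α, Store w m → Store w m → Prop}

theorem congr (h : Realizable R) (e : ∀ w s t, R w s t ↔ S w s t) : Realizable S := by
  obtain rfl : R = S := by
    funext w s t
    exact propext (e w s t)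
  exact h

theorem comp (hR : Realizable R) (hS : Realizable S) :
    Realizable fun w s t => ∃ u, R w s u ∧ S w u t := by
  obtain ⟨F, hF⟩ := hR
  obtain ⟨G, hG⟩ := hS
  refine ⟨F.seq G, fun w s d => ?_⟩
  rw [Flow.run_seq]
  constructor
  · rintro ⟨e, h1, h2⟩
    obtain ⟨u, rfl, hu⟩ := (hF _ _ _).1 h1
    obtain ⟨t, rfl, ht⟩ := (hG _ _ _).1 h2
    exact ⟨t, rfl, u, hu, ht⟩
  · rintro ⟨t, rfl, u, hu, ht⟩
    exact ⟨u.raw, (hF _ _ _).2 ⟨u, rfl, hu⟩, (hG _ _ _).2 ⟨t, rfl, ht⟩⟩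

theorem union (hR : Realizable R) (hS : Realizable S) :
    Realizable fun w s t => R w s t ∨ S w s t := by
  obtain ⟨F, hF⟩ := hR
  obtain ⟨G, hG⟩ := hS
  refine ⟨F.alt G, fun w s d => ?_⟩
  rw [Flow.run_alt, hF, hG]
  constructor
  · rintro (⟨t, rfl, h⟩ | ⟨t, rfl, h⟩)
    · exact ⟨t, rfl, .inl h⟩
    · exact ⟨t, rfl, .inr h⟩
  · rintro ⟨t, rfl, h | h⟩
    · exact .inl ⟨t, rfl, h⟩
    · exact .inr ⟨t, rfl, h⟩

theorem star (hR : Realizable R) : Realizable fun w => ReflTransGen (R w) := by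
  obtain ⟨F, hF⟩ := hR
  refine ⟨F.star, fun w s d => ?_⟩
  rw [Flow.run_star]
  constructor
  · intro h
    induction h with
    | refl => exact ⟨s, rfl, .refl⟩
    | tail _ h ih =>
      obtain ⟨u, rfl, hu⟩ := ih
      obtain ⟨t, rfl, ht⟩ := (hF _ _ _).1 h
      exact ⟨t, rfl, hu.tail ht⟩
  · rintro ⟨t, rfl, h⟩
    exact ReflTransGen.lift Store.raw (fun a b hab => (hF _ _ _).2 ⟨b, rfl, hab⟩) _ _ h

end Realizable

end SpaceComplexity

/-! ### Sweeps over the work tape -/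

namespace SpaceComplexity

open Relation

section Sweep

variable {α : Type} {m : ℕ} {Q : Type}

/-- The states that a letter-to-letter transducer with transitions `δ` can reach from `q₀` by
reading the first columns of `c` and writing those of `c'`. -/
def SweepTo (q₀ : Q) (δ : Q → (Fin m → Bool) → (Fin m → Bool) → Q → Prop)
    (c c' : ℕ → Fin m → Bool) : ℕ → Q → Prop
  | 0, q => q = q₀
  | i + 1, q => ∃ p, SweepTo q₀ δ c c' i p ∧ δ p (c i) (c' i) q

theorem SweepTo.congr {q₀ : Q} {δ : Q → (Fin m → Bool) → (Fin m → Bool) → Q → Prop}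
    {c c' d' : ℕ → Fin m → Bool} {i : ℕ} {q : Q} (h : SweepTo q₀ δ c c' i q)
    (e : ∀ j < i, c' j = d' j) : SweepTo q₀ δ c d' i q := by
  induction i generalizing q with
  | zero => exact h
  | succ i ih =>
    obtain ⟨p, h1, h2⟩ := h
    exact ⟨p, ih h1 fun j hj => e j (by omega), e i (by omega) ▸ h2⟩

/-- The edges of the flow chart that applies a transducer to the columns of the work tape and then
returns to the left end. -/
inductive SweepEdge (q₀ : Q) (δ : Q → (Fin m → Bool) → (Fin m → Bool) → Q → Prop) (acc : Set Q) :
    Q ⊕ Fin 3 → Option (Act α m) → Q ⊕ Fin 3 → Prop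
  | start (i : InputSymbol α) :
      SweepEdge q₀ δ acc (.inr 0) (some ⟨i, .left, .stay, .left, .right⟩) (.inl q₀)
  | forward (i : InputSymbol α) {p q a b} (h : δ p a b q) :
      SweepEdge q₀ δ acc (.inl p) (some ⟨i, .col a, .stay, .col b, .right⟩) (.inl q)
  | turn (i : InputSymbol α) {p} (h : p ∈ acc) :
      SweepEdge q₀ δ acc (.inl p) (some ⟨i, .blank, .stay, .blank, .left⟩) (.inr 1)
  | back (i : InputSymbol α) {a} :
      SweepEdge q₀ δ acc (.inr 1) (some ⟨i, .col a, .stay, .col a, .left⟩) (.inr 1)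
  | halt (i : InputSymbol α) :
      SweepEdge q₀ δ acc (.inr 1) (some ⟨i, .left, .stay, .left, .stay⟩) (.inr 2)

/-- The flow chart of a sweep. -/
def sweep [Finite Q] (q₀ : Q) (δ : Q → (Fin m → Bool) → (Fin m → Bool) → Q → Prop)
    (acc : Set Q) : Flow α m where
  State := Q ⊕ Fin 3
  entry := .inr 0
  exit := .inr 2
  edge := SweepEdge q₀ δ acc

theorem columns_succ_of_lt {l i : ℕ} (c : ℕ → Fin m → Bool) (h : i < l) :
    columns l c (i + 1) = .col (c i) := by
  simp [columns, h]

theorem columns_succ_of_le {l i : ℕ} (c : ℕ → Fin m → Bool) (h : l ≤ i) :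
    columns l c (i + 1) = .blank := by
  simp [columns, h]

theorem update_columns {l i : ℕ} (c : ℕ → Fin m → Bool) (b : Fin m → Bool) (h : i < l) :
    Function.update (columns l c) (i + 1) (.col b) = columns l (Function.update c i b) := by
  funext j
  cases j with
  | zero => simp [columns]
  | succ j =>
    by_cases hj : j = i
    · subst hj
      simp [columns, h]
    · simp [columns, hj, Function.update_of_ne]

theorem Act.exec_stay {w : List α} {i : InputSymbol α} {r b : TrackSymbol m} {v : Move} {p : ℕ}
    (hp : p ≤ w.length + 1) {f : ℕ → TrackSymbol m} {k : ℕ} {d : Raw m} :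
    Act.Exec w ⟨i, r, .stay, b, v⟩ ⟨p, f, k⟩ d ↔
      Act.Safe (⟨i, r, .stay, b, v⟩ : Act α m) ∧ i = readInput w p ∧ r = f k ∧
        d = ⟨p, Function.update f k b, v.apply k⟩ := by
  simp only [Act.Exec, Move.apply, min_eq_left hp]

theorem update_columns_zero (l : ℕ) (c : ℕ → Fin m → Bool) :
    Function.update (columns l c) 0 .left = columns l c :=
  Function.update_eq_self 0 (columns l c)

/-- The invariant of a sweep. -/
inductive SweepInv (q₀ : Q) (δ : Q → (Fin m → Bool) → (Fin m → Bool) → Q → Prop) (acc : Set Q)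
    (l p : ℕ) (c : ℕ → Fin m → Bool) : Q ⊕ Fin 3 → Raw m → Prop
  | start {y} (hy : y = ⟨p, columns l c, 0⟩) : SweepInv q₀ δ acc l p c (.inr 0) y
  | forward {y q} (i : ℕ) (c' : ℕ → Fin m → Bool) (hi : i ≤ l) (hs : SweepTo q₀ δ c c' i q)
      (hy : y = ⟨p, columns l (fun j => if j < i then c' j else c j), i + 1⟩) :
      SweepInv q₀ δ acc l p c (.inl q) y
  | back {y} (i : ℕ) (c' : ℕ → Fin m → Bool) (hi : i ≤ l) (hs : ∃ q ∈ acc, SweepTo q₀ δ c c' l q)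
      (hy : y = ⟨p, columns l c', i⟩) : SweepInv q₀ δ acc l p c (.inr 1) y
  | done {y} (c' : ℕ → Fin m → Bool) (hs : ∃ q ∈ acc, SweepTo q₀ δ c c' l q)
      (hy : y = ⟨p, columns l c', 0⟩) : SweepInv q₀ δ acc l p c (.inr 2) y

theorem update_prefix (c c' : ℕ → Fin m → Bool) (k : ℕ) (b : Fin m → Bool) :
    Function.update (fun j => if j < k then c' j else c j) k b =
      fun j => if j < k + 1 then Function.update c' k b j else c j := by
  funext j
  rcases lt_trichotomy j k with h | h | h
  · simp [Function.update_of_ne h.ne, h, h.trans (Nat.lt_succ_self k)]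
  · subst h
    simp
  · simp [Function.update_of_ne h.ne', h.not_gt, Nat.not_lt.2 h]

/-- The markers keep the phases apart: the blank is met exactly behind the last column and the left
marker only in cell `0`. So a sweep can neither turn early nor halt before the head is back. -/
theorem SweepInv.step [Finite Q] {q₀ : Q} {δ : Q → (Fin m → Bool) → (Fin m → Bool) → Q → Prop}
    {acc : Set Q} {w : List α} {l p : ℕ} {c : ℕ → Fin m → Bool} (hp : p ≤ w.length + 1)
    {y1 z1 : Q ⊕ Fin 3} {y2 z2 : Raw m} {o : Option (Act α m)}
    (inv : SweepInv q₀ δ acc l p c y1 y2) (ho : SweepEdge q₀ δ acc y1 o z1)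
    (hx : execOption w o y2 z2) : SweepInv q₀ δ acc l p c z1 z2 := by
  cases ho with
  | start i =>
    obtain ⟨rfl⟩ := inv
    obtain ⟨-, -, -, rfl⟩ := (Act.exec_stay hp).1 hx
    exact .forward 0 c (Nat.zero_le _) rfl (by simp [update_columns_zero, Move.apply])
  | @forward i p' q a b hδ =>
    obtain _ | ⟨k, c', hk, hs, rfl⟩ := inv
    obtain ⟨-, -, hr, rfl⟩ := (Act.exec_stay hp).1 hx
    rcases hk.lt_or_eq with hk | rfl
    · rw [columns_succ_of_lt _ hk] at hr
      simp only [lt_irrefl, if_false, TrackSymbol.col.injEq] at hr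
      refine .forward (k + 1) (Function.update c' k b) hk ⟨p', ?_, ?_⟩ ?_
      · exact hs.congr fun j hj => by rw [Function.update_of_ne hj.ne]
      · simpa [← hr] using hδ
      · rw [update_columns _ _ hk, update_prefix]
        rfl
    · rw [columns_succ_of_le _ le_rfl] at hr
      exact nomatch hr
  | @turn i p' hacc =>
    obtain _ | ⟨k, c', hk, hs, rfl⟩ := inv
    obtain ⟨-, -, hr, rfl⟩ := (Act.exec_stay hp).1 hx
    rcases hk.lt_or_eq with hk | rfl
    · rw [columns_succ_of_lt _ hk] at hr
      exact nomatch hr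
    · refine .back k c' le_rfl ⟨p', hacc, hs⟩ ?_
      rw [hr, Function.update_eq_self, Store.columns_congr (c' := c')]
      · rfl
      · intro j hj
        simp [hj]
  | @back i a =>
    obtain _ | _ | ⟨k, c', hk, hs, rfl⟩ := inv
    obtain ⟨-, -, hr, rfl⟩ := (Act.exec_stay hp).1 hx
    refine .back (k - 1) c' (by omega) hs ?_
    rw [hr, Function.update_eq_self]
    rfl
  | halt i =>
    obtain _ | _ | ⟨k, c', hk, hs, rfl⟩ := inv
    obtain ⟨-, -, hr, rfl⟩ := (Act.exec_stay hp).1 hx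
    refine .done c' hs ?_
    rw [hr, Function.update_eq_self]
    cases k with
    | zero => rfl
    | succ k =>
      rw [columns_succ_of_lt _ hk] at hr
      exact nomatch hr

theorem run_sweep [Finite Q] (q₀ : Q) (δ : Q → (Fin m → Bool) → (Fin m → Bool) → Q → Prop)
    (acc : Set Q) (w : List α) (s : Store w m) (d : Raw m) :
    (sweep q₀ δ acc).Run w s.raw d ↔ ∃ c', (∃ q ∈ acc, SweepTo q₀ δ s.bits c' (width w) q) ∧
      d = ⟨s.pos, columns (width w) c', 0⟩ := by
  have hp : (s.pos : ℕ) ≤ w.length + 1 := Nat.lt_succ_iff.1 s.pos.2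
  set l := width w with hl
  let F : Flow α m := sweep q₀ δ acc
  constructor
  · intro h
    have inv : ∀ y : F.State × Raw m, ReflTransGen (F.Step w) (.inr 0, s.raw) y →
        SweepInv q₀ δ acc l s.pos s.bits y.1 y.2 := by
      intro y hy
      induction hy with
      | refl => exact .start rfl
      | tail _ hyz ih =>
        obtain ⟨o, ho, hx⟩ := hyz
        exact ih.step hp ho hx
    obtain _ | _ | _ | ⟨c', hs, hd⟩ := inv _ h
    exact ⟨c', hs, hd⟩
  · rintro ⟨c', ⟨q, hq, hs⟩, rfl⟩
    have fwd : ∀ i ≤ l, ∀ q, SweepTo q₀ δ s.bits c' i q → ReflTransGen (F.Step w) (.inr 0, s.raw)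
        (.inl q, ⟨s.pos, columns l (fun j => if j < i then c' j else s.bits j), i + 1⟩) := by
      intro i
      induction i with
      | zero =>
        rintro - q rfl
        refine .single (Flow.Step.mk (F := F) (SweepEdge.start (readInput w s.pos)) ?_)
        refine (Act.exec_stay hp).2 ⟨rfl, rfl, rfl, ?_⟩
        simp only [Nat.not_lt_zero, if_false, Move.apply]
        rw [update_columns_zero]
      | succ i ih =>
        rintro hi q ⟨p, h1, h2⟩
        refine (ih (by omega) p h1).tail
          (Flow.Step.mk (F := F) (SweepEdge.forward (readInput w s.pos) h2) ?_)
        refine (Act.exec_stay hp).2 ⟨⟨_, rfl⟩, rfl, ?_, ?_⟩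
        · rw [columns_succ_of_lt _ hi]
          simp
        · rw [update_columns _ _ hi, update_prefix]
          simp only [Move.apply]
          rw [Store.columns_congr]
          intro j hj
          by_cases h : j = i
          · subst h
            simp
          · simp [Function.update_of_ne h]
    have back : ∀ i ≤ l, ReflTransGen (F.Step w) (.inr 1, ⟨s.pos, columns l c', i⟩)
        (.inr 2, ⟨s.pos, columns l c', 0⟩) := by
      intro i
      induction i with
      | zero =>
        intro
        refine .single (Flow.Step.mk (F := F) (SweepEdge.halt (readInput w s.pos)) ?_)
        refine (Act.exec_stay hp).2 ⟨rfl, rfl, rfl, ?_⟩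
        simp only [Move.apply]
        congr 1
        exact (Function.update_eq_self 0 (columns l c')).symm
      | succ i ih =>
        intro hi
        refine .head (Flow.Step.mk (F := F) (SweepEdge.back (readInput w s.pos) (a := c' i)) ?_)
          (ih (by omega))
        have hr := columns_succ_of_lt c' hi
        refine (Act.exec_stay hp).2 ⟨⟨_, rfl⟩, rfl, hr.symm, ?_⟩
        simp only [Move.apply]
        rw [← hr, Function.update_eq_self]
        rfl
    refine (fwd l le_rfl q hs).trans (.head (b := (.inr 1, ⟨s.pos, columns l c', l⟩))
      (Flow.Step.mk (F := F) (p := .inl q) (q := .inr 1)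
        (SweepEdge.turn (readInput w s.pos) hq) ?_) (back l le_rfl))
    have hr := columns_succ_of_le (l := l) (fun j => if j < l then c' j else s.bits j) le_rfl
    refine (Act.exec_stay hp).2 ⟨⟨rfl, nofun⟩, rfl, hr.symm, ?_⟩
    simp only [Move.apply]
    rw [← hr, Function.update_eq_self, Store.columns_congr (c' := c')
      (c := fun j => if j < l then c' j else s.bits j)]
    · rfl
    · intro j hj
      simp [hj]

end Sweep

/-! ### Assignments and tests on registers -/

namespace Realizable

variable {α : Type} {m : ℕ}

theorem sweep {Q : Type} [Finite Q] (q₀ : Q)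
    (δ : Q → (Fin m → Bool) → (Fin m → Bool) → Q → Prop) (acc : Set Q) :
    Realizable fun (w : List α) s t => t.pos = s.pos ∧
      ∃ q ∈ acc, SweepTo q₀ δ s.bits t.bits (width w) q := by
  refine ⟨SpaceComplexity.sweep q₀ δ acc, fun w s d => ?_⟩
  rw [run_sweep]
  constructor
  · rintro ⟨c', ⟨q, hq, hs⟩, rfl⟩
    obtain ⟨t, ht, hb⟩ := Store.exists_bits s.pos c'
    refine ⟨t, ?_, ht, q, hq, hs.congr fun j hj => funext fun i => (hb j hj i).symm⟩
    rw [Store.raw, ht, Store.columns_congr fun j hj => funext fun i => hb j hj i]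
  · rintro ⟨t, rfl, ht, h⟩
    refine ⟨t.bits, h, ?_⟩
    rw [Store.raw, ht]

theorem sweepTo_unit {D : (Fin m → Bool) → (Fin m → Bool) → Prop} {c c' : ℕ → Fin m → Bool}
    {i : ℕ} {q : Unit} :
    SweepTo () (fun _ a b _ => D a b) c c' i q ↔ ∀ j < i, D (c j) (c' j) := by
  induction i generalizing q with
  | zero => simp [SweepTo]
  | succ i ih =>
    simp only [SweepTo, ih]
    constructor
    · rintro ⟨-, h1, h2⟩ j hj
      rcases Nat.lt_succ_iff_lt_or_eq.1 hj with h | rfl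
      · exact h1 j h
      · exact h2
    · intro h
      exact ⟨(), fun j hj => h j (by omega), h i (by omega)⟩

/-- A transducer with a single state has no memory and relates the columns one by one. Arbitrary
assignment and the tests for equality, zero and the greatest value are all of this kind. -/
theorem columnwise (D : (Fin m → Bool) → (Fin m → Bool) → Prop) :
    Realizable fun (w : List α) s t => t.pos = s.pos ∧
      ∀ j < width w, D (s.bits j) (t.bits j) := by
  refine (sweep () (fun _ a b _ => D a b) Set.univ).congr fun w s t => ?_
  simp [sweepTo_unit]

/-- Assign arbitrary values to the registers in `p`. -/
theorem havoc (p : Set (Fin m)) :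
    Realizable fun (_ : List α) s t => t.pos = s.pos ∧ ∀ i ∉ p, t.reg i = s.reg i := by
  refine (columnwise fun a b => ∀ i ∉ p, b i = a i).congr fun w s t => ?_
  refine and_congr_right fun _ => ⟨fun h i hi => ?_, fun h j hj i hi => ?_⟩
  · exact Store.reg_eq_of_bits fun k hk => h k hk i hi
  · simp only [Store.bits, h i hi]

theorem store_eq {w : List α} {s t : Store w m} :
    t = s ↔ t.pos = s.pos ∧ ∀ j < width w, t.bits j = s.bits j := by
  constructor
  · rintro rfl
    simp
  · rintro ⟨h1, h2⟩
    exact Store.ext h1 (funext fun i => Store.reg_eq_of_bits fun k hk => by rw [h2 k hk])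

theorem columnwise_test (D : (Fin m → Bool) → Prop) :
    Realizable fun (w : List α) s t => t = s ∧ ∀ j < width w, D (s.bits j) := by
  refine (columnwise fun a b => b = a ∧ D a).congr fun w s t => ?_
  rw [store_eq]
  constructor
  · rintro ⟨h1, h2⟩
    exact ⟨⟨h1, fun j hj => (h2 j hj).1⟩, fun j hj => (h2 j hj).2⟩
  · rintro ⟨⟨h1, h2⟩, h3⟩
    exact ⟨h1, fun j hj => ⟨h2 j hj, h3 j hj⟩⟩

theorem test_eq {ι : Type*} (a b : ι → Fin m) :
    Realizable fun (_ : List α) s t => t = s ∧ ∀ i, s.reg (a i) = s.reg (b i) := by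
  refine (columnwise_test fun c => ∀ i, c (a i) = c (b i)).congr fun w s t => ?_
  refine and_congr_right fun _ => ⟨fun h i => ?_, fun h k hk i => ?_⟩
  · exact Store.reg_eq_of_bits fun k hk => h k hk i
  · simp only [Store.bits, h i]

theorem test_zero (i : Fin m) :
    Realizable fun (_ : List α) s t => t = s ∧ (s.reg i : ℕ) = 0 := by
  refine (columnwise_test fun a => a i = false).congr fun w s t => ?_
  refine and_congr_right fun _ => ⟨fun h => ?_, fun h k hk => ?_⟩
  · apply Nat.eq_of_testBit_eq
    intro k
    rw [Nat.zero_testBit]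
    by_cases hk : k < width w
    · exact h k hk
    · exact Nat.testBit_lt_two_pow
        ((s.reg i).2.trans_le (Nat.pow_le_pow_right (by norm_num) (by omega)))
  · simp only [Store.bits, h, Nat.zero_testBit]

theorem test_max (i : Fin m) :
    Realizable fun (w : List α) s t => t = s ∧ (s.reg i : ℕ) + 1 = 2 ^ width w := by
  refine (columnwise_test fun a => a i = true).congr fun w s t => ?_
  refine and_congr_right fun _ => ⟨fun h => ?_, fun h k hk => ?_⟩
  · have : (s.reg i : ℕ) = 2 ^ width w - 1 := by
      apply Nat.eq_of_testBit_eq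
      intro k
      rw [Nat.testBit_two_pow_sub_one]
      by_cases hk : k < width w
      · rw [decide_eq_true hk]
        exact h k hk
      · rw [decide_eq_false hk]
        exact Nat.testBit_lt_two_pow
          ((s.reg i).2.trans_le (Nat.pow_le_pow_right (by norm_num) (by omega)))
    have := Nat.one_le_two_pow (n := width w)
    omega
  · have : (s.reg i : ℕ) = 2 ^ width w - 1 := by omega
    simp only [Store.bits, this, Nat.testBit_two_pow_sub_one, hk, decide_true]

/-- The transitions of a transducer that tests whether register `j` is the successor of
register `i`; the state is the carry. -/
def succEdge (i j : Fin m) (p : Bool) (a b : Fin m → Bool) (q : Bool) : Prop :=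
  b = a ∧ (a i).toNat + p.toNat = (a j).toNat + 2 * q.toNat

theorem mod_two_pow_succ_eq (x k : ℕ) :
    x % 2 ^ (k + 1) = x % 2 ^ k + 2 ^ k * (x.testBit k).toNat := by
  rw [pow_succ, Nat.mod_mul, Nat.testBit_eq_decide_div_mod_eq]
  rcases Nat.mod_two_eq_zero_or_one (x / 2 ^ k) with h | h <;> simp [h]

/-- The least significant bit comes first, so the carry travels with the sweep. The initial carry
`true` is the one to be added, and a carry after `k` columns is worth `2 ^ k`. -/
theorem sweepTo_succEdge {i j : Fin m} {w : List α} {s : Store w m} {c' : ℕ → Fin m → Bool}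
    {k : ℕ} {q : Bool} :
    SweepTo true (succEdge i j) s.bits c' k q ↔ (∀ n < k, c' n = s.bits n) ∧
      (s.reg i : ℕ) % 2 ^ k + 1 = (s.reg j : ℕ) % 2 ^ k + q.toNat * 2 ^ k := by
  induction k generalizing q with
  | zero => cases q <;> simp [SweepTo, Nat.mod_one]
  | succ k ih =>
    have hi := Nat.mod_lt (s.reg i) (Nat.two_pow_pos k)
    have hj := Nat.mod_lt (s.reg j) (Nat.two_pow_pos k)
    simp only [SweepTo, ih, succEdge, mod_two_pow_succ_eq]
    simp only [pow_succ, Store.bits]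
    generalize (s.reg i : ℕ) % 2 ^ k = x at *
    generalize (s.reg j : ℕ) % 2 ^ k = y at *
    generalize (2 ^ k : ℕ) = z at *
    generalize hb : Nat.testBit (s.reg i) k = b
    generalize hd : Nat.testBit (s.reg j) k = d
    constructor
    · rintro ⟨p, ⟨h1, h2⟩, h3, h4⟩
      refine ⟨fun n hn => ?_, ?_⟩
      · rcases Nat.lt_succ_iff_lt_or_eq.1 hn with h | rfl
        · exact h1 n h
        · exact h3
      · clear ih
        have : z * b.toNat + z * p.toNat = z * d.toNat + z * (2 * q.toNat) := by
          rw [← mul_add, h4, mul_add]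
        nlinarith
    · rintro ⟨h1, h2⟩
      have key : ∃ p : Bool, x + 1 = y + p.toNat * z ∧
          b.toNat + p.toNat = d.toNat + 2 * q.toNat := by
        cases b <;> cases d <;> cases q <;> simp at h2 ⊢ <;> omega
      obtain ⟨p, h3, h4⟩ := key
      exact ⟨p, ⟨fun n hn => h1 n (by omega), h3⟩, h1 k (by omega), h4⟩

theorem test_succ (i j : Fin m) :
    Realizable fun (_ : List α) s t => t = s ∧ (s.reg i : ℕ) + 1 = s.reg j := by
  -- Accepting only the final carry `false` excludes the overflow from the greatest value to `0`.
  refine (sweep true (succEdge i j) {false}).congr fun w s t => ?_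
  rw [store_eq]
  simp only [Set.mem_singleton_iff, exists_eq_left, sweepTo_succEdge, Nat.mod_eq_of_lt (Fin.is_lt _),
    Bool.toNat_false, zero_mul, add_zero, and_assoc]

/-- Move the input head, provided that it reads a symbol in `p`. -/
theorem moveInput (p : Set (InputSymbol α)) (v : Move) :
    Realizable fun (w : List α) (s t : Store w m) => readInput w s.pos ∈ p ∧ t.reg = s.reg ∧
      (t.pos : ℕ) = min (v.apply s.pos) (w.length + 1) := by
  refine ⟨Flow.single {a | ∃ i ∈ p, a = ⟨i, .left, v, .left, .stay⟩}, fun w s d => ?_⟩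
  rw [Flow.run_single]
  constructor
  · rintro ⟨_, ⟨i, hi, rfl⟩, -, h1, h2, rfl⟩
    refine ⟨⟨⟨min (v.apply s.pos) (w.length + 1), by omega⟩, s.reg⟩, ?_, ?_, rfl, rfl⟩
    · simp only [Store.raw, update_columns_zero]
      rfl
    · dsimp only at h1
      subst h1
      exact hi
  · rintro ⟨t, rfl, h1, h2, h3⟩
    refine ⟨_, ⟨_, h1, rfl⟩, rfl, rfl, rfl, ?_⟩
    have : t.bits = s.bits := by
      funext j i
      simp only [Store.bits, h2]
    simp only [Store.raw, update_columns_zero, h3, this]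
    rfl

end Realizable

end SpaceComplexity

/-! ### Predicates recognised by nondeterministic flow charts -/

namespace SpaceComplexity

open Relation

variable {α : Type}

/-- The stores `s` and `t` agree on the first `k` registers. -/
def Store.Agree {w : List α} {m : ℕ} (k : ℕ) (s t : Store w m) : Prop :=
  ∀ j : Fin m, (j : ℕ) < k → t.reg j = s.reg j

theorem Store.Agree.refl {w : List α} {m k : ℕ} (s : Store w m) : s.Agree k s := fun _ _ => rfl

theorem Store.Agree.symm {w : List α} {m k : ℕ} {s t : Store w m} (h : s.Agree k t) :
    t.Agree k s := fun j hj => (h j hj).symm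

theorem Store.Agree.trans {w : List α} {m k : ℕ} {s t u : Store w m} (h : s.Agree k t)
    (h' : t.Agree k u) : s.Agree k u := fun j hj => (h' j hj).trans (h j hj)

theorem Store.Agree.mono {w : List α} {m k l : ℕ} {s t : Store w m} (h : s.Agree l t)
    (hkl : k ≤ l) : s.Agree k t := fun j hj => h j (hj.trans_le hkl)

theorem Store.Agree.reg {w : List α} {m k : ℕ} {s t : Store w m} (h : s.Agree k t) {κ : Type*}
    {r : κ → Fin m} (hr : ∀ i, (r i : ℕ) < k) : (fun i => t.reg (r i)) = fun i => s.reg (r i) :=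
  funext fun i => h (r i) (hr i)

/-- The next `n` registers after the first `k` ones. -/
noncomputable def slot {ι : Type*} [Fintype ι] {m : ℕ} (k : ℕ) (h : k + Fintype.card ι ≤ m) (i : ι) : Fin m :=
  ⟨k + Fintype.equivFin ι i, by have := (Fintype.equivFin ι i).2; omega⟩

theorem slot_lt {ι : Type*} [Fintype ι] {m k : ℕ} (h : k + Fintype.card ι ≤ m) (i : ι) :
    (slot k h i : ℕ) < k + Fintype.card ι := by
  simp [slot]

theorem le_slot {ι : Type*} [Fintype ι] {m k : ℕ} (h : k + Fintype.card ι ≤ m) (i : ι) :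
    k ≤ (slot k h i : ℕ) := by
  simp [slot]

theorem slot_inj {ι : Type*} [Fintype ι] {m k : ℕ} (h : k + Fintype.card ι ≤ m) {i j : ι}
    (e : slot k h i = slot k h j) : i = j := by
  simpa only [slot, Fin.mk.injEq, Nat.add_left_cancel_iff, Fin.val_inj,
    EmbeddingLike.apply_eq_iff_eq] using e

theorem Store.exists_slot {ι : Type*} [Fintype ι] {w : List α} {m k : ℕ}
    (h : k + Fintype.card ι ≤ m) (s : Store w m) (v : ι → Word w) :
    ∃ t : Store w m, t.pos = s.pos ∧ (∀ j : Fin m, (j : ℕ) < k ∨ k + Fintype.card ι ≤ j →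
      t.reg j = s.reg j) ∧ ∀ i, t.reg (slot k h i) = v i := by
  classical
  refine ⟨⟨s.pos, fun j => if hj : ∃ i, slot k h i = j then v hj.choose else s.reg j⟩, rfl, ?_, ?_⟩
  · intro j hj
    have : ¬ ∃ i, slot k h i = j := by
      rintro ⟨i, rfl⟩
      have h1 := le_slot h i
      have h2 := slot_lt h i
      omega
    simp only [this, dif_neg, not_false_iff]
  · intro i
    have hi : ∃ i', slot k h i' = slot k h i := ⟨i, rfl⟩
    exact (dif_pos hi).trans (congrArg v (slot_inj h hi.choose_spec))

/-- A nondeterministic walk of the input head to the left and to the right can end anywhere. -/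
theorem Realizable.havoc_pos {m : ℕ} : Realizable fun (_ : List α) (s t : Store _ m) =>
    t.reg = s.reg := by
  refine ((Realizable.moveInput Set.univ .left).union
    (Realizable.moveInput Set.univ .right)).star.congr fun w s t => ?_
  constructor
  · intro h
    induction h with
    | refl => rfl
    | tail _ h ih => rcases h with h | h <;> exact h.2.1.trans ih
  · intro h
    have right : ∀ n : ℕ, ∀ (s t : Store w m), t.reg = s.reg → (t.pos : ℕ) = s.pos + n →
        ReflTransGen (fun s t : Store w m =>
        (readInput w s.pos ∈ Set.univ ∧ t.reg = s.reg ∧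
          (t.pos : ℕ) = min (Move.left.apply s.pos) (w.length + 1)) ∨
        (readInput w s.pos ∈ Set.univ ∧ t.reg = s.reg ∧
          (t.pos : ℕ) = min (Move.right.apply s.pos) (w.length + 1))) s t := by
      intro n
      induction n with
      | zero =>
        intro s t h e
        rw [Store.ext (Fin.ext (by simpa using e)) h]
      | succ n ih =>
        intro s t h e
        have := t.pos.2
        refine .head (b := ⟨⟨s.pos + 1, by omega⟩, s.reg⟩) (.inr ⟨trivial, rfl, ?_⟩)
          (ih _ _ h (by simp only; omega))
        simp only [Move.apply]
        omega
    have left : ∀ n : ℕ, ∀ (s t : Store w m), t.reg = s.reg → (s.pos : ℕ) = t.pos + n →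
        ReflTransGen (fun s t : Store w m =>
        (readInput w s.pos ∈ Set.univ ∧ t.reg = s.reg ∧
          (t.pos : ℕ) = min (Move.left.apply s.pos) (w.length + 1)) ∨
        (readInput w s.pos ∈ Set.univ ∧ t.reg = s.reg ∧
          (t.pos : ℕ) = min (Move.right.apply s.pos) (w.length + 1))) s t := by
      intro n
      induction n with
      | zero =>
        intro s t h e
        rw [Store.ext (Fin.ext (by simpa using e.symm)) h]
      | succ n ih =>
        intro s t h e
        have := s.pos.2
        refine .head (b := ⟨⟨s.pos - 1, by omega⟩, s.reg⟩) (.inl ⟨trivial, rfl, ?_⟩)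
          (ih _ _ h (by simp only; omega))
        simp only [Move.apply]
        omega
    rcases le_total (s.pos : ℕ) t.pos with hl | hl
    · exact right (t.pos - s.pos) s t h (by omega)
    · exact left (s.pos - t.pos) s t h (by omega)

/-- Assign arbitrary values to the input head and to all but the first `k` registers. -/
theorem Realizable.forget {m : ℕ} (k : ℕ) :
    Realizable fun (_ : List α) (s t : Store _ m) => s.Agree k t := by
  refine ((Realizable.havoc {j | k ≤ (j : ℕ)}).comp Realizable.havoc_pos).congr fun w s t => ?_
  constructor
  · rintro ⟨u, ⟨-, h1⟩, h2⟩ j hj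
    rw [h2]
    exact h1 j (by simpa using hj)
  · intro h
    exact ⟨⟨s.pos, t.reg⟩, ⟨rfl, fun j hj => h j (by simpa using hj)⟩, rfl⟩

/-- A predicate of words and of registers is semidecidable if there is a flow chart that checks it;
the flow chart has to work for all large numbers `m` of registers and all positions of the
arguments among the first `k` registers, which it must not change. -/
def Semi {κ : Type*} (P : ∀ w : List α, (κ → Word w) → Prop) : Prop :=
  ∃ c, ∀ m k, k + c ≤ m → ∀ r : κ → Fin m, (∀ i, (r i : ℕ) < k) →
    Realizable fun w (s t : Store w m) => P w (fun i => s.reg (r i)) ∧ s.Agree k t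

namespace Semi

variable {κ κ' : Type*} {P Q : ∀ w : List α, (κ → Word w) → Prop}

theorem congr (h : Semi P) (e : ∀ w σ, P w σ ↔ Q w σ) : Semi Q := by
  obtain rfl : P = Q := by
    funext w s
    exact propext (e w s)
  exact h

theorem subst (h : Semi P) (f : κ → κ') :
    Semi fun w (σ : κ' → Word w) => P w fun i => σ (f i) := by
  obtain ⟨c, h⟩ := h
  exact ⟨c, fun m k hm r hr => h m k hm (fun i => r (f i)) fun i => hr _⟩

/-- Composition with `forget` brings a test into the form that `Semi` demands, in which the scratch
registers and the input head end up arbitrary. -/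
theorem of_test (h : ∀ m, ∀ r : κ → Fin m, Realizable fun w (s t : Store w m) =>
    t = s ∧ P w (fun i => s.reg (r i))) : Semi P := by
  refine ⟨0, fun m k _ r _ => ((h m r).comp (.forget k)).congr fun w s t => ?_⟩
  constructor
  · rintro ⟨u, ⟨rfl, h1⟩, h2⟩
    exact ⟨h1, h2⟩
  · rintro ⟨h1, h2⟩
    exact ⟨s, ⟨rfl, h1⟩, h2⟩

/-- The first check may spoil the scratch registers, but the arguments lie among the first `k`. The
second check finds them unchanged and can reuse the same scratch space. -/
theorem and (hP : Semi P) (hQ : Semi Q) : Semi fun w σ => P w σ ∧ Q w σ := by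
  obtain ⟨c, hP⟩ := hP
  obtain ⟨d, hQ⟩ := hQ
  refine ⟨c + d, fun m k hm r hr =>
    ((hP m k (by omega) r hr).comp (hQ m k (by omega) r hr)).congr fun w s t => ?_⟩
  constructor
  · rintro ⟨u, ⟨h1, h2⟩, h3, h4⟩
    rw [h2.reg hr] at h3
    exact ⟨⟨h1, h3⟩, h2.trans h4⟩
  · rintro ⟨⟨h1, h2⟩, h3⟩
    exact ⟨s, ⟨h1, .refl s⟩, h2, h3⟩

theorem or (hP : Semi P) (hQ : Semi Q) : Semi fun w σ => P w σ ∨ Q w σ := by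
  obtain ⟨c, hP⟩ := hP
  obtain ⟨d, hQ⟩ := hQ
  refine ⟨c + d, fun m k hm r hr =>
    ((hP m k (by omega) r hr).union (hQ m k (by omega) r hr)).congr fun w s t => ?_⟩
  tauto

theorem eq (i j : κ) : Semi fun (w : List α) (σ : κ → Word w) => σ i = σ j :=
  of_test fun m r => (Realizable.test_eq (fun _ : Unit => r i) fun _ => r j).congr
    fun w s t => by simp

theorem zero (i : κ) : Semi fun (w : List α) (σ : κ → Word w) => (σ i : ℕ) = 0 :=
  of_test fun _ r => Realizable.test_zero (r i)

theorem max (i : κ) : Semi fun (w : List α) (σ : κ → Word w) => (σ i : ℕ) + 1 = 2 ^ width w :=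
  of_test fun _ r => Realizable.test_max (r i)

theorem succ (i j : κ) : Semi fun (w : List α) (σ : κ → Word w) => (σ i : ℕ) + 1 = σ j :=
  of_test fun _ r => Realizable.test_succ (r i) (r j)

theorem true : Semi fun (w : List α) (_ : κ → Word w) => True :=
  of_test fun m r => (Realizable.columnwise_test fun _ => True).congr fun w s t => by simp

theorem false : Semi fun (w : List α) (_ : κ → Word w) => False :=
  of_test fun m r => (Realizable.columnwise_test fun _ => False).congr fun w s t => by
    have : 0 < width w := by simp [width, Nat.size_pos]
    simp only [imp_false, not_lt, and_false, iff_false, not_and, not_forall]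
    exact fun _ => ⟨0, by omega⟩

theorem const (p : Prop) : Semi fun (w : List α) (_ : κ → Word w) => p := by
  by_cases hp : p
  · exact true.congr fun _ _ => by simp [hp]
  · exact false.congr fun _ _ => by simp [hp]

/-- The witness is guessed into the registers following the first `k`. The chart for `P` then
protects these as well, and afterwards they are released. -/
theorem ex {ι : Type} [Fintype ι] {P : ∀ w : List α, (κ → Word w) → (ι → Word w) → Prop}
    (h : Semi fun w (σ : κ ⊕ ι → Word w) => P w (fun i => σ (.inl i)) fun i => σ (.inr i)) :
    Semi fun w σ => ∃ v, P w σ v := by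
  obtain ⟨c, h⟩ := h
  refine ⟨c + Fintype.card ι, fun m k hm r hr => ?_⟩
  have hk : k + Fintype.card ι ≤ m := by omega
  refine ((Realizable.forget k).comp ((h m (k + Fintype.card ι) (by omega)
    (Sum.elim r (slot k hk)) ?_).comp (.forget k))).congr fun w s t => ?_
  · rintro (i | i)
    · exact (hr i).trans_le (Nat.le_add_right _ _)
    · exact slot_lt hk i
  · simp only [Sum.elim_inl, Sum.elim_inr]
    constructor
    · rintro ⟨u, h1, v, ⟨h2, h3⟩, h4⟩
      rw [h1.reg hr] at h2
      exact ⟨⟨_, h2⟩, h1.trans ((h3.mono (Nat.le_add_right _ _)).trans h4)⟩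
    · rintro ⟨⟨v, h1⟩, h2⟩
      obtain ⟨u, -, hu, huv⟩ := s.exists_slot hk v
      have hsu : s.Agree k u := fun j hj => hu j (.inl hj)
      refine ⟨u, hsu, u, ⟨?_, .refl u⟩, hsu.symm.trans h2⟩
      rw [hsu.reg hr]
      simpa only [huv] using h1

/-- Only two tuples are stored: the current vertex of the path and a guess for the next one. The
loop is the iteration of the flow chart that performs one step. -/
theorem tc {ι : Type} [Fintype ι]
    {R : ∀ w : List α, (κ → Word w) → (ι → Word w) → (ι → Word w) → Prop}
    (h : Semi fun w (σ : (κ ⊕ ι) ⊕ ι → Word w) =>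
      R w (fun i => σ (.inl (.inl i))) (fun i => σ (.inl (.inr i))) fun i => σ (.inr i))
    (xs ys : ι → κ) :
    Semi fun w σ => ReflTransGen (R w σ) (fun i => σ (xs i)) fun i => σ (ys i) := by
  obtain ⟨c, h⟩ := h
  set n := Fintype.card ι with hn
  refine ⟨c + n + n, fun m k hm r hr => ?_⟩
  have hk : k + Fintype.card ι ≤ m := by omega
  have hk' : k + n + Fintype.card ι ≤ m := by omega
  let cur : ι → Fin m := slot k hk
  let nxt : ι → Fin m := slot (k + n) hk'
  have hcur : ∀ i, (cur i : ℕ) < k + n := slot_lt hk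
  have hnxt : ∀ i, (nxt i : ℕ) < k + n + n := slot_lt hk'
  -- Guess `nxt`, check `R`, then copy `nxt` to `cur` by giving `cur` arbitrary values and testing
  -- for equality.
  have step : Realizable fun w (s t : Store w m) =>
      R w (fun i => s.reg (r i)) (fun i => s.reg (cur i)) (fun i => t.reg (cur i)) ∧
        s.Agree k t := by
    refine ((Realizable.forget (k + n)).comp ((h m (k + n + n) (by omega)
      (Sum.elim (Sum.elim r cur) nxt) ?_).comp ((Realizable.havoc {j | ∃ i, cur i = j}).comp
      ((Realizable.test_eq cur nxt).comp (.forget (k + n)))))).congr fun w s t => ?_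
    · rintro ((i | i) | i)
      · exact (hr i).trans_le (by omega)
      · exact (hcur i).trans_le (by omega)
      · exact hnxt i
    · simp only [Sum.elim_inl, Sum.elim_inr]
      constructor
      · rintro ⟨u1, h1, u2, ⟨h2, h3⟩, u3, ⟨-, h4⟩, u4, ⟨rfl, h5⟩, h6⟩
        have h1' : s.Agree k u1 := h1.mono (by omega)
        have h3' : u1.Agree k u2 := h3.mono (by omega)
        have h4' : u2.Agree k u4 := fun j hj => h4 j fun ⟨i, hi⟩ => by
          have := le_slot hk i
          simp only [← hi, cur] at hj
          omega
        refine ⟨?_, h1'.trans (h3'.trans (h4'.trans (h6.mono (by omega))))⟩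
        have e : (fun i => t.reg (cur i)) = fun i => u1.reg (nxt i) := by
          funext i
          rw [h6 _ (hcur i), h5 i, h4, h3 _ (hnxt i)]
          rintro ⟨j, hj⟩
          have h7 := hcur j
          have h8 := le_slot hk' i
          rw [hj] at h7
          simp only [nxt] at h7
          omega
        rw [e, ← h1'.reg hr, ← h1.reg hcur]
        exact h2
      · rintro ⟨h1, h2⟩
        obtain ⟨u1, -, hu1, hu1'⟩ := s.exists_slot hk' fun i => t.reg (cur i)
        obtain ⟨u3, hp3, hu3, hu3'⟩ := u1.exists_slot hk fun i => t.reg (cur i)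
        have a1 : s.Agree (k + n) u1 := fun j hj => hu1 j (.inl hj)
        have a3 : u1.Agree k u3 := fun j hj => hu3 j (.inl hj)
        refine ⟨u1, a1, u1, ⟨?_, .refl _⟩, u3, ⟨hp3, ?_⟩, u3, ⟨rfl, ?_⟩, ?_⟩
        · rw [a1.reg hcur, (a1.mono (Nat.le_add_right _ _)).reg hr]
          simpa only [nxt, hu1'] using h1
        · intro j hj
          apply hu3
          by_contra hc
          apply hj
          refine ⟨(Fintype.equivFin ι).symm ⟨j - k, by omega⟩, Fin.ext ?_⟩
          simp only [cur, slot, Equiv.apply_symm_apply]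
          omega
        · intro i
          rw [hu3' i, hu3 _ (.inr (le_slot hk' i)), hu1' i]
        · intro j hj
          by_cases hjk : (j : ℕ) < k
          · rw [a3 j hjk, a1 j hj, h2 j hjk]
          · obtain ⟨i, rfl⟩ : ∃ i, cur i = j := by
              refine ⟨(Fintype.equivFin ι).symm ⟨j - k, by omega⟩, Fin.ext ?_⟩
              simp only [cur, slot, Equiv.apply_symm_apply]
              omega
            exact (hu3' i).symm
  refine ((Realizable.forget k).comp ((Realizable.test_eq cur fun i => r (xs i)).comp
    (step.star.comp ((Realizable.test_eq cur fun i => r (ys i)).comp (.forget k))))).congr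
    fun w s t => ?_
  constructor
  · rintro ⟨_, h1, u, ⟨rfl, h2⟩, _, h3, v, ⟨rfl, h4⟩, h5⟩
    have key : ReflTransGen (R w fun i => s.reg (r i)) (fun i => u.reg (cur i))
        (fun i => v.reg (cur i)) ∧ s.Agree k v := by
      clear h4 h5 h2
      induction h3 with
      | refl => exact ⟨.refl, h1⟩
      | tail _ h ih =>
        rw [ih.2.reg hr] at h
        exact ⟨ih.1.tail h.1, ih.2.trans h.2⟩
    refine ⟨?_, key.2.trans h5⟩
    have e1 : (fun i => u.reg (cur i)) = fun i => s.reg (r (xs i)) :=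
      funext fun i => (h2 i).trans (h1 _ (hr _))
    have e2 : (fun i => v.reg (cur i)) = fun i => s.reg (r (ys i)) :=
      funext fun i => (h4 i).trans (key.2 _ (hr _))
    beta_reduce
    rw [← e1, ← e2]
    exact key.1
  · rintro ⟨h1, h2⟩
    obtain ⟨u, -, hu, hu'⟩ := s.exists_slot hk fun i => s.reg (r (xs i))
    have hsu : s.Agree k u := fun j hj => hu j (.inl hj)
    refine ⟨u, hsu, u, ⟨rfl, fun i => (hu' i).trans (hsu _ (hr _)).symm⟩, ?_⟩
    have key : ∀ z, ReflTransGen (R w fun i => s.reg (r i)) (fun i => s.reg (r (xs i))) z →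
        ∃ v : Store w m, ReflTransGen (fun s t : Store w m =>
          R w (fun i => s.reg (r i)) (fun i => s.reg (cur i)) (fun i => t.reg (cur i)) ∧
            s.Agree k t) u v ∧ (∀ i, v.reg (cur i) = z i) ∧ s.Agree k v := by
      intro z hz
      induction hz with
      | refl => exact ⟨u, .refl, hu', hsu⟩
      | @tail y z _ hyz ih =>
        obtain ⟨v, hv1, hv2, hv3⟩ := ih
        obtain ⟨v', -, hv, hv'⟩ := v.exists_slot hk z
        have hvv : v.Agree k v' := fun j hj => hv j (.inl hj)
        refine ⟨v', hv1.tail ⟨?_, hvv⟩, hv', hv3.trans hvv⟩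
        rw [hv3.reg hr]
        simpa only [hv2, cur, hv'] using hyz
    obtain ⟨v, hv1, hv2, hv3⟩ := key _ h1
    exact ⟨v, hv1, v, ⟨rfl, fun i => (hv2 i).trans (hv3 _ (hr _)).symm⟩, hv3.symm.trans h2⟩

/-! ### Reading the input at a position held in a register -/

theorem readInput_min (w : List α) (p : ℕ) : readInput w (min p (w.length + 1)) = readInput w p := by
  rcases le_total p (w.length + 1) with h | h
  · rw [min_eq_left h]
  · rw [min_eq_right h]
    obtain ⟨p, rfl⟩ : ∃ q, p = q + 1 := ⟨p - 1, by omega⟩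
    simp only [readInput]
    rw [List.getElem?_eq_none (by omega), List.getElem?_eq_none (by omega)]

theorem readInput_eq_leftEnd {w : List α} {p : ℕ} : readInput w p = .leftEnd ↔ p = 0 := by
  cases p with
  | zero => simp [readInput]
  | succ p =>
    simp only [readInput]
    cases w[p]? <;> simp

/-- The position is found by walking: the register `c` counts the moves of the input head from the
left end marker until it equals the argument. At the right end marker the head stops while `c` may
still grow; by `readInput_min` the same symbol is read. -/
theorem input (i : κ) (a : InputSymbol α) :
    Semi fun (w : List α) (σ : κ → Word w) => readInput w (σ i) = a := by
  refine ⟨2, fun m k hm r hr => ?_⟩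
  let c : Fin m := ⟨k, by omega⟩
  let c' : Fin m := ⟨k + 1, by omega⟩
  have step : Realizable fun (w : List α) (s t : Store w m) => (s.reg c : ℕ) + 1 = t.reg c ∧
      (t.pos : ℕ) = min ((s.pos : ℕ) + 1) (w.length + 1) ∧ s.Agree k t := by
    -- There is no increment in place: the successor of `c` is guessed in `c'` and then copied back
    -- to `c`.
    refine ((Realizable.havoc {j | k + 1 ≤ (j : ℕ)}).comp ((Realizable.test_succ c c').comp
      ((Realizable.havoc {j | j = c}).comp ((Realizable.test_eq (fun _ : Unit => c)
      fun _ => c').comp ((Realizable.havoc {j | k + 1 ≤ (j : ℕ)}).comp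
      (Realizable.moveInput Set.univ .right)))))).congr fun w s t => ?_
    constructor
    · rintro ⟨_, ⟨p1, h1⟩, u1, ⟨rfl, h2⟩, _, ⟨p3, h3⟩, u2, ⟨rfl, h4⟩, u4, ⟨p5, h5⟩, -, h6, p6⟩
      have e1 : u1.reg c = s.reg c := h1 c (by simp [c])
      have e2 : u2.reg c' = u1.reg c' := h3 c' (by simp [c, c'])
      have e3 : u4.reg c = u2.reg c := h5 c (by simp [c])
      refine ⟨?_, ?_, ?_⟩
      · rw [h6, e3, h4 (), e2, ← h2, e1]
      · rw [p6, p5, p3, p1]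
        rfl
      · intro j hj
        rw [h6, h5 j (by simp; omega), h3 j (by simp [c, Fin.ext_iff]; omega),
          h1 j (by simp; omega)]
    · rintro ⟨h1, h2, h3⟩
      let u1 : Store w m := ⟨s.pos, fun j => if (j : ℕ) ≤ k then s.reg j else t.reg c⟩
      let u2 : Store w m := ⟨s.pos, fun j => if (j : ℕ) < k then s.reg j else t.reg c⟩
      refine ⟨u1, ⟨rfl, ?_⟩, u1, ⟨rfl, ?_⟩, u2, ⟨rfl, ?_⟩, u2, ⟨rfl, ?_⟩, ⟨s.pos, t.reg⟩, ⟨rfl, ?_⟩,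
        trivial, rfl, h2⟩
      · intro j hj
        simp only [Set.mem_ofPred_eq, not_le] at hj
        simp [u1, Nat.lt_succ_iff.1 hj]
      · simp [u1, c, c', ← h1]
      · intro j hj
        have : (j : ℕ) ≠ k := fun h => hj (Fin.ext h)
        simp only [u1, u2]
        by_cases hjk : (j : ℕ) < k
        · simp [hjk, hjk.le]
        · have : ¬ (j : ℕ) ≤ k := by omega
          simp [hjk, this]
      · simp [u2, c, c']
      · intro j hj
        simp only [Set.mem_ofPred_eq, not_le] at hj
        by_cases hjk : (j : ℕ) < k
        · simp [u2, hjk, h3 j hjk]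
        · have : j = c := Fin.ext (by simp only [c]; omega)
          simp [u2, this, c]
  refine ((Realizable.forget k).comp ((Realizable.test_zero c).comp
    ((Realizable.moveInput {.leftEnd} .stay).comp (step.star.comp
    ((Realizable.test_eq (fun _ : Unit => c) fun _ => r i).comp
    ((Realizable.moveInput {a} .stay).comp (.forget k)))))) ).congr fun w s t => ?_
  constructor
  · rintro ⟨_, h1, u1, ⟨rfl, h2⟩, u2, ⟨h3, h4, h5⟩, _, h6, u3, ⟨rfl, h7⟩, u4, ⟨h8, h9, -⟩, h10⟩
    have key : (u3.pos : ℕ) = min (u3.reg c : ℕ) (w.length + 1) ∧ s.Agree k u3 := by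
      clear h7 h8 h9 h10
      induction h6 with
      | refl =>
        rw [Set.mem_singleton_iff, readInput_eq_leftEnd] at h3
        refine ⟨?_, fun j hj => h4 ▸ h1 j hj⟩
        rw [h5, h4, h2, h3]
        rfl
      | tail _ h ih =>
        refine ⟨?_, ih.2.trans h.2.2⟩
        rw [h.2.1, ← h.1, ih.1]
        omega
    refine ⟨?_, key.2.trans fun j hj => h9 ▸ h10 j hj⟩
    rw [← h8, key.1, readInput_min, h7 (), key.2 _ (hr i)]
  · rintro ⟨h1, h2⟩
    let u : ℕ → Store w m := fun n => ⟨⟨min n (w.length + 1), by omega⟩, fun j =>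
      if (j : ℕ) < k then s.reg j else if h : n < 2 ^ width w then ⟨n, h⟩ else s.reg j⟩
    have hu : ∀ n, s.Agree k (u n) := fun n j hj => by simp [u, hj]
    have hc : ∀ n, n < 2 ^ width w → ((u n).reg c : ℕ) = n := fun n hn => by simp [u, c, hn]
    have key : ∀ n, n < 2 ^ width w → ReflTransGen (fun s t : Store w m =>
        (s.reg c : ℕ) + 1 = t.reg c ∧
        (t.pos : ℕ) = min ((s.pos : ℕ) + 1) (w.length + 1) ∧ s.Agree k t) (u 0) (u n) := by
      intro n
      induction n with
      | zero => exact fun _ => .refl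
      | succ n ih =>
        intro hn
        refine (ih (by omega)).tail ⟨?_, ?_, (hu n).symm.trans (hu _)⟩
        · rw [hc _ hn, hc _ (by omega)]
        · simp only [u]
          omega
    have hx := (s.reg (r i)).2
    refine ⟨u 0, hu 0, u 0, ⟨rfl, hc 0 (by omega)⟩, u 0, ⟨?_, rfl, ?_⟩, u (s.reg (r i)),
      key _ hx, u (s.reg (r i)), ⟨rfl, fun _ => ?_⟩, u (s.reg (r i)), ⟨?_, rfl, ?_⟩,
      (hu _).symm.trans h2⟩
    · rfl
    · simp [u, Move.apply]
    · rw [hu _ _ (hr i)]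
      exact Fin.ext (hc _ hx)
    · simp only [Set.mem_singleton_iff, u, readInput_min]
      exact h1
    · simp [u, Move.apply]

end Semi

end SpaceComplexity

/-! ### Turing machines for semidecidable predicates -/

namespace SpaceComplexity

open Relation

variable {α : Type}

instance (m : ℕ) : Finite (TrackSymbol m) := by
  refine Finite.of_injective (β := Option (Option (Fin m → Bool)))
    (fun | .left => none | .blank => some none | .col c => some (some c)) ?_
  rintro (_ | _ | c) (_ | _ | d) h <;> simp_all

/-- The transitions of a machine that first lays off as many columns as the binary representation
of the length of the input needs, by counting the positions of the input head, and then runs a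
flow chart. -/
inductive MachineEdge {m : ℕ} (F : Flow α m) : Fin 3 ⊕ F.State → InputSymbol α → TrackSymbol m →
    Fin 3 ⊕ F.State → Move → TrackSymbol m → Move → Prop
  | init (i : InputSymbol α) : MachineEdge F (.inl 0) i .blank (.inl 1) .stay .left .right
  | carry (i : InputSymbol α) : MachineEdge F (.inl 1) i (.col fun _ => true) (.inl 1) .stay
      (.col fun _ => false) .right
  | set (i : InputSymbol α) : MachineEdge F (.inl 1) i (.col fun _ => false) (.inl 2) .stay
      (.col fun _ => true) .left
  | extend (i : InputSymbol α) : MachineEdge F (.inl 1) i .blank (.inl 2) .stay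
      (.col fun _ => true) .left
  | back (i : InputSymbol α) (c : Fin m → Bool) : MachineEdge F (.inl 2) i (.col c) (.inl 2) .stay
      (.col c) .left
  | next (i : InputSymbol α) (h : i ≠ .rightEnd) : MachineEdge F (.inl 2) i .left (.inl 1) .right
      .left .right
  | enter : MachineEdge F (.inl 2) .rightEnd .left (.inr F.entry) .stay .left .stay
  | empty (i : InputSymbol α) (a : TrackSymbol m) {p q} (h : F.edge p none q) :
      MachineEdge F (.inr p) i a (.inr q) .stay a .stay
  | act (a : Act α m) {p q} (h : F.edge p (some a) q) (ha : a.Safe) :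
      MachineEdge F (.inr p) a.input a.read (.inr q) a.inputMove a.write a.move

/-- The Turing machine that runs a flow chart. -/
def Flow.machine {m : ℕ} (F : Flow α m) : NTM α where
  State := Fin 3 ⊕ F.State
  Symbol := TrackSymbol m
  Work := Unit
  finite_State := by
    have := F.finite_State
    infer_instance
  blank := .blank
  start := .inl 0
  accept := {.inr F.exit}
  trans q i a := {x | MachineEdge F q i (a ()) x.1 x.2.1 (x.2.2 ()).1 (x.2.2 ()).2}

namespace Flow

variable {m : ℕ} (F : Flow α m)

/-- A configuration of the machine of a flow chart. -/
def cfg (x : (Fin 3 ⊕ F.State) × Raw m) : F.machine.Cfg where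
  state := x.1
  inputHead := x.2.inputHead
  tape := fun _ => x.2.tape
  head := fun _ => x.2.head

/-- The step relation of the machine of a flow chart. -/
def MachineStep (w : List α) (x y : (Fin 3 ⊕ F.State) × Raw m) : Prop :=
  ∃ v a u, MachineEdge F x.1 (readInput w x.2.inputHead) (x.2.tape x.2.head) y.1 v a u ∧
    y.2 = ⟨min (v.apply x.2.inputHead) (w.length + 1), Function.update x.2.tape x.2.head a,
      u.apply x.2.head⟩

theorem machine_step_iff (w : List α) (x : (Fin 3 ⊕ F.State) × Raw m) (d : F.machine.Cfg) :
    F.machine.Step w (F.cfg x) d ↔ ∃ y, d = F.cfg y ∧ F.MachineStep w x y := by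
  constructor
  · rintro ⟨q, v, act, h, rfl⟩
    exact ⟨(q, ⟨_, _, _⟩), rfl, v, _, _, h, rfl⟩
  · rintro ⟨⟨y1, y2⟩, rfl, v, a, u, h, hy⟩
    dsimp only at hy
    subst hy
    exact ⟨y1, v, fun _ => (a, u), h, rfl⟩

theorem machine_reachable_iff (w : List α) (d : F.machine.Cfg) :
    F.machine.Reachable w d ↔ ∃ y, d = F.cfg y ∧
      ReflTransGen (F.MachineStep w) (.inl 0, ⟨0, fun _ => .blank, 0⟩) y := by
  constructor
  · intro h
    induction h with
    | refl => exact ⟨_, rfl, .refl⟩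
    | tail _ h ih =>
      obtain ⟨y, rfl, hy⟩ := ih
      obtain ⟨z, rfl, hz⟩ := (F.machine_step_iff w y _).1 h
      exact ⟨z, rfl, hy.tail hz⟩
  · rintro ⟨y, rfl, hy⟩
    exact ReflTransGen.lift (r := F.MachineStep w) (p := F.machine.Step w) F.cfg
      (fun x y h => (F.machine_step_iff w x _).2 ⟨y, rfl, h⟩) _ _ hy

end Flow

/-! ### The binary counter that measures the input -/

theorem testBit_add_one {i v : ℕ} (h1 : ∀ j < i, v.testBit j = true) (h2 : v.testBit i = false)
    (j : ℕ) : (v + 1).testBit j = if j < i then false else if j = i then true else v.testBit j := by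
  induction i generalizing v j with
  | zero =>
    rw [Nat.testBit_zero, decide_eq_false_iff_not] at h2
    cases j with
    | zero => simp; omega
    | succ j =>
      rw [Nat.testBit_add_one, Nat.testBit_add_one]
      have : (v + 1) / 2 = v / 2 := by omega
      simp [this]
  | succ i ih =>
    have h0 := h1 0 (by omega)
    rw [Nat.testBit_zero, decide_eq_true_iff] at h0
    cases j with
    | zero => simp; omega
    | succ j =>
      have : (v + 1) / 2 = v / 2 + 1 := by omega
      rw [Nat.testBit_add_one, Nat.testBit_add_one, this, ih]
      · simp
      · intro k hk
        rw [← Nat.testBit_add_one]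
        exact h1 (k + 1) (by omega)
      · rw [← Nat.testBit_add_one]
        exact h2

/-- Only a number whose digits are all ones becomes longer when one is added. -/
theorem size_add_one_of_testBit {i v : ℕ} (h : v.testBit i = false) (hi : i < v.size) :
    (v + 1).size = v.size := by
  apply le_antisymm _ (Nat.size_le_size (Nat.le_succ v))
  rw [Nat.size_le]
  have h1 : v < 2 ^ v.size := Nat.lt_size_self v
  by_contra h2
  have h3 : v = 2 ^ v.size - 1 := by omega
  have h4 := Nat.testBit_two_pow_sub_one v.size i
  rw [← h3, h] at h4
  simp [hi] at h4

theorem size_add_one_of_ones {v : ℕ} (h : ∀ j < v.size, v.testBit j = true) :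
    (v + 1).size = v.size + 1 := by
  have h3 : v = 2 ^ v.size - 1 := by
    apply Nat.eq_of_testBit_eq
    intro j
    rw [Nat.testBit_two_pow_sub_one]
    by_cases hj : j < v.size
    · simp [hj, h j hj]
    · simp only [hj, decide_false]
      exact Nat.testBit_lt_two_pow
        ((Nat.lt_size_self v).trans_le (Nat.pow_le_pow_right (by norm_num) (by omega)))
  have h4 : v + 1 = 2 ^ v.size := by
    have := Nat.one_le_two_pow (n := v.size)
    omega
  rw [h4, Nat.size_pow]

section Invariant

variable {m : ℕ} (F : Flow α m) (w : List α)

/-- The tape that holds the number `v` on every track, where the first `i` bits are cleared. -/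
def counterTape (m v i : ℕ) : ℕ → TrackSymbol m :=
  columns v.size fun j _ => if j < i then false else v.testBit j

/-- The store after the preparation of the work tape. -/
def startStore (m : ℕ) : Store w m where
  pos := ⟨w.length + 1, by omega⟩
  reg := fun _ => ⟨w.length + 2, Nat.lt_size_self _⟩

theorem startStore_raw : (startStore w m).raw =
    ⟨w.length + 1, counterTape m (w.length + 2) 0, 0⟩ := by
  simp only [Store.raw, counterTape, startStore, width]
  rfl

theorem counterTape_carry {v i : ℕ} (hi : i < v.size) :
    Function.update (counterTape m v i) (i + 1) (.col fun _ => false) =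
      counterTape m v (i + 1) := by
  rw [counterTape, update_columns _ _ hi, counterTape]
  congr 1
  funext j k
  rcases lt_trichotomy j i with h | rfl | h
  · simp [Function.update_of_ne h.ne, h, h.trans (Nat.lt_succ_self i)]
  · simp
  · simp [Function.update_of_ne h.ne', h.not_gt, Nat.not_lt.2 h]

theorem counterTape_set {v i : ℕ} (hi : i < v.size) (h1 : ∀ j < i, v.testBit j = true)
    (h2 : v.testBit i = false) :
    Function.update (counterTape m v i) (i + 1) (.col fun _ => true) =
      counterTape m (v + 1) 0 := by
  rw [counterTape, update_columns _ _ hi, counterTape, size_add_one_of_testBit h2 hi]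
  congr 1
  funext j k
  rw [testBit_add_one h1 h2]
  rcases lt_trichotomy j i with h | rfl | h
  · simp [Function.update_of_ne h.ne, h]
  · simp
  · simp [h.not_gt, h.ne']

theorem counterTape_extend {v : ℕ} (h1 : ∀ j < v.size, v.testBit j = true) :
    Function.update (counterTape m v v.size) (v.size + 1) (.col fun _ => true) =
      counterTape m (v + 1) 0 := by
  have h2 : v.testBit v.size = false := Nat.testBit_lt_two_pow (Nat.lt_size_self v)
  funext j
  cases j with
  | zero => simp [counterTape, columns]
  | succ j =>
    rcases lt_trichotomy j v.size with h | rfl | h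
    · rw [Function.update_of_ne (by omega), counterTape, counterTape, size_add_one_of_ones h1,
        columns_succ_of_lt _ h, columns_succ_of_lt _ (by omega)]
      simp [h, testBit_add_one h1 h2]
    · rw [Function.update_self, counterTape, size_add_one_of_ones h1,
        columns_succ_of_lt _ (Nat.lt_succ_self _)]
      simp [testBit_add_one h1 h2]
    · rw [Function.update_of_ne (by omega), counterTape, counterTape, size_add_one_of_ones h1,
        columns_succ_of_le _ h.le, columns_succ_of_le _ h]

/-- The invariant of the machine of a flow chart. -/
inductive MachineInv : Fin 3 ⊕ F.State → Raw m → Prop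
  | init {y} (hy : y = ⟨0, fun _ => .blank, 0⟩) : MachineInv (.inl 0) y
  | carry {y} (v i : ℕ) (hv : v ≤ w.length + 1) (hi : i ≤ v.size)
      (h : ∀ j < i, v.testBit j = true) (hy : y = ⟨v, counterTape m v i, i + 1⟩) :
      MachineInv (.inl 1) y
  | back {y} (v i : ℕ) (hv : v ≤ w.length + 1) (hi : i ≤ (v + 1).size)
      (hy : y = ⟨v, counterTape m (v + 1) 0, i⟩) : MachineInv (.inl 2) y
  | run {y q} (c : ℕ → Fin m → Bool) (p i : ℕ) (hp : p ≤ w.length + 1) (hi : i ≤ width w + 1)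
      (hy : y = ⟨p, columns (width w) c, i⟩)
      (h : ReflTransGen (F.Step w) (F.entry, (startStore w m).raw) (q, y)) : MachineInv (.inr q) y

variable {F w}

/-- The space bound concerns every computation, so the shape of the tape is followed through all
nondeterministic choices. While the flow chart runs, safety of its instructions keeps the end
markers in place, hence the head never passes the first blank. -/
theorem MachineInv.step (hm : 0 < m) {x y : (Fin 3 ⊕ F.State) × Raw m} (inv : MachineInv F w x.1 x.2)
    (h : F.MachineStep w x y) : MachineInv F w y.1 y.2 := by
  obtain ⟨x1, x2⟩ := x
  obtain ⟨y1, y2⟩ := y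
  obtain ⟨v, a, u, h, hy⟩ := h
  dsimp only at inv h hy ⊢
  subst hy
  generalize hI : readInput w x2.inputHead = I at h
  generalize hS : x2.tape x2.head = S at h
  cases h with
  | init i =>
    obtain ⟨rfl⟩ := inv
    refine .carry 0 0 (Nat.zero_le _) (Nat.zero_le _) (by simp) ?_
    simp only [Move.apply, Raw.mk.injEq, and_true]
    refine ⟨by simp, ?_⟩
    funext j
    cases j <;> simp [counterTape, columns]
  | carry i =>
    obtain _ | ⟨v, i, hv, hi, h, rfl⟩ := inv
    dsimp only at hS hI
    rcases hi.lt_or_eq with hi | rfl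
    · rw [counterTape, columns_succ_of_lt _ hi] at hS
      simp only [lt_irrefl, if_false, TrackSymbol.col.injEq] at hS
      refine .carry v (i + 1) hv hi (fun j hj => ?_) ?_
      · rcases Nat.lt_succ_iff_lt_or_eq.1 hj with hj | rfl
        · exact h j hj
        -- Without tracks a column of ones and a column of zeros would be the same symbol; `hm`
        -- provides a track on which they differ.
        · exact congrFun hS ⟨0, hm⟩
      · simp only [Move.apply, counterTape_carry hi, min_eq_left hv]
    · rw [counterTape, columns_succ_of_le _ le_rfl] at hS
      exact nomatch hS
  | set i =>
    obtain _ | ⟨v, i, hv, hi, h, rfl⟩ := inv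
    dsimp only at hS hI
    rcases hi.lt_or_eq with hi | rfl
    · rw [counterTape, columns_succ_of_lt _ hi] at hS
      simp only [lt_irrefl, if_false, TrackSymbol.col.injEq] at hS
      have hb : v.testBit i = false := congrFun hS ⟨0, hm⟩
      refine .back v i hv ?_ ?_
      · rw [size_add_one_of_testBit hb hi]
        exact hi.le
      · simp only [Move.apply, counterTape_set hi h hb, min_eq_left hv, Nat.add_sub_cancel]
    · rw [counterTape, columns_succ_of_le _ le_rfl] at hS
      exact nomatch hS
  | extend i =>
    obtain _ | ⟨v, i, hv, hi, h, rfl⟩ := inv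
    dsimp only at hS hI
    rcases hi.lt_or_eq with hi | rfl
    · rw [counterTape, columns_succ_of_lt _ hi] at hS
      exact nomatch hS
    · refine .back v v.size hv (Nat.size_le_size (Nat.le_succ v)) ?_
      simp only [Move.apply, counterTape_extend h, min_eq_left hv, Nat.add_sub_cancel]
  | back i c =>
    obtain _ | _ | ⟨v, i, hv, hi, rfl⟩ := inv
    dsimp only at hS hI
    refine .back v (i - 1) hv (by omega) ?_
    simp only [Move.apply, min_eq_left hv]
    rw [← hS, Function.update_eq_self]
  | next i hne =>
    obtain _ | _ | ⟨v, i, hv, hi, rfl⟩ := inv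
    dsimp only at hS hI
    have hv' : v + 1 ≤ w.length + 1 := by
      by_contra hc
      obtain rfl : v = w.length + 1 := by omega
      apply hne
      rw [← hI]
      simp [readInput]
    cases i with
    | zero =>
      refine .carry (v + 1) 0 hv' (Nat.zero_le _) (by simp) ?_
      simp only [Move.apply, min_eq_left hv']
      rw [← hS, Function.update_eq_self]
    | succ i =>
      rw [counterTape, columns_succ_of_lt _ hi] at hS
      exact nomatch hS
  | enter =>
    obtain _ | _ | ⟨v, i, hv, hi, rfl⟩ := inv
    dsimp only at hS hI
    have hv' : v = w.length + 1 := by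
      cases v with
      | zero => exact nomatch hI
      | succ v =>
        simp only [readInput] at hI
        by_contra hc
        rw [List.getElem?_eq_getElem (by omega)] at hI
        exact nomatch hI
    subst hv'
    cases i with
    | zero =>
      refine .run (fun j _ => if j < 0 then false else (w.length + 2).testBit j) (w.length + 1) 0
        le_rfl (Nat.zero_le _) ?_ ?_
      · simp only [Move.apply, min_self]
        rw [← hS, Function.update_eq_self]
        rfl
      · rw [startStore_raw]
        simp only [Move.apply, min_self]
        rw [← hS, Function.update_eq_self]
    | succ i =>
      rw [counterTape, columns_succ_of_lt _ hi] at hS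
      exact nomatch hS
  | @empty i S p q hpq =>
    obtain _ | _ | _ | ⟨c, p', i, hp, hi, rfl, h⟩ := inv
    dsimp only at hS hI
    rw [← hS, Function.update_eq_self]
    simp only [Move.apply, min_eq_left hp]
    exact .run c p' i hp hi rfl (h.tail (Flow.Step.mk hpq rfl))
  | @act a p q hpq ha =>
    obtain _ | _ | _ | ⟨c, p', i, hp, hi, rfl, h⟩ := inv
    dsimp only at hS hI
    have hx : a.Exec w ⟨p', columns (width w) c, i⟩ ⟨min (a.inputMove.apply p') (w.length + 1),
        Function.update (columns (width w) c) i a.write, a.move.apply i⟩ :=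
      ⟨ha, hI.symm, hS.symm, rfl⟩
    have hr := h.tail (Flow.Step.mk (q := q) hpq hx)
    have key : ∃ c', Function.update (columns (width w) c) i a.write = columns (width w) c' ∧
        a.move.apply i ≤ width w + 1 := by
      have hmove : ∀ u : Move, i ≤ width w → u.apply i ≤ width w + 1 := by
        rintro (_ | _ | _) h <;> simp only [Move.apply] <;> omega
      cases i with
      | zero =>
        have hS' : a.read = .left := hS.symm
        simp only [Act.Safe, hS'] at ha
        exact ⟨c, by rw [ha, update_columns_zero], hmove _ (Nat.zero_le _)⟩
      | succ i =>
        by_cases hil : i < width w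
        · have hS' : a.read = .col (c i) := by rw [← hS, columns_succ_of_lt _ hil]
          simp only [Act.Safe, hS'] at ha
          obtain ⟨b, hb⟩ := ha
          exact ⟨_, by rw [hb, update_columns _ _ hil], hmove _ hil⟩
        · have hS' : a.read = .blank := by rw [← hS, columns_succ_of_le _ (by omega)]
          simp only [Act.Safe, hS'] at ha
          refine ⟨c, ?_, ?_⟩
          · rw [ha.1, ← hS', ← hS, Function.update_eq_self]
          · obtain ⟨-, ha⟩ := ha
            generalize a.move = u at ha
            cases u
            · simp only [Move.apply]
              omega
            · exact hi
            · exact absurd rfl ha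
    obtain ⟨c', h1, h2⟩ := key
    refine .run c' (min (a.inputMove.apply p') (w.length + 1)) (a.move.apply i) (min_le_right _ _) h2
      ?_ hr
    simp only [h1]

theorem MachineStep.mk {p q : Fin 3 ⊕ F.State} {h i : ℕ} {f : ℕ → TrackSymbol m}
    {I : InputSymbol α} {S a : TrackSymbol m} {v u : Move} {z : Raw m}
    (e : MachineEdge F p I S q v a u) (hI : readInput w h = I) (hS : f i = S)
    (hz : z = ⟨min (v.apply h) (w.length + 1), Function.update f i a, u.apply i⟩) :
    F.MachineStep w (p, ⟨h, f, i⟩) (q, z) := by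
  subst hI hS
  exact ⟨v, a, u, e, hz⟩

/-- Here `n` is the number of digits that the carry has not yet passed. If it passes all of them, a
new column is laid off. -/
theorem carry_run {v : ℕ} (hv : v ≤ w.length + 1) (n : ℕ) : ∀ i, i + n = v.size →
    (∀ j < i, v.testBit j = true) → ∃ k ≤ (v + 1).size,
      ReflTransGen (F.MachineStep w) (.inl 1, ⟨v, counterTape m v i, i + 1⟩)
        (.inl 2, ⟨v, counterTape m (v + 1) 0, k⟩) := by
  induction n with
  | zero =>
    rintro i rfl h
    refine ⟨v.size, Nat.size_le_size (Nat.le_succ v),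
      .single (MachineStep.mk (.extend _) rfl (columns_succ_of_le _ le_rfl) ?_)⟩
    rw [Nat.add_zero, counterTape_extend h]
    simp only [Move.apply, min_eq_left hv]
    rfl
  | succ n ih =>
    intro i hi h
    have hil : i < v.size := by omega
    cases hb : v.testBit i with
    | true =>
      obtain ⟨k, hk, hr⟩ := ih (i + 1) (by omega) fun j hj => by
        rcases Nat.lt_succ_iff_lt_or_eq.1 hj with hj | rfl
        · exact h j hj
        · exact hb
      refine ⟨k, hk, .head (MachineStep.mk (.carry _) rfl ?_ ?_) hr⟩
      · rw [counterTape, columns_succ_of_lt _ hil]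
        simp [hb]
      · simp only [Move.apply, counterTape_carry hil, min_eq_left hv]
    | false =>
      refine ⟨i, ?_, .single (MachineStep.mk (.set _) rfl ?_ ?_)⟩
      · rw [size_add_one_of_testBit hb hil]
        exact hil.le
      · rw [counterTape, columns_succ_of_lt _ hil]
        simp [hb]
      · simp only [Move.apply, counterTape_set hil h hb, min_eq_left hv]
        rfl

theorem back_run {v u : ℕ} (hv : v ≤ w.length + 1) (k : ℕ) (hk : k ≤ u.size) :
    ReflTransGen (F.MachineStep w) (.inl 2, ⟨v, counterTape m u 0, k⟩)
      (.inl 2, ⟨v, counterTape m u 0, 0⟩) := by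
  induction k with
  | zero => exact .refl
  | succ k ih =>
    have hr : counterTape m u 0 (k + 1) = _ := columns_succ_of_lt _ hk
    refine .head (MachineStep.mk (.back _ _) rfl hr ?_) (ih (by omega))
    rw [← hr, Function.update_eq_self]
    simp only [Move.apply, min_eq_left hv]
    rfl

/-- One increment is made for each cell visited by the input head, including cell `0`, so the
counter is one ahead of the position. At the right end marker it shows `w.length + 2`, whose binary
length is `width w`. -/
theorem count_run (v : ℕ) (hv : v ≤ w.length + 1) :
    ReflTransGen (F.MachineStep w) (.inl 0, ⟨0, fun _ => .blank, 0⟩)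
      (.inl 2, ⟨v, counterTape m (v + 1) 0, 0⟩) := by
  have next : ∀ u ≤ w.length + 1, ReflTransGen (F.MachineStep w)
      (.inl 1, ⟨u, counterTape m u 0, 1⟩) (.inl 2, ⟨u, counterTape m (u + 1) 0, 0⟩) := by
    intro u hu
    obtain ⟨k, hk, hr⟩ := carry_run (F := F) hu u.size 0 (by omega) (by simp)
    exact hr.trans (back_run hu k hk)
  induction v with
  | zero =>
    refine .head (MachineStep.mk (.init _) rfl rfl ?_) (next 0 hv)
    simp only [Move.apply, Raw.mk.injEq, and_true]
    refine ⟨by simp, ?_⟩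
    funext j
    cases j <;> simp [counterTape, columns]
  | succ v ih =>
    have hr : counterTape m (v + 1) 0 0 = .left := rfl
    refine (ih (by omega)).trans (.head (MachineStep.mk (.next _ ?_) rfl hr ?_) (next (v + 1) hv))
    · cases v with
      | zero => exact nofun
      | succ v =>
        simp only [readInput]
        rw [List.getElem?_eq_getElem (by omega)]
        exact nofun
    · rw [← hr, Function.update_eq_self]
      simp only [Move.apply, min_eq_left hv]

theorem start_run :
    ReflTransGen (F.MachineStep w) (.inl 0, ⟨0, fun _ => .blank, 0⟩)
      (.inr F.entry, (startStore w m).raw) := by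
  refine (count_run (w.length + 1) le_rfl).tail (MachineStep.mk .enter ?_ rfl ?_)
  · simp [readInput]
  · rw [startStore_raw]
    have hr : counterTape m (w.length + 2) 0 0 = .left := rfl
    rw [← hr, Function.update_eq_self]
    simp only [Move.apply, min_self]

theorem flow_run {y : F.State × Raw m}
    (h : ReflTransGen (F.Step w) (F.entry, (startStore w m).raw) y) :
    ReflTransGen (F.MachineStep w) (.inr F.entry, (startStore w m).raw) (.inr y.1, y.2) ∧
      y.2.inputHead ≤ w.length + 1 := by
  induction h with
  | refl => exact ⟨.refl, le_rfl⟩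
  | @tail y z _ hyz ih =>
    obtain ⟨y1, p, f, i⟩ := y
    obtain ⟨z1, z2⟩ := z
    obtain ⟨o, ho, hx⟩ := hyz
    cases o with
    | none =>
      simp only [execOption] at hx
      subst hx
      refine ⟨ih.1.tail (MachineStep.mk (.empty _ _ ho) rfl rfl ?_), ih.2⟩
      rw [Function.update_eq_self]
      simp only [Move.apply, min_eq_left ih.2]
    | some a =>
      obtain ⟨hs, h1, h2, hx⟩ := hx
      dsimp only at h1 h2 hx ⊢
      subst hx
      exact ⟨ih.1.tail (MachineStep.mk (.act a ho hs) h1.symm h2.symm rfl), min_le_right _ _⟩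

theorem MachineInv.head_le {q : Fin 3 ⊕ F.State} {y : Raw m} (h : MachineInv F w q y) :
    y.head ≤ width w + 1 := by
  cases h with
  | init hy => simp [hy]
  | carry v i hv hi h hy =>
    have := Nat.size_le_size (show v ≤ w.length + 2 by omega)
    simp only [hy, width]
    omega
  | back v i hv hi hy =>
    have := Nat.size_le_size (show v + 1 ≤ w.length + 2 by omega)
    simp only [hy, width]
    omega
  | run c p i hp hi hy h => simpa [hy] using hi

theorem width_le (w : List α) : width w ≤ Nat.log 2 w.length + 3 := by
  rw [width, Nat.size_le]
  have h1 := Nat.lt_pow_succ_log_self (b := 2) (by norm_num) w.length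
  have h2 := Nat.one_le_two_pow (n := Nat.log 2 w.length)
  simp only [pow_succ] at h1 ⊢
  omega

end Invariant

theorem Semi.mem_NL [Finite α] {P : ∀ w : List α, (Empty → Word w) → Prop} (h : Semi P) :
    {w | P w fun i => i.elim} ∈ NL α := by
  obtain ⟨c, h⟩ := h
  -- One register more than required makes the number of tracks positive, as the counting phase
  -- needs.
  obtain ⟨F, hF⟩ := h (c + 1) 0 (by omega) (fun i => i.elim) fun i => i.elim
  have inv : ∀ w y, ReflTransGen (F.MachineStep w) (.inl 0, ⟨0, fun _ => .blank, 0⟩) y →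
      MachineInv F w y.1 y.2 := by
    intro w y hy
    induction hy with
    | refl => exact .init rfl
    | tail _ h ih => exact ih.step (Nat.succ_pos c) h
  -- The head position is at most `width w + 1`, hence at most `Nat.log 2 w.length + 4`, which is
  -- less than five times `Nat.log 2 w.length + 1`.
  refine ⟨F.machine, 5, ?_, fun w => ?_⟩
  · intro w d hd i
    obtain ⟨y, rfl, hy⟩ := (F.machine_reachable_iff w d).1 hd
    have h1 := (inv w y hy).head_le
    have h2 := width_le w
    change y.2.head < _
    dsimp only
    omega
  · have e : ∀ s : Store w (c + 1), (fun i : Empty => s.reg i.elim) = fun i => i.elim :=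
      fun s => funext fun i => i.elim
    constructor
    · intro hw
      have hr := (hF w (startStore w (c + 1)) (startStore w (c + 1)).raw).2
        ⟨_, rfl, by rw [e]; exact hw, .refl _⟩
      refine ⟨F.cfg (.inr F.exit, (startStore w (c + 1)).raw), ?_, rfl⟩
      exact (F.machine_reachable_iff w _).2 ⟨_, rfl, start_run.trans (flow_run hr).1⟩
    · rintro ⟨d, hd, hacc⟩
      obtain ⟨⟨q, y⟩, rfl, hy⟩ := (F.machine_reachable_iff w d).1 hd
      have hq : q = .inr F.exit := hacc
      subst hq
      obtain _ | _ | _ | ⟨c', p, i, hp, hi, hy, hrun⟩ := inv w _ hy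
      obtain ⟨t, -, ht, -⟩ := (hF w (startStore w (c + 1)) y).1 hrun
      rw [e] at ht
      exact ht

end SpaceComplexity

/-! ### Inductive counting -/

namespace SpaceComplexity

open Relation

section Counting

variable {V : Type*} {N : ℕ} (e : V ≃ Fin N) (S : V → V → Prop) (x : V)

/-- The vertices reachable from `x` in at most `d` steps. -/
def Within : ℕ → V → Prop
  | 0, v => v = x
  | d + 1, v => Within d v ∨ ∃ u, Within d u ∧ S u v

/-- `Within` as reachability of pairs. -/
def WithinStep (p q : V × V) : Prop :=
  (e p.1 : ℕ) + 1 = e q.1 ∧ (q.2 = p.2 ∨ S p.2 q.2)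

/-- Counting: a set of `c` elements that satisfy `A`, all others satisfying `B`. -/
def CountSplit (A B : V → Prop) (c : V) : Prop :=
  ∃ U : Finset V, (∀ v ∈ U, A v) ∧ (∀ v ∉ U, B v) ∧ U.card = e c

/-- `CountSplit` as reachability of pairs. -/
def CountStep (A B : V → Prop) (p q : V × V) : Prop :=
  (e p.1 : ℕ) + 1 = e q.1 ∧
    ((B q.1 ∧ q.2 = p.2) ∨ (A q.1 ∧ (e p.2 : ℕ) + 1 = e q.2))

variable {e S x}

/-- The depth is stored as the vertex with that number. Each step raises it by one and may leave the
vertex unchanged, so all distances up to the depth are covered. -/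
theorem within_iff {z d v : V} (hz : (e z : ℕ) = 0) :
    ReflTransGen (WithinStep e S) (z, x) (d, v) ↔ Within S x (e d) v := by
  constructor
  · have key : ∀ p : V × V, ReflTransGen (WithinStep e S) (z, x) p → Within S x (e p.1) p.2 := by
      intro p h
      induction h with
      | refl => rw [hz]; rfl
      | @tail p q _ h ih =>
        rw [← h.1]
        rcases h.2 with h | h
        · rw [h]; exact .inl ih
        · exact .inr ⟨_, ih, h⟩
    exact key _
  · generalize hn : (e d : ℕ) = n
    induction n generalizing d v with
    | zero =>
      rintro rfl
      rw [← hz] at hn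
      rw [e.injective (Fin.ext hn)]
    | succ n ih =>
      intro h
      have hnN : n < N := by have := (e d).2; omega
      have hd : (e (e.symm ⟨n, hnN⟩) : ℕ) = n := by simp
      rcases h with h | ⟨u, h, hu⟩
      · exact (ih hd h).tail ⟨by simp [hn], .inl rfl⟩
      · exact (ih hd h).tail ⟨by simp [hn], .inr hu⟩

/-- The vertices are visited in the order of their numbers; for each one the path either witnesses
`A` and counts, or witnesses `B`. The set `U` collects the counted vertices up to `v`. The first
vertex has no step leading to it, so its decision is made by the choice of `c₀`. -/
theorem countStep_iff {A B : V → Prop} {z v c : V} (hz : (e z : ℕ) = 0) :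
    (∃ c₀, ((e c₀ : ℕ) = 0 ∧ B z ∨ (e z : ℕ) + 1 = e c₀ ∧ A z) ∧
      ReflTransGen (CountStep e A B) (z, c₀) (v, c)) ↔
    ∃ U : Finset V, (∀ u ∈ U, (e u : ℕ) ≤ e v ∧ A u) ∧
      (∀ u, (e u : ℕ) ≤ e v → u ∉ U → B u) ∧ U.card = e c := by
  classical
  have hz' : ∀ u, (e u : ℕ) = 0 → u = z := fun u hu => e.injective (Fin.ext (hu.trans hz.symm))
  constructor
  · rintro ⟨c₀, h0, h⟩
    have key : ∀ p : V × V, ReflTransGen (CountStep e A B) (z, c₀) p →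
        ∃ U : Finset V, (∀ u ∈ U, (e u : ℕ) ≤ e p.1 ∧ A u) ∧
          (∀ u, (e u : ℕ) ≤ e p.1 → u ∉ U → B u) ∧ U.card = e p.2 := by
      intro p h
      induction h with
      | refl =>
        rcases h0 with ⟨h0, hB⟩ | ⟨h0, hA⟩
        · refine ⟨∅, by simp, fun u hu _ => ?_, by simp [h0]⟩
          rw [hz' u (by simp only at hu; omega)]
          exact hB
        · refine ⟨{z}, by simp [hA], fun u hu hu' => ?_, by simp only [Finset.card_singleton]; omega⟩
          exact absurd (hz' u (by simp only at hu; omega)) (by simpa using hu')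
      | @tail p q _ h ih =>
        obtain ⟨U, h1, h2, h3⟩ := ih
        obtain ⟨h4, h5⟩ := h
        have hne : q.1 ∉ U := fun hq => by have := (h1 _ hq).1; omega
        rcases h5 with ⟨hB, h5⟩ | ⟨hA, h5⟩
        · refine ⟨U, fun u hu => ⟨by have := (h1 u hu).1; omega, (h1 u hu).2⟩, fun u hu hu' => ?_,
            by rw [h5, h3]⟩
          by_cases hq : u = q.1
          · rw [hq]; exact hB
          · have : (e u : ℕ) ≠ e q.1 := fun h => hq (e.injective (Fin.ext h))
            exact h2 u (by omega) hu'
        · refine ⟨insert q.1 U, fun u hu => ?_, fun u hu hu' => ?_, ?_⟩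
          · rcases Finset.mem_insert.1 hu with rfl | hu
            · exact ⟨le_rfl, hA⟩
            · exact ⟨by have := (h1 u hu).1; omega, (h1 u hu).2⟩
          · rw [Finset.mem_insert, not_or] at hu'
            have : (e u : ℕ) ≠ e q.1 := fun h => hu'.1 (e.injective (Fin.ext h))
            exact h2 u (by omega) hu'.2
          · rw [Finset.card_insert_of_notMem hne, h3, h5]
    exact key _ h
  · generalize hn : (e v : ℕ) = n
    induction n generalizing v c with
    | zero =>
      rintro ⟨U, h1, h2, h3⟩
      rw [hz' v hn]
      by_cases hU : z ∈ U
      · have : U = {z} := by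
          ext u
          rw [Finset.mem_singleton]
          exact ⟨fun hu => hz' u (by have := (h1 u hu).1; omega), fun hu => hu ▸ hU⟩
        rw [this, Finset.card_singleton] at h3
        exact ⟨c, .inr ⟨by omega, (h1 z hU).2⟩, .refl⟩
      · have : U = ∅ := by
          rw [Finset.eq_empty_iff_forall_notMem]
          intro u hu
          have := hz' u (by have := (h1 u hu).1; omega)
          exact hU (this ▸ hu)
        rw [this, Finset.card_empty] at h3
        exact ⟨c, .inl ⟨h3.symm, h2 z (by omega) hU⟩, .refl⟩
    | succ n ih =>
      rintro ⟨U, h1, h2, h3⟩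
      have hnN : n < N := by have := (e v).2; omega
      set v' := e.symm ⟨n, hnN⟩ with hv'
      have hd : (e v' : ℕ) = n := by simp [hv']
      by_cases hU : v ∈ U
      · have hc : (e c : ℕ) ≠ 0 := by
          rw [← h3]
          exact Finset.card_ne_zero_of_mem hU
        have hcN : (e c : ℕ) - 1 < N := by have := (e c).2; omega
        set c' := e.symm ⟨(e c : ℕ) - 1, hcN⟩ with hc'
        have hd' : (e c' : ℕ) = e c - 1 := by simp [hc']
        have : ∃ U : Finset V, (∀ u ∈ U, (e u : ℕ) ≤ n ∧ A u) ∧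
            (∀ u, (e u : ℕ) ≤ n → u ∉ U → B u) ∧ U.card = e c' := by
          refine ⟨U.erase v, fun u hu => ?_, fun u hu hu' => ?_, ?_⟩
          · obtain ⟨hu1, hu2⟩ := Finset.mem_erase.1 hu
            have h6 := (h1 u hu2).1
            have : (e u : ℕ) ≠ e v := fun h => hu1 (e.injective (Fin.ext h))
            exact ⟨by omega, (h1 u hu2).2⟩
          · refine h2 u (by omega) fun hu2 => hu' (Finset.mem_erase.2 ⟨?_, hu2⟩)
            rintro rfl
            omega
          · rw [Finset.card_erase_of_mem hU, h3, hd']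
        obtain ⟨c₀, h4, h5⟩ := ih hd this
        exact ⟨c₀, h4, h5.tail ⟨by rw [hd, hn], .inr ⟨(h1 v hU).2, by simp only [hd']; omega⟩⟩⟩
      · have : ∃ U : Finset V, (∀ u ∈ U, (e u : ℕ) ≤ n ∧ A u) ∧
            (∀ u, (e u : ℕ) ≤ n → u ∉ U → B u) ∧ U.card = e c := by
          refine ⟨U, fun u hu => ?_, fun u hu hu' => ?_, h3⟩
          · have h6 := (h1 u hu).1
            have : (e u : ℕ) ≠ e v := fun h => hU (e.injective (Fin.ext h) ▸ hu)
            exact ⟨by omega, (h1 u hu).2⟩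
          · exact h2 u (by omega) hu'
        obtain ⟨c₀, h4, h5⟩ := ih hd this
        exact ⟨c₀, h4, h5.tail ⟨by rw [hd, hn], .inl ⟨h2 v (by omega) hU, rfl⟩⟩⟩

theorem countSplit_iff {A B : V → Prop} {c : V} :
    CountSplit e A B c ↔ ∃ z v c₀, (e z : ℕ) = 0 ∧ (e v : ℕ) + 1 = N ∧
      ((e c₀ : ℕ) = 0 ∧ B z ∨ (e z : ℕ) + 1 = e c₀ ∧ A z) ∧
      ReflTransGen (CountStep e A B) (z, c₀) (v, c) := by
  have hN : 0 < N := (e c).pos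
  constructor
  · rintro ⟨U, h1, h2, h3⟩
    let z := e.symm ⟨0, hN⟩
    let v := e.symm ⟨N - 1, by omega⟩
    have hz : (e z : ℕ) = 0 := by simp [z]
    have hv : (e v : ℕ) + 1 = N := by simp [v]; omega
    obtain ⟨c₀, h4, h5⟩ := (countStep_iff (A := A) (B := B) (v := v) (c := c) hz).2
      ⟨U, fun u hu => ⟨by have := (e u).2; omega, h1 u hu⟩, fun u _ hu => h2 u hu, h3⟩
    exact ⟨z, v, c₀, hz, hv, h4, h5⟩
  · rintro ⟨z, v, c₀, hz, hv, h4, h5⟩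
    obtain ⟨U, h1, h2, h3⟩ := (countStep_iff hz).1 ⟨c₀, h4, h5⟩
    exact ⟨U, fun u hu => (h1 u hu).2, fun u hu => h2 u (by have := (e u).2; omega) hu, h3⟩

variable (e S x) in
/-- One round of inductive counting: if `c` is the number of vertices other than `x` that are
reachable in `d` steps, then `c'` is that number for `d + 1`. -/
def CountRound (d c c' : V) : Prop :=
  CountSplit e (fun v => v ≠ x ∧ (Within S x (e d) v ∨ ∃ u, Within S x (e d) u ∧ S u v))
    (fun v => v = x ∨ (¬ S x v ∧
      CountSplit e (fun u => u ≠ x ∧ Within S x (e d) u ∧ u ≠ v ∧ ¬ S u v) (fun _ => True) c)) c'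

open Classical in
variable (S x) in
/-- The vertices other than `x` that are reachable in at most `d` steps. -/
noncomputable def withinFinset [Fintype V] (d : ℕ) : Finset V :=
  Finset.univ.filter fun v => v ≠ x ∧ Within S x d v

theorem mem_withinFinset [Fintype V] {d : ℕ} {v : V} :
    v ∈ withinFinset S x d ↔ v ≠ x ∧ Within S x d v := by
  simp [withinFinset]

theorem within_self (d : ℕ) : Within S x d x := by
  induction d with
  | zero => rfl
  | succ d ih => exact .inl ih

/-- There are exactly as many candidates as the count `c` says, so exhibiting that many with
property `Q` exhibits all of them. This turns a universal statement about reachable vertices into an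
existential one. -/
theorem countSplit_true_iff [Fintype V] {d : ℕ} {c : V} {Q : V → Prop}
    (hc : (e c : ℕ) = (withinFinset S x d).card) :
    CountSplit e (fun u => u ≠ x ∧ Within S x d u ∧ Q u) (fun _ => True) c ↔
      ∀ u ∈ withinFinset S x d, Q u := by
  constructor
  · rintro ⟨U, h1, -, h3⟩ u hu
    have hU : U = withinFinset S x d := by
      apply Finset.eq_of_subset_of_card_le
      · exact fun u hu => mem_withinFinset.2 ⟨(h1 u hu).1, (h1 u hu).2.1⟩
      · rw [h3, hc]
    rw [← hU] at hu
    exact (h1 u hu).2.2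
  · intro h
    exact ⟨withinFinset S x d, fun u hu => ⟨(mem_withinFinset.1 hu).1, (mem_withinFinset.1 hu).2,
      h u hu⟩, fun _ _ => trivial, hc.symm⟩

/-- For complementary `A` and `B` every decision is forced, so the count is exact. -/
theorem countSplit_compl_iff {A B : V → Prop} {c : V} {T : Finset V}
    (hA : ∀ v, A v ↔ v ∈ T) (hB : ∀ v, B v ↔ v ∉ T) : CountSplit e A B c ↔ T.card = e c := by
  constructor
  · rintro ⟨U, h1, h2, h3⟩
    have : U = T := by
      ext v
      by_cases hv : v ∈ U
      · simp [hv, (hA v).1 (h1 v hv)]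
      · simp [hv, (hB v).1 (h2 v hv)]
    rw [← this, h3]
  · exact fun h => ⟨T, fun v hv => (hA v).2 hv, fun v hv => (hB v).2 hv, h⟩

/-- Given the right count for depth `d`, being out of reach at depth `d + 1` has a certificate: list
all vertices within `d` and check that none equals `v` or has an edge to `v`. The source `x` is not
counted and its edge is checked separately. -/
theorem countRound_iff [Fintype V] {d c c' : V} (hc : (e c : ℕ) = (withinFinset S x (e d)).card) :
    CountRound e S x d c c' ↔ (withinFinset S x (e d + 1)).card = e c' := by
  refine countSplit_compl_iff (fun v => ?_) (fun v => ?_)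
  · rw [mem_withinFinset]
    rfl
  · rw [countSplit_true_iff hc, mem_withinFinset, not_and]
    by_cases hv : v = x
    · simp [hv]
    · simp only [hv, false_or, ne_eq, not_false_iff, true_implies]
      constructor
      · rintro ⟨h1, h2⟩ (h | ⟨u, hu, h⟩)
        · exact (h2 v (mem_withinFinset.2 ⟨hv, h⟩)).1 rfl
        · by_cases hux : u = x
          · exact h1 (hux ▸ h)
          · exact (h2 u (mem_withinFinset.2 ⟨hux, hu⟩)).2 h
      · intro h
        refine ⟨fun hx => h (.inr ⟨x, within_self _, hx⟩), fun u hu => ⟨?_, fun hs => ?_⟩⟩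
        · rintro rfl
          exact h (.inl (mem_withinFinset.1 hu).2)
        · exact h (.inr ⟨u, (mem_withinFinset.1 hu).2, hs⟩)

/-- Leaving out `x` is what keeps the count below `N`, so that it can be stored as the number of a
vertex. -/
theorem card_withinFinset_lt [Fintype V] (e : V ≃ Fin N) (d : ℕ) :
    (withinFinset S x d).card < N := by
  have h : (withinFinset S x d).card < Fintype.card V := by
    apply Finset.card_lt_univ_of_notMem (x := x)
    simp [mem_withinFinset]
  rwa [Fintype.card_congr e, Fintype.card_fin] at h

variable (e S x) in
/-- The rounds of inductive counting. -/
def RoundStep (p q : V × V) : Prop :=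
  (e p.1 : ℕ) + 1 = e q.1 ∧ CountRound e S x p.1 p.2 q.2

theorem rounds_iff [Fintype V] {z d c : V} (hz : (e z : ℕ) = 0) :
    ReflTransGen (RoundStep e S x) (z, z) (d, c) ↔
      (e c : ℕ) = (withinFinset S x (e d)).card := by
  have h0 : (withinFinset S x 0).card = 0 := by
    rw [Finset.card_eq_zero, Finset.eq_empty_iff_forall_notMem]
    intro v hv
    rw [mem_withinFinset] at hv
    exact hv.1 hv.2
  constructor
  · have key : ∀ p : V × V, ReflTransGen (RoundStep e S x) (z, z) p →
        (e p.2 : ℕ) = (withinFinset S x (e p.1)).card := by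
      intro p h
      induction h with
      | refl => simp only [hz, h0]
      | tail _ h ih => rw [← h.1, (countRound_iff ih).1 h.2]
    exact key _
  · generalize hn : (e d : ℕ) = n
    induction n generalizing d c with
    | zero =>
      intro h
      rw [← hz] at hn
      rw [h0, ← hz] at h
      rw [e.injective (Fin.ext hn), e.injective (Fin.ext h)]
    | succ n ih =>
      intro h
      have hnN : n < N := by have := (e d).2; omega
      let d' := e.symm ⟨n, hnN⟩
      have hd : (e d' : ℕ) = n := by simp [d']
      let c' := e.symm ⟨_, card_withinFinset_lt (S := S) (x := x) e n⟩
      have hc : (e c' : ℕ) = (withinFinset S x n).card := by simp [c']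
      refine (ih hd hc).tail ⟨by rw [hd, hn], (countRound_iff ?_).2 ?_⟩
      · simp only [hd, hc]
      · simp only [hd, h]

/-- Nested sets of equal size coincide, so the set of vertices within `d` is closed under edges. -/
theorem reachable_of_stable [Fintype V] {d : ℕ}
    (h : (withinFinset S x (d + 1)).card = (withinFinset S x d).card) {v : V}
    (hv : ReflTransGen S x v) : Within S x d v := by
  have hsub : withinFinset S x d ⊆ withinFinset S x (d + 1) := fun v hv =>
    mem_withinFinset.2 ⟨(mem_withinFinset.1 hv).1, .inl (mem_withinFinset.1 hv).2⟩
  have heq := Finset.eq_of_subset_of_card_le hsub h.le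
  induction hv with
  | refl => exact within_self d
  | @tail u v _ huv ih =>
    by_cases hvx : v = x
    · rw [hvx]; exact within_self d
    · have : v ∈ withinFinset S x (d + 1) := mem_withinFinset.2 ⟨hvx, .inr ⟨u, ih, huv⟩⟩
      rw [← heq] at this
      exact (mem_withinFinset.1 this).2

theorem reachable_of_within {d : ℕ} {v : V} (h : Within S x d v) : ReflTransGen S x v := by
  induction d generalizing v with
  | zero => rw [show v = x from h]
  | succ d ih =>
    rcases h with h | ⟨u, hu, huv⟩
    · exact ih h
    · exact (ih hu).tail huv

/-- Otherwise the count would grow at each depth below `N` and reach `N`. -/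
theorem exists_stable [Fintype V] (e : V ≃ Fin N) :
    ∃ d < N, (withinFinset S x (d + 1)).card = (withinFinset S x d).card := by
  by_contra! h
  have mono : ∀ d, (withinFinset S x d).card ≤ (withinFinset S x (d + 1)).card := fun d =>
    Finset.card_le_card fun v hv =>
      mem_withinFinset.2 ⟨(mem_withinFinset.1 hv).1, .inl (mem_withinFinset.1 hv).2⟩
  have key : ∀ d ≤ N, d ≤ (withinFinset S x d).card := by
    intro d
    induction d with
    | zero => simp
    | succ d ih =>
      intro hd
      have h1 := ih (by omega)
      have h2 := h d (by omega)
      have h3 := mono d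
      omega
  have h1 := key N le_rfl
  have h2 := card_withinFinset_lt (S := S) (x := x) e N
  omega

/-- The certificate is a depth `d` with its count `c`, obtained by rounds of counting, a further
round showing that the count is stable, and a list of `c` vertices within `d` that avoids `y`. Apart
from `x` the list exhausts everything reachable. -/
theorem not_reachable_iff [Fintype V] {y : V} :
    ¬ ReflTransGen S x y ↔ x ≠ y ∧ ∃ z d c, (e z : ℕ) = 0 ∧
      ReflTransGen (RoundStep e S x) (z, z) (d, c) ∧ CountRound e S x d c c ∧
      CountSplit e (fun u => u ≠ x ∧ Within S x (e d) u ∧ u ≠ y) (fun _ => True) c := by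
  constructor
  · intro h
    refine ⟨fun hxy => h (hxy ▸ .refl), ?_⟩
    obtain ⟨d, hd, hs⟩ := exists_stable (S := S) (x := x) e
    let z := e.symm ⟨0, (e x).pos⟩
    let d' := e.symm ⟨d, hd⟩
    let c := e.symm ⟨_, card_withinFinset_lt (S := S) (x := x) e d⟩
    have hz : (e z : ℕ) = 0 := by simp [z]
    have hd' : (e d' : ℕ) = d := by simp [d']
    have hc : (e c : ℕ) = (withinFinset S x (e d')).card := by simp [c, d']
    refine ⟨z, d', c, hz, (rounds_iff hz).2 hc, (countRound_iff hc).2 ?_,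
      (countSplit_true_iff hc).2 ?_⟩
    · rw [hc, hd', hs]
    · rintro u hu rfl
      exact h (reachable_of_within (mem_withinFinset.1 hu).2)
  · rintro ⟨hxy, z, d, c, hz, h1, h2, h3⟩ h
    have hc := (rounds_iff hz).1 h1
    have hs := (countRound_iff hc).1 h2
    rw [hc] at hs
    have hw := reachable_of_stable hs h
    exact (countSplit_true_iff hc).1 h3 y (mem_withinFinset.2 ⟨hxy.symm, hw⟩) rfl

end Counting

end SpaceComplexity

/-! ### Complementation of reachability -/

namespace SpaceComplexity

open Relation

variable {α : Type}

/-- The tuples of words are numbered consecutively. -/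
noncomputable def tupleEquiv (w : List α) (n : ℕ) : (Fin n → Word w) ≃ Fin ((2 ^ width w) ^ n) :=
  finFunctionFinEquiv

/-- Component `0` is the least significant digit in base `2 ^ width w`; the tests on tuples recurse
on this. -/
theorem tupleEquiv_succ (w : List α) {n : ℕ} (x : Fin (n + 1) → Word w) :
    (tupleEquiv w (n + 1) x : ℕ) =
      x 0 + 2 ^ width w * (tupleEquiv w n fun i => x i.succ) := by
  simp only [tupleEquiv, finFunctionFinEquiv_apply, Fin.sum_univ_succ, Finset.mul_sum]
  simp only [Fin.val_zero, pow_zero, mul_one, Fin.val_succ, pow_succ]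
  congr 1
  exact Finset.sum_congr rfl fun i _ => by ring

namespace Semi

variable {κ κ' : Type} {n : ℕ}

theorem app {ι : Type} {A : ∀ w : List α, (κ → Word w) → (ι → Word w) → Prop}
    (h : Semi fun w (σ : κ ⊕ ι → Word w) => A w (fun i => σ (Sum.inl i)) fun i => σ (Sum.inr i))
    (f : κ → κ') (g : ι → κ') :
    Semi fun w (σ : κ' → Word w) => A w (fun i => σ (f i)) fun i => σ (g i) :=
  h.subst (Sum.elim f g)

theorem app₂ {ι ι' : Type} {A : ∀ w : List α, (κ → Word w) → (ι → Word w) → (ι' → Word w) → Prop}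
    (h : Semi fun w (σ : (κ ⊕ ι) ⊕ ι' → Word w) =>
      A w (fun i => σ (Sum.inl (Sum.inl i))) (fun i => σ (Sum.inl (Sum.inr i))) fun i => σ (Sum.inr i))
    (f : κ → κ') (g : ι → κ') (g' : ι' → κ') :
    Semi fun w (σ : κ' → Word w) =>
      A w (fun i => σ (f i)) (fun i => σ (g i)) fun i => σ (g' i) :=
  h.subst (Sum.elim (Sum.elim f g) g')

theorem tc₂ {ι ι' : Type} [Fintype ι] [Fintype ι']
    {R : ∀ w : List α, (κ → Word w) → (ι → Word w) × (ι' → Word w) →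
      (ι → Word w) × (ι' → Word w) → Prop}
    (h : Semi fun w (σ : (κ ⊕ (ι ⊕ ι')) ⊕ (ι ⊕ ι') → Word w) =>
      R w (fun i => σ (Sum.inl (Sum.inl i)))
        (fun i => σ (Sum.inl (Sum.inr (Sum.inl i))), fun i => σ (Sum.inl (Sum.inr (Sum.inr i))))
        (fun i => σ (Sum.inr (Sum.inl i)), fun i => σ (Sum.inr (Sum.inr i))))
    (xs : ι → κ) (xs' : ι' → κ) (ys : ι → κ) (ys' : ι' → κ) :
    Semi fun w σ => ReflTransGen (R w σ) (fun i => σ (xs i), fun i => σ (xs' i))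
      (fun i => σ (ys i), fun i => σ (ys' i)) := by
  refine (tc (ι := ι ⊕ ι') (R := fun w σ p q => R w σ (fun i => p (Sum.inl i), fun i => p (Sum.inr i))
    (fun i => q (Sum.inl i), fun i => q (Sum.inr i))) h (Sum.elim xs xs') (Sum.elim ys ys')).congr ?_
  intro w σ
  constructor
  · intro h
    exact ReflTransGen.lift (p := R w σ) (fun p : ι ⊕ ι' → Word w =>
      ((fun i => p (Sum.inl i), fun i => p (Sum.inr i)) : (ι → Word w) × (ι' → Word w)))
      (fun _ _ h => h) _ _ h
  · intro h
    have := ReflTransGen.lift (r := R w σ)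
      (p := fun p q => R w σ (fun i => p (Sum.inl i), fun i => p (Sum.inr i))
        (fun i => q (Sum.inl i), fun i => q (Sum.inr i)))
      (fun p : (ι → Word w) × (ι' → Word w) => Sum.elim p.1 p.2) (fun _ _ h => h) _ _ h
    convert this using 1 <;> funext i <;> cases i <;> rfl

theorem tuple_eq {ι : Type} (xs ys : ι → κ) :
    Semi fun (w : List α) (σ : κ → Word w) => (fun i => σ (xs i)) = fun i => σ (ys i) :=
  of_test fun m r => (Realizable.test_eq (fun i => r (xs i)) fun i => r (ys i)).congr
    fun w s t => by simp [funext_iff]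

theorem tuple_zero (xs : Fin n → κ) : Semi fun (w : List α) (σ : κ → Word w) =>
    (tupleEquiv w n fun i => σ (xs i) : ℕ) = 0 := by
  induction n with
  | zero => exact true.congr fun w σ => by simp
  | succ n ih =>
    refine ((zero (xs 0)).and (ih fun i => xs i.succ)).congr fun w σ => ?_
    rw [tupleEquiv_succ]
    simp

theorem tuple_max (xs : Fin n → κ) : Semi fun (w : List α) (σ : κ → Word w) =>
    (tupleEquiv w n fun i => σ (xs i) : ℕ) + 1 = (2 ^ width w) ^ n := by
  induction n with
  | zero => exact true.congr fun w σ => by simp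
  | succ n ih =>
    refine ((max (xs 0)).and (ih fun i => xs i.succ)).congr fun w σ => ?_
    rw [tupleEquiv_succ]
    have h1 := (σ (xs 0)).2
    have h2 := (tupleEquiv w n fun i => σ (xs i.succ)).2
    generalize (σ (xs 0) : ℕ) = a at *
    generalize ((tupleEquiv w n fun i => σ (xs i.succ) : Fin _) : ℕ) = b at *
    rw [pow_succ']
    generalize (2 ^ width w) ^ n = M at *
    generalize 2 ^ width w = B at *
    constructor
    · rintro ⟨rfl, rfl⟩
      ring
    · intro h
      have hb : b + 1 = M := by
        by_contra hb
        have : b + 2 ≤ M := by omega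
        nlinarith
      subst hb
      exact ⟨by nlinarith, rfl⟩

/-- Either the lowest digit grows and the others stay, or it wraps from the greatest value to `0`
and the others form a successor. -/
theorem tuple_succ (xs ys : Fin n → κ) : Semi fun (w : List α) (σ : κ → Word w) =>
    (tupleEquiv w n fun i => σ (xs i) : ℕ) + 1 = tupleEquiv w n fun i => σ (ys i) := by
  induction n with
  | zero => exact false.congr fun w σ => by simp
  | succ n ih =>
    refine (((succ (xs 0) (ys 0)).and (tuple_eq (fun i : Fin n => xs i.succ) fun i => ys i.succ)).or
      (((max (xs 0)).and (zero (ys 0))).and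
      (ih (fun i => xs i.succ) fun i => ys i.succ))).congr fun w σ => ?_
    rw [tupleEquiv_succ, tupleEquiv_succ, ← (tupleEquiv w n).apply_eq_iff_eq, Fin.ext_iff]
    have h1 := (σ (xs 0)).2
    have h2 := (σ (ys 0)).2
    generalize (σ (xs 0) : ℕ) = a at *
    generalize (σ (ys 0) : ℕ) = b at *
    generalize ((tupleEquiv w n fun i => σ (xs i.succ) : Fin _) : ℕ) = c at *
    generalize ((tupleEquiv w n fun i => σ (ys i.succ) : Fin _) : ℕ) = d at *
    generalize 2 ^ width w = B at *
    constructor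
    · rintro (⟨h3, h4⟩ | ⟨⟨h3, h4⟩, h5⟩)
      · rw [h4, ← h3]
        ring
      · rw [← h5, h4, mul_add, ← h3]
        ring
    · intro h
      rcases lt_trichotomy c d with hcd | rfl | hcd
      · right
        have h6 : d = c + 1 := by
          by_contra hne
          have : c + 2 ≤ d := by omega
          nlinarith
        subst h6
        rw [mul_add] at h
        omega
      · left
        omega
      · exfalso
        have : d + 1 ≤ c := hcd
        nlinarith

theorem tuple_le (xs ys : Fin n → κ) : Semi fun (w : List α) (σ : κ → Word w) =>
    (tupleEquiv w n fun i => σ (xs i) : ℕ) ≤ tupleEquiv w n fun i => σ (ys i) := by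
  refine (tc (R := fun w _ p q => (tupleEquiv w n p : ℕ) + 1 = tupleEquiv w n q)
    (tuple_succ _ _) xs ys).congr fun w σ => ?_
  generalize (fun i => σ (xs i)) = x
  generalize (fun i => σ (ys i)) = y
  constructor
  · intro h
    induction h with
    | refl => exact le_rfl
    | tail _ h ih => omega
  · intro h
    obtain ⟨k, hk⟩ := Nat.exists_eq_add_of_le h
    induction k generalizing y with
    | zero =>
      rw [(tupleEquiv w n).injective (Fin.ext hk)]
    | succ k ih =>
      have hN : (tupleEquiv w n x : ℕ) + k < (2 ^ width w) ^ n := by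
        have := (tupleEquiv w n y).2
        omega
      exact (ih ((tupleEquiv w n).symm ⟨_, hN⟩) (by simp) (by simp)).tail
        (by simp only [Equiv.apply_symm_apply]; omega)

/-- Inequality needs a positive test. In a linear order it means that one side is smaller, that is,
the successor of one is at most the other. -/
theorem tuple_ne (xs ys : Fin n → κ) : Semi fun (w : List α) (σ : κ → Word w) =>
    (fun i => σ (xs i)) ≠ fun i => σ (ys i) := by
  have lt : ∀ xs ys : Fin n → κ, Semi fun (w : List α) (σ : κ → Word w) => ∃ z : Fin n → Word w,
      (tupleEquiv w n fun i => σ (xs i) : ℕ) + 1 = tupleEquiv w n (fun i => z i) ∧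
      (tupleEquiv w n fun i => z i : ℕ) ≤ tupleEquiv w n fun i => σ (ys i) := fun xs ys =>
    ex ((tuple_succ (fun i => Sum.inl (xs i)) fun i => Sum.inr i).and
      (tuple_le (fun i => Sum.inr i) fun i => Sum.inl (ys i)))
  have lt_iff : ∀ (w : List α) (x y : Fin n → Word w), (∃ z : Fin n → Word w,
      (tupleEquiv w n x : ℕ) + 1 = tupleEquiv w n (fun i => z i) ∧
      (tupleEquiv w n fun i => z i : ℕ) ≤ tupleEquiv w n y) ↔
      (tupleEquiv w n x : ℕ) < tupleEquiv w n y := by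
    intro w x y
    constructor
    · rintro ⟨z, h1, h2⟩
      exact lt_of_lt_of_le (by omega) h2
    · intro h
      have hN : (tupleEquiv w n x : ℕ) + 1 < (2 ^ width w) ^ n := by
        have := (tupleEquiv w n y).2
        omega
      exact ⟨(tupleEquiv w n).symm ⟨_, hN⟩, by simp, by simpa using h⟩
  refine ((lt xs ys).or (lt ys xs)).congr fun w σ => ?_
  rw [lt_iff, lt_iff, ← Nat.ne_iff_lt_or_gt, ne_eq, ne_eq, Fin.val_inj,
    (tupleEquiv w n).apply_eq_iff_eq]

/-- By `countSplit_iff` the count is a matter of reachability. `A` and `B` enter only positively, so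
nothing about their complements is needed. -/
theorem countSplit {A B : ∀ w : List α, (κ → Word w) → (Fin n → Word w) → Prop}
    (hA : Semi fun w (σ : κ ⊕ Fin n → Word w) => A w (fun i => σ (Sum.inl i)) fun i => σ (Sum.inr i))
    (hB : Semi fun w (σ : κ ⊕ Fin n → Word w) => B w (fun i => σ (Sum.inl i)) fun i => σ (Sum.inr i))
    (cs : Fin n → κ) :
    Semi fun w σ => CountSplit (tupleEquiv w n) (A w σ) (B w σ) fun i => σ (cs i) := by
  have step : Semi fun w (σ : κ ⊕ Fin n ⊕ Fin n ⊕ Fin n → Word w) =>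
      ReflTransGen (CountStep (tupleEquiv w n) (A w fun i => σ (Sum.inl i)) (B w fun i => σ (Sum.inl i)))
        (fun i => σ (Sum.inr (Sum.inl i)), fun i => σ (Sum.inr (Sum.inr (Sum.inl i))))
        (fun i => σ (Sum.inr (Sum.inr (Sum.inr i))), fun i => σ (Sum.inl (cs i))) :=
    tc₂ (R := fun w σ => CountStep (tupleEquiv w n) (A w fun i => σ (Sum.inl i))
      (B w fun i => σ (Sum.inl i))) ((tuple_succ _ _).and
      (((hB.app _ _).and (tuple_eq _ _)).or ((hA.app _ _).and (tuple_succ _ _)))) _ _ _ _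
  refine Semi.congr (ex (ι := Fin n) (ex (ι := Fin n) (ex (ι := Fin n)
    (P := fun w σ c => (tupleEquiv w n (fun i => σ (Sum.inl (Sum.inr i))) : ℕ) = 0 ∧
      (tupleEquiv w n (fun i => σ (Sum.inr i)) : ℕ) + 1 = (2 ^ width w) ^ n ∧
      ((tupleEquiv w n c : ℕ) = 0 ∧ B w (fun i => σ (Sum.inl (Sum.inl i))) (fun i => σ (Sum.inl (Sum.inr i))) ∨
        (tupleEquiv w n (fun i => σ (Sum.inl (Sum.inr i))) : ℕ) + 1 = tupleEquiv w n c ∧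
          A w (fun i => σ (Sum.inl (Sum.inl i))) (fun i => σ (Sum.inl (Sum.inr i)))) ∧
      ReflTransGen (CountStep (tupleEquiv w n) (A w fun i => σ (Sum.inl (Sum.inl i)))
        (B w fun i => σ (Sum.inl (Sum.inl i))))
        (fun i => σ (Sum.inl (Sum.inr i)), c) (fun i => σ (Sum.inr i), fun i => σ (Sum.inl (Sum.inl (cs i)))))
    ?_))) fun w σ => countSplit_iff.symm
  refine .and (tuple_zero _) (.and (tuple_max _) (.and (.or (.and (tuple_zero _) (hB.app _ _))
    (.and (tuple_succ _ _) (hA.app _ _))) ?_))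
  exact step.subst (Sum.elim (fun i => Sum.inl (Sum.inl (Sum.inl i))) (Sum.elim (fun i => Sum.inl (Sum.inl (Sum.inr i)))
    (Sum.elim (fun i => Sum.inr i) fun i => Sum.inl (Sum.inr i))))

/-- This is the theorem of Immerman and Szelepcsényi. In `not_reachable_iff` the relation occurs
negated only for single edges, which `h'` covers; all else is existential, counting or reachability.
The maps between sum types only rename variables. -/
theorem not_tc_fin {R : ∀ w : List α, (κ → Word w) → (Fin n → Word w) → (Fin n → Word w) → Prop}
    (h : Semi fun w (σ : (κ ⊕ Fin n) ⊕ Fin n → Word w) =>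
      R w (fun i => σ (Sum.inl (Sum.inl i))) (fun i => σ (Sum.inl (Sum.inr i))) fun i => σ (Sum.inr i))
    (h' : Semi fun w (σ : (κ ⊕ Fin n) ⊕ Fin n → Word w) =>
      ¬ R w (fun i => σ (Sum.inl (Sum.inl i))) (fun i => σ (Sum.inl (Sum.inr i))) fun i => σ (Sum.inr i))
    (xs ys : Fin n → κ) :
    Semi fun w σ => ¬ ReflTransGen (R w σ) (fun i => σ (xs i)) fun i => σ (ys i) := by
  have within : Semi fun w (σ : (κ ⊕ Fin n) ⊕ Fin n → Word w) =>
      Within (R w fun i => σ (Sum.inl (Sum.inl i))) (fun i => σ (Sum.inl (Sum.inl (xs i))))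
        (tupleEquiv w n fun i => σ (Sum.inl (Sum.inr i))) fun i => σ (Sum.inr i) := by
    have reach : Semi fun w (σ : (κ ⊕ Fin n ⊕ Fin n) ⊕ Fin n → Word w) =>
        ReflTransGen (WithinStep (tupleEquiv w n) (R w fun i => σ (Sum.inl (Sum.inl i))))
          (fun i => σ (Sum.inr i), fun i => σ (Sum.inl (Sum.inl (xs i))))
          (fun i => σ (Sum.inl (Sum.inr (Sum.inl i))), fun i => σ (Sum.inl (Sum.inr (Sum.inr i)))) :=
      tc₂ (R := fun w σ => WithinStep (tupleEquiv w n) (R w fun i => σ (Sum.inl (Sum.inl i))))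
        ((tuple_succ _ _).and ((tuple_eq _ _).or (h.app₂ _ _ _))) _ _ _ _
    refine Semi.congr (ex (ι := Fin n) (P := fun w σ z => (tupleEquiv w n z : ℕ) = 0 ∧
      ReflTransGen (WithinStep (tupleEquiv w n) (R w fun i => σ (Sum.inl (Sum.inl i))))
        (z, fun i => σ (Sum.inl (Sum.inl (xs i))))
        (fun i => σ (Sum.inl (Sum.inr i)), fun i => σ (Sum.inr i))) (.and (tuple_zero _) ?_)) fun w σ => ?_
    · exact reach.subst (Sum.elim (Sum.elim (fun i => Sum.inl (Sum.inl (Sum.inl i)))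
        (Sum.elim (fun i => Sum.inl (Sum.inl (Sum.inr i))) fun i => Sum.inl (Sum.inr i))) fun i => Sum.inr i)
    · constructor
      · rintro ⟨z, hz, h⟩
        exact (within_iff hz).1 h
      · intro h
        have hN : 0 < (2 ^ width w) ^ n := by positivity
        exact ⟨(tupleEquiv w n).symm ⟨0, hN⟩, by simp, (within_iff (by simp)).2 h⟩
  have round : Semi fun w (σ : ((κ ⊕ Fin n) ⊕ Fin n) ⊕ Fin n → Word w) =>
      CountRound (tupleEquiv w n) (R w fun i => σ (Sum.inl (Sum.inl (Sum.inl i))))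
        (fun i => σ (Sum.inl (Sum.inl (Sum.inl (xs i))))) (fun i => σ (Sum.inl (Sum.inl (Sum.inr i))))
        (fun i => σ (Sum.inl (Sum.inr i))) fun i => σ (Sum.inr i) := by
    refine countSplit
      (A := fun w σ v => v ≠ (fun i => σ (Sum.inl (Sum.inl (Sum.inl (xs i))))) ∧
        (Within (R w fun i => σ (Sum.inl (Sum.inl (Sum.inl i)))) (fun i => σ (Sum.inl (Sum.inl (Sum.inl (xs i)))))
          (tupleEquiv w n fun i => σ (Sum.inl (Sum.inl (Sum.inr i)))) v ∨
        ∃ u, Within (R w fun i => σ (Sum.inl (Sum.inl (Sum.inl i))))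
          (fun i => σ (Sum.inl (Sum.inl (Sum.inl (xs i)))))
          (tupleEquiv w n fun i => σ (Sum.inl (Sum.inl (Sum.inr i)))) u ∧
          R w (fun i => σ (Sum.inl (Sum.inl (Sum.inl i)))) u v))
      (B := fun w σ v => v = (fun i => σ (Sum.inl (Sum.inl (Sum.inl (xs i))))) ∨
        (¬ R w (fun i => σ (Sum.inl (Sum.inl (Sum.inl i)))) (fun i => σ (Sum.inl (Sum.inl (Sum.inl (xs i))))) v ∧
        CountSplit (tupleEquiv w n) (fun u => u ≠ (fun i => σ (Sum.inl (Sum.inl (Sum.inl (xs i))))) ∧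
          Within (R w fun i => σ (Sum.inl (Sum.inl (Sum.inl i))))
          (fun i => σ (Sum.inl (Sum.inl (Sum.inl (xs i)))))
          (tupleEquiv w n fun i => σ (Sum.inl (Sum.inl (Sum.inr i)))) u ∧ u ≠ v ∧
          ¬ R w (fun i => σ (Sum.inl (Sum.inl (Sum.inl i)))) u v) (fun _ => True)
          fun i => σ (Sum.inl (Sum.inr i)))) ?_ ?_ _
    · refine .and (tuple_ne _ _) (.or (within.subst (Sum.elim (Sum.elim
        (fun i => Sum.inl (Sum.inl (Sum.inl (Sum.inl i))))
        fun i => Sum.inl (Sum.inl (Sum.inl (Sum.inr i)))) fun i => Sum.inr i)) (ex (.and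
        (within.subst (Sum.elim (Sum.elim
        (fun i => Sum.inl (Sum.inl (Sum.inl (Sum.inl (Sum.inl i)))))
        fun i => Sum.inl (Sum.inl (Sum.inl (Sum.inl (Sum.inr i))))) fun i => Sum.inr i))
        (h.subst (Sum.elim (Sum.elim
        (fun i => Sum.inl (Sum.inl (Sum.inl (Sum.inl (Sum.inl i)))))
        fun i => Sum.inr i) fun i => Sum.inl (Sum.inr i))))))
    · refine .or (tuple_eq _ _) (.and (h'.subst (Sum.elim (Sum.elim
        (fun i => Sum.inl (Sum.inl (Sum.inl (Sum.inl i))))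
        fun i => Sum.inl (Sum.inl (Sum.inl (Sum.inl (xs i))))) fun i => Sum.inr i)) (countSplit
        (A := fun w σ u => u ≠ (fun i => σ (Sum.inl (Sum.inl (Sum.inl (Sum.inl (xs i)))))) ∧
          Within (R w fun i => σ (Sum.inl (Sum.inl (Sum.inl (Sum.inl i)))))
          (fun i => σ (Sum.inl (Sum.inl (Sum.inl (Sum.inl (xs i))))))
          (tupleEquiv w n fun i => σ (Sum.inl (Sum.inl (Sum.inl (Sum.inr i))))) u ∧
          u ≠ (fun i => σ (Sum.inr i)) ∧
          ¬ R w (fun i => σ (Sum.inl (Sum.inl (Sum.inl (Sum.inl i))))) u (fun i => σ (Sum.inr i)))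
        (B := fun _ _ _ => True) ?_ true _))
      exact .and (tuple_ne _ _) (.and (within.subst (Sum.elim (Sum.elim
        (fun i => Sum.inl (Sum.inl (Sum.inl (Sum.inl (Sum.inl i)))))
        fun i => Sum.inl (Sum.inl (Sum.inl (Sum.inl (Sum.inr i))))) fun i => Sum.inr i))
        (.and (tuple_ne _ _) (h'.subst (Sum.elim (Sum.elim
        (fun i => Sum.inl (Sum.inl (Sum.inl (Sum.inl (Sum.inl i)))))
        fun i => Sum.inr i) fun i => Sum.inl (Sum.inr i)))))
  have rounds : Semi fun w (σ : (κ ⊕ Fin n) ⊕ Fin n ⊕ Fin n → Word w) =>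
      ReflTransGen (RoundStep (tupleEquiv w n) (R w fun i => σ (Sum.inl (Sum.inl i)))
        fun i => σ (Sum.inl (Sum.inl (xs i))))
        (fun i => σ (Sum.inl (Sum.inr i)), fun i => σ (Sum.inl (Sum.inr i)))
        (fun i => σ (Sum.inr (Sum.inl i)), fun i => σ (Sum.inr (Sum.inr i))) :=
    tc₂ (R := fun w σ => RoundStep (tupleEquiv w n) (R w fun i => σ (Sum.inl (Sum.inl i)))
        fun i => σ (Sum.inl (Sum.inl (xs i)))) (.and (tuple_succ _ _)
        (round.subst (Sum.elim (Sum.elim (Sum.elim (fun i => Sum.inl (Sum.inl (Sum.inl (Sum.inl i))))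
          fun i => Sum.inl (Sum.inr (Sum.inl i))) fun i => Sum.inl (Sum.inr (Sum.inr i)))
          fun i => Sum.inr (Sum.inr i)))) _ _ _ _
  refine Semi.congr (.and (tuple_ne xs ys) (ex (ι := Fin n) (ex (ι := Fin n) (ex (ι := Fin n)
    (P := fun w σ c => (tupleEquiv w n (fun i => σ (Sum.inl (Sum.inr i))) : ℕ) = 0 ∧
      ReflTransGen (RoundStep (tupleEquiv w n) (R w fun i => σ (Sum.inl (Sum.inl i)))
        fun i => σ (Sum.inl (Sum.inl (xs i)))) (fun i => σ (Sum.inl (Sum.inr i)), fun i => σ (Sum.inl (Sum.inr i)))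
        (fun i => σ (Sum.inr i), c) ∧
      CountRound (tupleEquiv w n) (R w fun i => σ (Sum.inl (Sum.inl i)))
        (fun i => σ (Sum.inl (Sum.inl (xs i)))) (fun i => σ (Sum.inr i)) c c ∧
      CountSplit (tupleEquiv w n) (fun u => u ≠ (fun i => σ (Sum.inl (Sum.inl (xs i)))) ∧
        Within (R w fun i => σ (Sum.inl (Sum.inl i))) (fun i => σ (Sum.inl (Sum.inl (xs i))))
          (tupleEquiv w n fun i => σ (Sum.inr i)) u ∧ u ≠ fun i => σ (Sum.inl (Sum.inl (ys i))))
        (fun _ => True) c) (.and (tuple_zero _) (.and ?_ (.and ?_ ?_)))))))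
    fun w σ => not_reachable_iff.symm
  · exact rounds.subst (Sum.elim (Sum.elim (fun i => Sum.inl (Sum.inl (Sum.inl i)))
      fun i => Sum.inl (Sum.inl (Sum.inr i))) (Sum.elim (fun i => Sum.inl (Sum.inr i)) fun i => Sum.inr i))
  · exact round.subst (Sum.elim (Sum.elim (Sum.elim (fun i => Sum.inl (Sum.inl (Sum.inl i)))
      fun i => Sum.inl (Sum.inr i)) fun i => Sum.inr i) fun i => Sum.inr i)
  · refine countSplit (A := fun w σ u => u ≠ (fun i => σ (Sum.inl (Sum.inl (Sum.inl (xs i))))) ∧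
        Within (R w fun i => σ (Sum.inl (Sum.inl (Sum.inl i)))) (fun i => σ (Sum.inl (Sum.inl (Sum.inl (xs i)))))
          (tupleEquiv w n fun i => σ (Sum.inl (Sum.inr i))) u ∧
          u ≠ fun i => σ (Sum.inl (Sum.inl (Sum.inl (ys i))))) (B := fun _ _ _ => True) ?_ true _
    exact .and (tuple_ne _ _) (.and (within.subst (Sum.elim (Sum.elim
      (fun i => Sum.inl (Sum.inl (Sum.inl (Sum.inl i))))
      fun i => Sum.inl (Sum.inl (Sum.inr i))) fun i => Sum.inr i)) (tuple_ne _ _))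

end Semi

end SpaceComplexity

/-! ### Decidable predicates -/

namespace SpaceComplexity

open Relation

variable {α : Type}

instance [Finite α] : Finite (InputSymbol α) := by
  refine Finite.of_injective (β := Option (Option α))
    (fun | .leftEnd => none | .rightEnd => some none | .letter c => some (some c)) ?_
  rintro (_ | c | _) (_ | d | _) h <;> simp_all

theorem Semi.exists_finite {κ β : Type} [Finite β] {P : β → ∀ w : List α, (κ → Word w) → Prop}
    (h : ∀ b, Semi (P b)) : Semi fun w σ => ∃ b, P b w σ := by
  have := Fintype.ofFinite β
  classical
  have key : ∀ s : Finset β, Semi fun w σ => ∃ b ∈ s, P b w σ := by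
    intro s
    induction s using Finset.induction_on with
    | empty => exact Semi.false.congr fun w σ => by simp
    | insert a s _ ih => exact ((h a).or ih).congr fun w σ => by simp
  exact (key Finset.univ).congr fun w σ => by simp

/-- A predicate is decidable if it and its complement are semidecidable. -/
def Dec {κ : Type} (P : ∀ w : List α, (κ → Word w) → Prop) : Prop :=
  Semi P ∧ Semi fun w σ => ¬ P w σ

namespace Dec

variable {κ κ' : Type} {P Q : ∀ w : List α, (κ → Word w) → Prop}

theorem congr (h : Dec P) (e : ∀ w σ, P w σ ↔ Q w σ) : Dec Q :=
  ⟨h.1.congr e, h.2.congr fun w σ => not_congr (e w σ)⟩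

theorem subst (h : Dec P) (f : κ → κ') :
    Dec fun w (σ : κ' → Word w) => P w fun i => σ (f i) :=
  ⟨h.1.subst f, h.2.subst f⟩

theorem not (h : Dec P) : Dec fun w σ => ¬ P w σ :=
  ⟨h.2, h.1.congr fun _ _ => not_not.symm⟩

theorem and (hP : Dec P) (hQ : Dec Q) : Dec fun w σ => P w σ ∧ Q w σ :=
  ⟨hP.1.and hQ.1, (hP.2.or hQ.2).congr fun _ _ => not_and_or.symm⟩

theorem or (hP : Dec P) (hQ : Dec Q) : Dec fun w σ => P w σ ∨ Q w σ :=
  ⟨hP.1.or hQ.1, (hP.2.and hQ.2).congr fun _ _ => not_or.symm⟩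

theorem imp (hP : Dec P) (hQ : Dec Q) : Dec fun w σ => P w σ → Q w σ :=
  (hP.not.or hQ).congr fun _ _ => imp_iff_not_or.symm

theorem const (p : Prop) : Dec fun (w : List α) (_ : κ → Word w) => p :=
  ⟨.const p, .const _⟩

theorem exists_finite {β : Type} [Finite β] {P : β → ∀ w : List α, (κ → Word w) → Prop}
    (h : ∀ b, Dec (P b)) : Dec fun w σ => ∃ b, P b w σ := by
  refine ⟨.exists_finite fun b => (h b).1, ?_⟩
  have := Fintype.ofFinite β
  classical
  have : ∀ s : Finset β, Semi fun w σ => ∀ b ∈ s, ¬ P b w σ := by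
    intro s
    induction s using Finset.induction_on with
    | empty => exact Semi.true.congr fun w σ => by simp
    | insert a s _ ih => exact ((h a).2.and ih).congr fun w σ => by simp
  exact (this Finset.univ).congr fun w σ => by simp

/-- For the complement, `¬ P` has to be verified for every value, and counting serves as the loop
over all values: when `A` is false the counted set is empty, so `B` is checked everywhere. -/
theorem ex {P : ∀ w : List α, (κ → Word w) → Word w → Prop}
    (h : Dec fun w (σ : Option κ → Word w) => P w (fun i => σ (some i)) (σ none)) :
    Dec fun w σ => ∃ v, P w σ v := by
  constructor
  · refine (Semi.ex (ι := Fin 1) (P := fun w σ v => P w σ (v 0))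
      (h.1.subst (fun | some i => Sum.inl i | none => Sum.inr 0 : Option κ → κ ⊕ Fin 1))).congr fun w σ => ?_
    exact ⟨fun ⟨v, h⟩ => ⟨v 0, h⟩, fun ⟨v, h⟩ => ⟨fun _ => v, h⟩⟩
  · refine (Semi.ex (ι := Fin 1) (P := fun w σ c => (tupleEquiv w 1 c : ℕ) = 0 ∧
      CountSplit (tupleEquiv w 1) (fun _ => False) (fun v => ¬ P w σ (v 0)) c)
      (.and (.tuple_zero _) (.countSplit (A := fun _ _ _ => False)
        (B := fun w σ v => ¬ P w (fun i => σ (Sum.inl i)) (v 0)) .false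
        (h.2.subst (fun | some i => Sum.inl (Sum.inl i) | none => Sum.inr 0 :
          Option κ → (κ ⊕ Fin 1) ⊕ Fin 1)) _))).congr
      fun w σ => ?_
    constructor
    · rintro ⟨c, hc, U, h1, h2, h3⟩ ⟨v, hv⟩
      exact h2 (fun _ => v) (fun h => h1 _ h) hv
    · intro hne
      have hN : 0 < (2 ^ width w) ^ 1 := by positivity
      refine ⟨(tupleEquiv w 1).symm ⟨0, hN⟩, by simp, ∅, by simp, fun v _ hv => hne ⟨_, hv⟩, by simp⟩

theorem all {P : ∀ w : List α, (κ → Word w) → Word w → Prop}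
    (h : Dec fun w (σ : Option κ → Word w) => P w (fun i => σ (some i)) (σ none)) :
    Dec fun w σ => ∀ v, P w σ v :=
  (ex (P := fun w σ v => ¬ P w σ v) h.not).not.congr fun w σ => by simp

/-- Pairs are all that is needed later: two states, two positions, or a position and a value. -/
theorem tc {R : ∀ w : List α, (κ → Word w) → Word w × Word w → Word w × Word w → Prop}
    (h : Dec fun w (σ : Option (Option (Option (Option κ))) → Word w) =>
      R w (fun i => σ (some (some (some (some i)))))
        (σ (some (some (some none))), σ (some (some none))) (σ (some none), σ none))
    (x y z t : κ) :
    Dec fun w σ => ReflTransGen (R w σ) (σ x, σ y) (σ z, σ t) := by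
  let f : Option (Option (Option (Option κ))) → (κ ⊕ Fin 2) ⊕ Fin 2
    | some (some (some (some i))) => Sum.inl (Sum.inl i)
    | some (some (some none)) => Sum.inl (Sum.inr 0)
    | some (some none) => Sum.inl (Sum.inr 1)
    | some none => Sum.inr 0
    | none => Sum.inr 1
  have e : ∀ w (σ : κ → Word w), ReflTransGen (fun p q : Fin 2 → Word w =>
      R w σ (p 0, p 1) (q 0, q 1)) (fun i => σ (![x, y] i)) (fun i => σ (![z, t] i)) ↔
      ReflTransGen (R w σ) (σ x, σ y) (σ z, σ t) := by
    intro w σ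
    constructor
    · intro h
      exact ReflTransGen.lift (p := R w σ) (fun p : Fin 2 → Word w => (p 0, p 1))
        (fun _ _ h => h) _ _ h
    · intro h
      have := ReflTransGen.lift (r := R w σ)
        (p := fun p q : Fin 2 → Word w => R w σ (p 0, p 1) (q 0, q 1))
        (fun p : Word w × Word w => ![p.1, p.2]) (fun _ _ h => h) _ _ h
      convert this using 1 <;> funext i <;> fin_cases i <;> rfl
  constructor
  · exact (Semi.tc (ι := Fin 2) (R := fun w σ p q => R w σ (p 0, p 1) (q 0, q 1))
      (h.1.subst f) ![x, y] ![z, t]).congr e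
  · exact (Semi.not_tc_fin (R := fun w σ p q => R w σ (p 0, p 1) (q 0, q 1))
      (h.1.subst f) (h.2.subst f) ![x, y] ![z, t]).congr fun w σ => not_congr (e w σ)

/-! ### Arithmetic on registers -/

theorem eq (i j : κ) : Dec fun (w : List α) (σ : κ → Word w) => σ i = σ j :=
  ⟨.eq i j, (Semi.tuple_ne (n := 1) (fun _ => i) fun _ => j).congr fun w σ => by
    simp [funext_iff]⟩

theorem zero (i : κ) : Dec fun (w : List α) (σ : κ → Word w) => (σ i : ℕ) = 0 := by
  refine ⟨.zero i, (Semi.ex (ι := Fin 1) (P := fun w σ v => (v 0 : ℕ) + 1 = σ i)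
    (.succ _ _)).congr fun w σ => ⟨?_, fun h => ?_⟩⟩
  · rintro ⟨v, h⟩
    omega
  · have := (σ i).2
    exact ⟨fun _ => ⟨(σ i : ℕ) - 1, by omega⟩, by simp only; omega⟩

theorem succ (i j : κ) : Dec fun (w : List α) (σ : κ → Word w) => (σ i : ℕ) + 1 = σ j := by
  refine ⟨.succ i j, ((zero j).1.or (Semi.ex (ι := Fin 1)
    (P := fun w σ v => (v 0 : ℕ) + 1 = σ j ∧ ¬ v 0 = σ i)
    (.and (.succ _ _) (eq _ _).2))).congr fun w σ => ⟨?_, fun h => ?_⟩⟩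
  · rintro (h | ⟨v, h1, h2⟩) h
    · omega
    · exact h2 (Fin.ext (by omega))
  · by_cases hj : (σ j : ℕ) = 0
    · exact .inl hj
    · have := (σ j).2
      refine .inr ⟨fun _ => ⟨(σ j : ℕ) - 1, by omega⟩, by simp only; omega, fun e => h ?_⟩
      beta_reduce
      rw [← e]
      simp only
      omega

/-- A symbol other than `a` is one of finitely many, and each of them has a positive test. -/
theorem input [Finite α] (i : κ) (a : InputSymbol α) :
    Dec fun (w : List α) (σ : κ → Word w) => readInput w (σ i) = a := by
  refine ⟨.input i a, (Semi.exists_finite (β := {b : InputSymbol α // b ≠ a})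
    fun b => .input i b.1).congr fun w σ => ⟨?_, fun h => ⟨⟨_, h⟩, rfl⟩⟩⟩
  rintro ⟨⟨b, hb⟩, h⟩
  beta_reduce
  rwa [h]

/-- Both components of a pair are increased together, from `σ i` and `0` until they are `σ k` and `σ
j`. No value exceeds its final one, so nothing overflows. -/
theorem add (i j k : κ) : Dec fun (w : List α) (σ : κ → Word w) => (σ i : ℕ) + σ j = σ k := by
  refine (ex (P := fun w σ z => (z : ℕ) = 0 ∧ ReflTransGen (fun p q : Word w × Word w =>
    (p.1 : ℕ) + 1 = q.1 ∧ (p.2 : ℕ) + 1 = q.2) (σ i, z) (σ k, σ j)) (.and (zero _)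
    (tc (R := fun w _ p q => (p.1 : ℕ) + 1 = q.1 ∧ (p.2 : ℕ) + 1 = q.2)
    (.and (succ _ _) (succ _ _)) _ _ _ _))).congr fun w σ => ?_
  constructor
  · rintro ⟨z, hz, h⟩
    have key : ∀ p : Word w × Word w, ReflTransGen (fun p q : Word w × Word w =>
        (p.1 : ℕ) + 1 = q.1 ∧ (p.2 : ℕ) + 1 = q.2) (σ i, z) p → (σ i : ℕ) + p.2 = p.1 := by
      intro p h
      induction h with
      | refl => simp [hz]
      | tail _ h ih => omega
    exact key _ h
  · generalize σ k = c
    generalize σ j = b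
    intro h
    refine ⟨⟨0, by positivity⟩, rfl, ?_⟩
    obtain ⟨b, hb⟩ := b
    induction b generalizing c with
    | zero => rw [show σ i = c from Fin.ext h]
    | succ b ih =>
      have hc := c.2
      simp only at h
      exact (ih ⟨c - 1, by omega⟩ (by omega) (by simp only; omega)).tail
        ⟨by simp only; omega, rfl⟩

/-- Multiplication is repeated addition, with the first component counting the additions. -/
theorem mul (i j k : κ) : Dec fun (w : List α) (σ : κ → Word w) => (σ i : ℕ) * σ j = σ k := by
  refine (ex (P := fun w σ z => (z : ℕ) = 0 ∧ ReflTransGen (fun p q : Word w × Word w =>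
    (p.1 : ℕ) + 1 = q.1 ∧ (p.2 : ℕ) + σ j = q.2) (z, z) (σ i, σ k)) (.and (zero _)
    (tc (R := fun w σ p q => (p.1 : ℕ) + 1 = q.1 ∧ (p.2 : ℕ) + σ (some j) = q.2)
    (.and (succ _ _) (add _ _ _)) _ _ _ _))).congr fun w σ => ?_
  constructor
  · rintro ⟨z, hz, h⟩
    have key : ∀ p : Word w × Word w, ReflTransGen (fun p q : Word w × Word w =>
        (p.1 : ℕ) + 1 = q.1 ∧ (p.2 : ℕ) + σ j = q.2) (z, z) p → (p.1 : ℕ) * σ j = p.2 := by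
      intro p h
      induction h with
      | refl => simp [hz]
      | tail _ h ih => rw [← h.1, ← h.2, ← ih]; ring
    exact key _ h
  · generalize σ k = c
    generalize σ i = a
    intro h
    refine ⟨⟨0, by positivity⟩, rfl, ?_⟩
    obtain ⟨a, ha⟩ := a
    induction a generalizing c with
    | zero => rw [show c = ⟨0, by positivity⟩ from Fin.ext (by simpa using h.symm)]
    | succ a ih =>
      have hc := c.2
      simp only [add_mul, one_mul] at h
      exact (ih ⟨c - σ j, by omega⟩ (by omega) (by simp only; omega)).tail
        ⟨rfl, by simp only; omega⟩

theorem le (i j : κ) : Dec fun (w : List α) (σ : κ → Word w) => (σ i : ℕ) ≤ σ j := by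
  refine (ex (P := fun w σ z => (σ i : ℕ) + z = σ j) (add _ _ _)).congr fun w σ => ⟨?_, fun h => ?_⟩
  · rintro ⟨z, h⟩
    omega
  · have := (σ j).2
    exact ⟨⟨σ j - σ i, by omega⟩, by simp only; omega⟩

theorem mem_NL [Finite α] {P : ∀ w : List α, (Empty → Word w) → Prop} (h : Dec P) :
    {w | P w fun i => i.elim} ∈ NL α := h.1.mem_NL

end Dec

theorem length_add_two_lt (w : List α) : w.length + 2 < 2 ^ width w := Nat.lt_size_self _

/-- A function is computable if its graph is decidable; values that are too large for a register
are allowed. -/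
def IsTerm {κ : Type} (f : ∀ w : List α, (κ → Word w) → ℕ) : Prop :=
  Dec fun w (σ : Option κ → Word w) => f w (fun i => σ (some i)) = (σ none : ℕ)

namespace IsTerm

variable {κ κ' : Type} {f g : ∀ w : List α, (κ → Word w) → ℕ}

theorem dec_eq (hf : IsTerm f) (i : κ) : Dec fun w σ => f w σ = (σ i : ℕ) :=
  hf.subst fun | some j => j | none => i

theorem subst (hf : IsTerm f) (h : κ → κ') :
    IsTerm fun w (σ : κ' → Word w) => f w fun i => σ (h i) :=
  Dec.subst hf (Option.map h)

theorem var (i : κ) : IsTerm fun (w : List α) (σ : κ → Word w) => (σ i : ℕ) :=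
  (Dec.eq (some i) none).congr fun _ _ => Fin.ext_iff

theorem const (n : ℕ) : IsTerm fun (w : List α) (_ : κ → Word w) => n := by
  change Dec fun w (σ : Option κ → Word w) => n = (σ none : ℕ)
  have key : ∀ {κ : Type} (i : κ), Dec fun (w : List α) (σ : κ → Word w) => n = (σ i : ℕ) := by
    induction n with
    | zero => exact fun i => (Dec.zero i).congr fun w σ => eq_comm
    | succ n ih =>
      intro κ i
      refine (Dec.ex (P := fun w σ v => (v : ℕ) + 1 = σ i ∧ n = (v : ℕ))
        (.and (.succ _ _) (ih _))).congr fun w σ => ⟨?_, fun h => ?_⟩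
      · rintro ⟨v, h1, rfl⟩
        exact h1
      · have := (σ i).2
        exact ⟨⟨n, by omega⟩, h, rfl⟩
  exact key none

/-- If the sum fits into a register, so do the summands, and they can be guessed. -/
theorem add (hf : IsTerm f) (hg : IsTerm g) : IsTerm fun w σ => f w σ + g w σ := by
  refine (Dec.ex (P := fun w (σ : Option κ → Word w) a => f w (fun i => σ (some i)) = (a : ℕ) ∧
    ∃ b : Word w, g w (fun i => σ (some i)) = (b : ℕ) ∧ (a : ℕ) + b = σ none)
    (.and (Dec.subst hf fun | some i => some (some i) | none => none)
    (.ex (.and (Dec.subst hg fun | some i => some (some (some i)) | none => none)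
    (.add _ _ _))))).congr fun w σ => ?_
  constructor
  · rintro ⟨a, h1, b, h2, h3⟩
    beta_reduce
    rw [h1, h2, h3]
  · intro h
    beta_reduce at h
    have := (σ none).2
    exact ⟨⟨f w fun i => σ (some i), by omega⟩, rfl, ⟨g w fun i => σ (some i), by omega⟩, rfl, h⟩

theorem mul (hf : IsTerm f) (hg : IsTerm g) : IsTerm fun w σ => f w σ * g w σ := by
  have hz : ∀ {f : ∀ w : List α, (κ → Word w) → ℕ}, IsTerm f → Dec fun w σ => f w σ = 0 := by
    intro f hf
    refine (Dec.ex (P := fun w (σ : κ → Word w) a => f w σ = (a : ℕ) ∧ (a : ℕ) = 0)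
      (.and hf (.zero _))).congr fun w σ => ⟨?_, fun h => ⟨⟨0, by positivity⟩, h, rfl⟩⟩
    rintro ⟨a, h1, h2⟩
    omega
  -- A product may vanish although one factor is too large for a register, so the factor `0` is
  -- treated apart. If both factors are positive, the product bounds them.
  refine (((hz hf).or (hz hg)).subst some |>.and (.zero none) |>.or
    (Dec.ex (P := fun w (σ : Option κ → Word w) a => f w (fun i => σ (some i)) = (a : ℕ) ∧
    ∃ b : Word w, g w (fun i => σ (some i)) = (b : ℕ) ∧ (a : ℕ) * b = σ none)
    (.and (Dec.subst hf fun | some i => some (some i) | none => none)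
    (.ex (.and (Dec.subst hg fun | some i => some (some (some i)) | none => none)
    (.mul _ _ _)))))).congr fun w σ => ?_
  constructor
  · beta_reduce
    rintro (⟨h1 | h1, h2⟩ | ⟨a, h1, b, h2, h3⟩)
    · rw [h1, h2, zero_mul]
    · rw [h1, h2, mul_zero]
    · rw [h1, h2, h3]
  · intro h
    beta_reduce at h ⊢
    have := (σ none).2
    by_cases h1 : f w (fun i => σ (some i)) = 0
    · exact .inl ⟨.inl h1, by rw [← h, h1, zero_mul]⟩
    by_cases h2 : g w (fun i => σ (some i)) = 0
    · exact .inl ⟨.inr h2, by rw [← h, h2, mul_zero]⟩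
    have h3 := Nat.le_mul_of_pos_right (f w fun i => σ (some i)) (Nat.pos_of_ne_zero h2)
    have h4 := Nat.le_mul_of_pos_left (g w fun i => σ (some i)) (Nat.pos_of_ne_zero h1)
    exact .inr ⟨⟨f w fun i => σ (some i), by omega⟩, rfl, ⟨g w fun i => σ (some i), by omega⟩,
      rfl, h⟩

theorem dec_le_var (hf : IsTerm f) (i : κ) : Dec fun w σ => f w σ ≤ (σ i : ℕ) := by
  refine (Dec.ex (P := fun w (σ : κ → Word w) v => f w σ = (v : ℕ) ∧ (v : ℕ) ≤ σ i)
    (.and hf (.le _ _))).congr fun w σ => ⟨?_, fun h => ?_⟩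
  · rintro ⟨v, h1, h2⟩
    omega
  · have := (σ i).2
    exact ⟨⟨f w σ, by omega⟩, rfl, h⟩

theorem dec_var_lt (hf : IsTerm f) (i : κ) : Dec fun w σ => (σ i : ℕ) < f w σ :=
  (hf.dec_le_var i).not.congr fun _ _ => not_le

/-- A bound for one side suffices, since in the case of equality the common value fits into a
register. -/
theorem dec_eq_of_lt (hf : IsTerm f) (hg : IsTerm g) (hb : ∀ w σ, g w σ < 2 ^ width w) :
    Dec fun w σ => f w σ = g w σ := by
  refine (Dec.ex (P := fun w (σ : κ → Word w) v => f w σ = (v : ℕ) ∧ g w σ = (v : ℕ))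
    (.and hf hg)).congr fun w σ => ⟨?_, fun h => ?_⟩
  · rintro ⟨v, h1, h2⟩
    exact h1.trans h2.symm
  · exact ⟨⟨g w σ, hb w σ⟩, h, rfl⟩

theorem dec_eq_bool (hf : IsTerm f) (b : Bool) : Dec fun w σ => f w σ = b.toNat :=
  hf.dec_eq_of_lt (.const _) fun w _ => by
    have h1 := b.toNat_lt
    have h2 := length_add_two_lt w
    omega

end IsTerm

end SpaceComplexity

/-! ### Words as lists of numbers -/

namespace SpaceComplexity

open Relation Noninterference

theorem Dec.getElem {α : Type} [Finite α] {κ : Type} (i : κ) (a : Option α) :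
    Dec fun (w : List α) (σ : κ → Word w) => w[(σ i : ℕ)]? = a := by
  have key : ∀ c : α, Dec fun (w : List α) (σ : κ → Word w) => w[(σ i : ℕ)]? = some c := by
    intro c
    refine (Dec.ex (P := fun w (σ : κ → Word w) q => (σ i : ℕ) + 1 = q ∧
      readInput w q = .letter c) (.and (.succ _ _) (.input _ _))).congr fun w σ => ⟨?_, fun h => ?_⟩
    · rintro ⟨q, h1, h2⟩
      rw [← h1] at h2
      simp only [readInput] at h2
      split at h2 <;> simp_all
    · have h1 := (List.getElem?_eq_some_iff.1 h).1
      have h2 := length_add_two_lt w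
      refine ⟨⟨σ i + 1, by omega⟩, rfl, ?_⟩
      simp [readInput, h]
  cases a with
  | some c => exact key c
  | none =>
    refine (Dec.exists_finite key).not.congr fun w σ => ?_
    cases w[(σ i : ℕ)]? <;> simp

/-- The digit at a position of a word; separators and positions beyond the end count as `0`. -/
def digit (w : List Letter) (p : ℕ) : Bool := decide (w[p]? = some (some true))

/-- The next position in the same block of digits, if there is one. -/
def next (w : List Letter) (p : ℕ) : ℕ :=
  match w[p]? with
  | some (some _) => p + 1
  | _ => p

/-- The number written at the beginning of a word. -/
def blockVal : List Letter → ℕ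
  | some b :: u => 2 * blockVal u + b.toNat
  | _ => 0

theorem blockVal_of_separator {w : List Letter} {p : ℕ} (h : ∀ b, w[p]? ≠ some (some b)) :
    blockVal (w.drop p) = 0 := by
  by_cases hp : p < w.length
  · rw [List.drop_eq_getElem_cons hp]
    rw [List.getElem?_eq_getElem hp] at h
    cases hc : w[p] with
    | none => rfl
    | some b => exact absurd (by rw [hc]) (h b)
  · rw [List.drop_eq_nil_of_le (by omega)]
    rfl

theorem drop_of_digit {w : List Letter} {p : ℕ} {a : Letter} (h : w[p]? = some a) :
    w.drop p = a :: w.drop (p + 1) := by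
  obtain ⟨hp, h⟩ := List.getElem?_eq_some_iff.1 h
  rw [List.drop_eq_getElem_cons hp, h]

/-- Since `next` stalls at a separator or beyond the word, where the digit counts as `0`, the
recursion holds at every position: a number acts as if padded with zeros forever. -/
theorem blockVal_drop (w : List Letter) (p : ℕ) :
    blockVal (w.drop p) = 2 * blockVal (w.drop (next w p)) + (digit w p).toNat := by
  by_cases h : ∃ b, w[p]? = some (some b)
  · obtain ⟨b, h⟩ := h
    rw [drop_of_digit h]
    simp only [blockVal, next, digit, h]
    cases b <;> simp
  · push Not at h
    rw [blockVal_of_separator h]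
    have h1 : next w p = p := by
      unfold next
      split
      · exact absurd ‹_› (h _)
      · rfl
    have h2 : digit w p = false := by simp [digit, h]
    rw [h1, h2, blockVal_of_separator h]
    rfl

theorem next_lt {w : List Letter} {p : ℕ} (h : p < 2 ^ width w) : next w p < 2 ^ width w := by
  unfold next
  split
  · rename_i h1
    have h1 := (List.getElem?_eq_some_iff.1 h1).1
    have h2 := length_add_two_lt w
    omega
  · exact h

/-! ### Evaluation and comparison of the written numbers -/

section

variable {κ : Type}

theorem Dec.digit_eq (i : κ) (b : Bool) :
    Dec fun (w : List Letter) (σ : κ → Word w) => digit w (σ i) = b := by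
  cases b
  · exact (Dec.getElem i (some (some true))).not.congr fun w σ => by simp [digit]
  · exact (Dec.getElem i (some (some true))).congr fun w σ => by simp [digit]

theorem Dec.isDigit (i : κ) :
    Dec fun (w : List Letter) (σ : κ → Word w) => ∃ b, w[(σ i : ℕ)]? = some (some b) :=
  .exists_finite fun b => .getElem i (some (some b))

theorem Dec.next_eq (i j : κ) :
    Dec fun (w : List Letter) (σ : κ → Word w) => next w (σ i) = σ j := by
  refine (((isDigit i).and (.succ i j)).or ((isDigit i).not.and (.eq i j))).congr fun w σ => ?_
  rw [Fin.ext_iff]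
  unfold next
  split
  · rename_i h
    simp [h]
  · rename_i h
    have : ¬ ∃ b, w[(σ i : ℕ)]? = some (some b) := fun ⟨b, hb⟩ => h b hb
    simp [this]

/-- Horner's scheme: the walk starts with value `0` at the end `q` of the block and goes back to
`p`, doubling and adding digits. The intermediate values never exceed `x`. -/
theorem blockVal_drop_iff {w : List Letter} {p x : Word w} :
    blockVal (w.drop p) = x ↔ ∃ q z : Word w, (z : ℕ) = 0 ∧ (¬ ∃ b, w[(q : ℕ)]? = some (some b)) ∧
      ReflTransGen (fun s t : Word w × Word w => (t.1 : ℕ) + 1 = s.1 ∧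
        ∃ b, w[(t.1 : ℕ)]? = some (some b) ∧ (s.2 : ℕ) + s.2 + b.toNat = t.2) (q, z) (p, x) := by
  constructor
  · obtain ⟨n, hn⟩ : ∃ n, w.length - p ≤ n := ⟨_, le_rfl⟩
    induction n generalizing p x with
    | zero =>
      intro h
      rw [List.drop_eq_nil_of_le (by omega)] at h
      refine ⟨p, x, h.symm, ?_, .refl⟩
      rw [List.getElem?_eq_none (by omega)]
      simp
    | succ n ih =>
      intro h
      by_cases hb : ∃ b, w[(p : ℕ)]? = some (some b)
      · obtain ⟨b, hb⟩ := hb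
        have h1 := (List.getElem?_eq_some_iff.1 hb).1
        have h2 := length_add_two_lt w
        have h3 := x.2
        rw [drop_of_digit hb] at h
        simp only [blockVal] at h
        obtain ⟨q, z, hz, hq, hr⟩ := @ih ⟨p + 1, by omega⟩ ⟨blockVal (w.drop (p + 1)), by omega⟩
          (by simp only; omega) rfl
        exact ⟨q, z, hz, hq, hr.tail ⟨rfl, b, hb, by simp only; omega⟩⟩
      · refine ⟨p, x, ?_, hb, .refl⟩
        rw [← h, blockVal_of_separator fun b h => hb ⟨b, h⟩]
  · rintro ⟨q, z, hz, hq, hr⟩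
    have key : ∀ t : Word w × Word w, ReflTransGen (fun s t : Word w × Word w =>
        (t.1 : ℕ) + 1 = s.1 ∧ ∃ b, w[(t.1 : ℕ)]? = some (some b) ∧
        (s.2 : ℕ) + s.2 + b.toNat = t.2) (q, z) t → blockVal (w.drop t.1) = t.2 := by
      intro t h
      induction h with
      | refl => rw [blockVal_of_separator fun b h => hq ⟨b, h⟩, hz]
      | tail _ h ih =>
        obtain ⟨h1, b, h2, h3⟩ := h
        rw [drop_of_digit h2, h1]
        simp only [blockVal]
        omega
    exact key _ hr

theorem isTerm_blockVal (i : κ) :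
    IsTerm fun (w : List Letter) (σ : κ → Word w) => blockVal (w.drop (σ i)) := by
  refine (Dec.ex (.ex (.and (.zero _) (.and (Dec.isDigit _).not (.tc
    (R := fun w _ s t => (t.1 : ℕ) + 1 = s.1 ∧
        ∃ b, w[(t.1 : ℕ)]? = some (some b) ∧ (s.2 : ℕ) + s.2 + b.toNat = t.2)
    (.and (.succ _ _) (.exists_finite fun b => .and (.getElem _ _)
      (((IsTerm.var _).add (.var _)).add (.const _) |>.dec_eq _))) _ _ _ _))))).congr
    fun w σ => blockVal_drop_iff.symm

/-- Simultaneous steps to the next digits. -/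
def NextStep (w : List Letter) (s t : Word w × Word w) : Prop :=
  next w s.1 = t.1 ∧ next w s.2 = t.2

theorem Dec.nextStep (x y z t : κ) : Dec fun (w : List Letter) (σ : κ → Word w) =>
    ReflTransGen (NextStep w) (σ x, σ y) (σ z, σ t) :=
  .tc (R := fun w _ => NextStep w) (.and (.next_eq _ _) (.next_eq _ _)) _ _ _ _

/-- The values may be too large for registers, so two positions move through the digits in parallel.
The padding with zeros takes care of different lengths. -/
theorem blockVal_ne_iff {w : List Letter} {p q : Word w} :
    blockVal (w.drop p) ≠ blockVal (w.drop q) ↔ ∃ p' q' : Word w,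
      ReflTransGen (NextStep w) (p, q) (p', q') ∧ digit w p' ≠ digit w q' := by
  constructor
  · intro h
    by_contra! hc
    refine h (Nat.eq_of_testBit_eq fun k => ?_)
    clear h
    induction k generalizing p q with
    | zero =>
      have h := hc p q .refl
      rw [blockVal_drop w p, blockVal_drop w q, h]
      cases digit w q <;> simp [Nat.testBit_zero]
    | succ k ih =>
      have h := @ih ⟨_, next_lt p.2⟩ ⟨_, next_lt q.2⟩
        fun p' q' h => hc p' q' (.head ⟨rfl, rfl⟩ h)
      have h1 := (digit w p).toNat_lt
      have h2 := (digit w q).toNat_lt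
      rw [Nat.testBit_succ, Nat.testBit_succ, blockVal_drop w p, blockVal_drop w q]
      convert h using 2 <;> simp only <;> omega
  · rintro ⟨p', q', h, hd⟩
    have key : ∀ s : Word w × Word w, ReflTransGen (NextStep w) s (p', q') →
        blockVal (w.drop s.1) ≠ blockVal (w.drop s.2) := by
      intro s hs
      induction hs using ReflTransGen.head_induction_on with
      | refl =>
        rw [blockVal_drop w p', blockVal_drop w q']
        cases h1 : digit w p' <;> cases h2 : digit w q' <;> simp_all <;> omega
      | @head s t hst _ ih =>
        rw [← hst.1, ← hst.2] at ih
        have h1 := (digit w s.1).toNat_lt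
        have h2 := (digit w s.2).toNat_lt
        rw [blockVal_drop w s.1, blockVal_drop w s.2]
        omega
    exact key _ h

/-- The pair `p'`, `q'` marks the most significant place at which the digits differ; whatever lies
below it has no influence on the order. -/
theorem blockVal_lt_iff {w : List Letter} {p q : Word w} :
    blockVal (w.drop p) < blockVal (w.drop q) ↔ ∃ p' q' : Word w,
      ReflTransGen (NextStep w) (p, q) (p', q') ∧ digit w p' = false ∧ digit w q' = true ∧
      ∃ p'' q'' : Word w, next w p' = p'' ∧ next w q' = q'' ∧
      blockVal (w.drop p'') = blockVal (w.drop q'') := by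
  constructor
  -- The larger number is positive, so dropping its lowest digit makes it strictly smaller.
  · obtain ⟨n, hn⟩ : ∃ n, blockVal (w.drop q) ≤ n := ⟨_, le_rfl⟩
    intro h
    induction n generalizing p q with
    | zero => omega
    | succ n ih =>
      rw [blockVal_drop w p, blockVal_drop w q] at h
      rw [blockVal_drop w q] at hn
      have h1 := (digit w p).toNat_lt
      have h2 := (digit w q).toNat_lt
      by_cases he : blockVal (w.drop (next w p)) = blockVal (w.drop (next w q))
      · refine ⟨p, q, .refl, ?_, ?_, ⟨_, next_lt p.2⟩, ⟨_, next_lt q.2⟩, rfl, rfl, he⟩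
        · cases h3 : digit w p
          · rfl
          · rw [h3] at h
            simp only [Bool.toNat_true] at h
            omega
        · cases h3 : digit w q
          · rw [h3] at h
            simp only [Bool.toNat_false] at h
            omega
          · rfl
      · obtain ⟨p', q', h3, h4⟩ := @ih ⟨_, next_lt p.2⟩ ⟨_, next_lt q.2⟩ (by simp only; omega)
          (by simp only; omega)
        exact ⟨p', q', .head ⟨rfl, rfl⟩ h3, h4⟩
  · rintro ⟨p', q', h, hp, hq, p'', q'', hp', hq', hd⟩
    have key : ∀ s : Word w × Word w, ReflTransGen (NextStep w) s (p', q') →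
        blockVal (w.drop s.1) < blockVal (w.drop s.2) := by
      intro s hs
      induction hs using ReflTransGen.head_induction_on with
      | refl =>
        rw [blockVal_drop w p', blockVal_drop w q', hp', hq', hd, hp, hq]
        simp
      | @head s t hst _ ih =>
        rw [← hst.1, ← hst.2] at ih
        have h1 := (digit w s.1).toNat_lt
        have h2 := (digit w s.2).toNat_lt
        rw [blockVal_drop w s.1, blockVal_drop w s.2]
        omega
    exact key _ h

theorem Dec.blockVal_eq (i j : κ) : Dec fun (w : List Letter) (σ : κ → Word w) =>
    blockVal (w.drop (σ i)) = blockVal (w.drop (σ j)) := by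
  refine (Dec.ex (P := fun w (σ : κ → Word w) p' => ∃ q' : Word w,
    ReflTransGen (NextStep w) (σ i, σ j) (p', q') ∧ ∃ b, digit w p' = b ∧ ¬ digit w q' = b)
    (.ex (.and (.nextStep _ _ _ _) (Dec.exists_finite fun b => .and (.digit_eq _ b)
      (.not (.digit_eq _ b)))))).not.congr fun w σ => ?_
  rw [← not_iff_not, not_not]
  exact (exists₂_congr fun _ _ => and_congr_right fun _ =>
    exists_eq_left'.trans ne_comm).trans blockVal_ne_iff.symm

theorem Dec.blockVal_lt (i j : κ) : Dec fun (w : List Letter) (σ : κ → Word w) =>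
    blockVal (w.drop (σ i)) < blockVal (w.drop (σ j)) :=
  (Dec.ex (.ex (.and (.nextStep _ _ _ _) (.and (.digit_eq _ _) (.and (.digit_eq _ _)
    (.ex (.ex (.and (.next_eq _ _) (.and (.next_eq _ _) (.blockVal_eq _ _)))))))))).congr
    fun _ _ => blockVal_lt_iff.symm

end

end SpaceComplexity

/-! ### Tables of numbers -/

namespace SpaceComplexity

open Relation Noninterference

/-- The numbers written in a word, without an unfinished block at the end. -/
def decode : List Letter → List ℕ
  | [] => []
  | none :: u => 0 :: decode u
  | some b :: u => match decode u with
    | [] => []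
    | x :: l => (2 * x + b.toNat) :: l

/-- The word consists of binary numbers without superfluous digits. -/
def Canonical (w : List Letter) : Prop :=
  ∀ (p : ℕ) (b : Bool), w[p]? = some (some b) →
    w[p + 1]? ≠ none ∧ ¬ (b = false ∧ w[p + 1]? = some none)

theorem canonical_cons {c : Letter} {u : List Letter} : Canonical (c :: u) ↔
    (∀ b, c = some b → u[0]? ≠ none ∧ ¬ (b = false ∧ u[0]? = some none)) ∧ Canonical u := by
  constructor
  · intro h
    exact ⟨fun b hb => h 0 b (by simp [hb]), fun p b hb => h (p + 1) b (by simpa using hb)⟩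
  · rintro ⟨h1, h2⟩ p b hb
    cases p with
    | zero => exact h1 b (by simpa using hb)
    | succ p => exact h2 p b (by simpa using hb)

theorem encodeNat_bit {n : ℕ} {b : Bool} (h : n = 0 → b = true) :
    encodeNat (2 * n + b.toNat) = some b :: encodeNat n := by
  rw [← Nat.bit_val]
  simp [encodeNat, Nat.bits_append_bit n b h]

theorem decode_encodeNat_append (n : ℕ) (u : List Letter) :
    decode (encodeNat n ++ u) = n :: decode u := by
  induction n using Nat.binaryRec' with
  | zero => simp [encodeNat, decode]
  | bit b n h ih =>
    rw [Nat.bit_val, encodeNat_bit h, List.cons_append, decode, ih]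

theorem decode_encode (l : List ℕ) : decode (l.flatMap encodeNat) = l := by
  induction l with
  | nil => rfl
  | cons n l ih => rw [List.flatMap_cons, decode_encodeNat_append, ih]

theorem encodeNat_head (n : ℕ) (u : List Letter) : (encodeNat n ++ u)[0]? = some none ↔ n = 0 := by
  rcases Nat.eq_zero_or_pos n with rfl | hn
  · simp [encodeNat]
  · rw [← Nat.bit_bodd_div2 n, Nat.bit_val, encodeNat_bit]
    · simp
      rw [← Nat.bit_bodd_div2 n, Nat.bit_val] at hn
      cases h : n.bodd <;> simp_all; omega
    · intro h
      rw [← Nat.bit_bodd_div2 n, Nat.bit_val, h] at hn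
      cases h : n.bodd <;> simp_all

theorem canonical_encodeNat_append {n : ℕ} {u : List Letter} (h : Canonical u) :
    Canonical (encodeNat n ++ u) := by
  induction n using Nat.binaryRec' with
  | zero => simpa [encodeNat, canonical_cons] using h
  | bit b n hb ih =>
    rw [Nat.bit_val, encodeNat_bit hb, List.cons_append, canonical_cons]
    refine ⟨fun c hc => ⟨?_, ?_⟩, ih⟩
    · simp [encodeNat]
    · rw [encodeNat_head]
      rintro ⟨rfl, h0⟩
      simp [hb h0] at hc

/-- Decoding loses only superfluous zeros and an unfinished last block. `Canonical` excludes exactly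
these, so that encoding inverts decoding. -/
theorem canonical_iff {w : List Letter} : Canonical w ↔ (decode w).flatMap encodeNat = w := by
  constructor
  · intro h
    induction w with
    | nil => rfl
    | cons c u ih =>
      obtain ⟨h1, h2⟩ := canonical_cons.1 h
      have ih := ih h2
      cases c with
      | none => rw [decode, List.flatMap_cons, ih]; rfl
      | some b =>
        obtain ⟨h3, h4⟩ := h1 b rfl
        rw [decode]
        cases hd : decode u with
        | nil =>
          rw [hd] at ih
          rw [← ih] at h3
          simp at h3
        | cons x l =>
          rw [hd, List.flatMap_cons] at ih
          rw [← ih, encodeNat_head] at h4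
          simp only
          rw [List.flatMap_cons, encodeNat_bit, List.cons_append, ih]
          intro hx
          cases b <;> simp_all
  · intro h
    rw [← h]
    generalize decode w = l
    induction l with
    | nil => intro p b hb; simp at hb
    | cons n l ih => exact canonical_encodeNat_append ih

theorem length_decode_le (w : List Letter) : (decode w).length ≤ w.length := by
  induction w with
  | nil => simp [decode]
  | cons c u ih =>
    cases c with
    | none => simpa [decode] using ih
    | some b =>
      rw [decode]
      split
      · simp
      · rename_i h
        rw [h] at ih
        simp at ih ⊢
        omega

/-- The position `q` is the first one after the block containing the position `p`. -/
def BlockEnd (w : List Letter) (p q : Word w) : Prop :=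
  ∃ r : Word w, ReflTransGen (fun s t : Word w × Word w => s.2 = t.2 ∧ next w s.1 = t.1)
    (p, p) (r, p) ∧ w[(r : ℕ)]? = some none ∧ (r : ℕ) + 1 = q

theorem decode_of_blockEnd {w : List Letter} {p q : Word w} (h : BlockEnd w p q) :
    decode (w.drop p) = blockVal (w.drop p) :: decode (w.drop q) := by
  obtain ⟨r, h, hr, hq⟩ := h
  have key : ∀ s : Word w × Word w,
      ReflTransGen (fun s t : Word w × Word w => s.2 = t.2 ∧ next w s.1 = t.1) s (r, p) →
      decode (w.drop s.1) = blockVal (w.drop s.1) :: decode (w.drop q) := by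
    intro s hs
    induction hs using ReflTransGen.head_induction_on with
    | refl =>
      rw [drop_of_digit hr, decode, hq]
      rfl
    | @head s t hst _ ih =>
      by_cases hb : ∃ b, w[(s.1 : ℕ)]? = some (some b)
      · obtain ⟨b, hb⟩ := hb
        have hn : next w s.1 = s.1 + 1 := by simp [next, hb]
        rw [← hst.2, hn] at ih
        rw [drop_of_digit hb, decode, ih]
        rfl
      · have hn : next w s.1 = s.1 := by
          unfold next
          split
          · exact absurd ⟨_, ‹_›⟩ hb
          · rfl
        rwa [← hst.2, hn] at ih
  exact key _ h

theorem exists_blockEnd {w : List Letter} (p : Word w) (h : decode (w.drop p) ≠ []) :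
    ∃ q, BlockEnd w p q := by
  -- The second component of the pairs is a dummy that has to stay fixed while `p` moves in the
  -- induction.
  suffices h' : ∀ x, ∃ r q : Word w, ReflTransGen (fun s t : Word w × Word w =>
      s.2 = t.2 ∧ next w s.1 = t.1) (p, x) (r, x) ∧ w[(r : ℕ)]? = some none ∧ (r : ℕ) + 1 = q by
    obtain ⟨r, q, h1⟩ := h' p
    exact ⟨q, r, h1⟩
  intro x
  obtain ⟨n, hn⟩ : ∃ n, w.length - p ≤ n := ⟨_, le_rfl⟩
  induction n generalizing p with
  | zero =>
    rw [List.drop_eq_nil_of_le (by omega)] at h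
    exact absurd rfl h
  | succ n ih =>
    have hl := length_add_two_lt w
    cases hc : w[(p : ℕ)]? with
    | none =>
      rw [List.drop_eq_nil_of_le (by simpa using hc)] at h
      exact absurd rfl h
    | some c =>
      have hp := (List.getElem?_eq_some_iff.1 hc).1
      cases c with
      | none => exact ⟨p, ⟨p + 1, by omega⟩, .refl, hc, rfl⟩
      | some b =>
        obtain ⟨r, q, h1, h2⟩ := ih ⟨p + 1, by omega⟩ (by
          intro h0
          rw [drop_of_digit hc, decode, h0] at h
          exact h rfl) (by simp only; omega)
        exact ⟨r, q, .head (b := (⟨p + 1, by omega⟩, x)) ⟨rfl, by simp [next, hc]⟩ h1, h2⟩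

/-- The block with the number `i` begins at the position `p`. -/
def StartsAt (w : List Letter) (p i : Word w) : Prop :=
  ∃ z : Word w, (z : ℕ) = 0 ∧ ReflTransGen (fun s t : Word w × Word w =>
    BlockEnd w s.1 t.1 ∧ (s.2 : ℕ) + 1 = t.2) (z, z) (p, i)

theorem decode_of_startsAt {w : List Letter} {p i : Word w} (h : StartsAt w p i) :
    decode (w.drop p) = (decode w).drop i := by
  obtain ⟨z, hz, h⟩ := h
  have key : ∀ t : Word w × Word w, ReflTransGen (fun s t : Word w × Word w =>
      BlockEnd w s.1 t.1 ∧ (s.2 : ℕ) + 1 = t.2) (z, z) t →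
      decode (w.drop t.1) = (decode w).drop t.2 := by
    intro t ht
    induction ht with
    | refl => simp [hz]
    | tail _ h ih =>
      rw [decode_of_blockEnd h.1] at ih
      rw [← h.2, ← List.drop_drop, ← ih]
      rfl
  exact key _ h

/-- The last step passed a complete block, so the list has an entry with index `i - 1`. -/
theorem startsAt_le {w : List Letter} {p i : Word w} (h : StartsAt w p i) :
    (i : ℕ) ≤ (decode w).length := by
  obtain ⟨z, hz, h⟩ := h
  cases h.cases_tail with
  | inl h => simp_all
  | inr h =>
    obtain ⟨t, h1, h2, h3⟩ := h
    have h4 := decode_of_startsAt ⟨z, hz, h1⟩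
    rw [decode_of_blockEnd h2] at h4
    by_contra hc
    simp only at h3
    rw [List.drop_eq_nil_of_le (as := decode w) (by omega)] at h4
    simp at h4

theorem exists_startsAt {w : List Letter} (i : Word w) (hi : (i : ℕ) ≤ (decode w).length) :
    ∃ p, StartsAt w p i := by
  obtain ⟨i, hw⟩ := i
  induction i with
  | zero => exact ⟨⟨0, hw⟩, ⟨0, hw⟩, rfl, .refl⟩
  | succ i ih =>
    simp only at hi
    obtain ⟨p, hp⟩ := ih (by omega) (by simp only; omega)
    have hd := decode_of_startsAt hp
    obtain ⟨q, hq⟩ := exists_blockEnd p (by rw [hd]; simp; omega)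
    obtain ⟨z, hz, h⟩ := hp
    exact ⟨q, z, hz, h.tail ⟨hq, rfl⟩⟩

/-- The number with index `i` in a word, or `0` if there is no such number. -/
def entry (w : List Letter) (i : ℕ) : ℕ := (decode w)[i]?.getD 0

section

variable {κ : Type} {f g : ∀ w : List Letter, (κ → Word w) → ℕ}

theorem Dec.blockEnd (i j : κ) :
    Dec fun (w : List Letter) (σ : κ → Word w) => BlockEnd w (σ i) (σ j) := by
  unfold BlockEnd
  refine .ex (.and ?_ (.and (.getElem _ _) (.succ _ _)))
  exact .tc (R := fun w _ s t => s.2 = t.2 ∧ next w s.1 = t.1) (.and (.eq _ _) (.next_eq _ _))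
    _ _ _ _

theorem Dec.startsAt (i j : κ) :
    Dec fun (w : List Letter) (σ : κ → Word w) => StartsAt w (σ i) (σ j) := by
  unfold StartsAt
  refine .ex (.and (.zero _) ?_)
  exact .tc (R := fun w _ s t => BlockEnd w s.1 t.1 ∧ (s.2 : ℕ) + 1 = t.2)
    (.and (.blockEnd _ _) (.succ _ _)) _ _ _ _

/-- There is a number with index `i`, which begins at the position `p`. -/
def BlockAt (w : List Letter) (i : ℕ) (p : Word w) : Prop :=
  ∃ j : Word w, i = j ∧ StartsAt w p j ∧ ∃ q, BlockEnd w p q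

theorem BlockAt.entry_eq {w : List Letter} {i : ℕ} {p : Word w} (h : BlockAt w i p) :
    i < (decode w).length ∧ entry w i = blockVal (w.drop p) := by
  obtain ⟨j, rfl, hj, q, hq⟩ := h
  have h := decode_of_startsAt hj
  rw [decode_of_blockEnd hq] at h
  have h1 : (decode w)[(j : ℕ)]? = some (blockVal (w.drop p)) := by
    have := congrArg (fun l => l[0]?) h
    simpa using this.symm
  refine ⟨(List.getElem?_eq_some_iff.1 h1).1, ?_⟩
  rw [entry, h1]
  rfl

theorem exists_blockAt {w : List Letter} {i : ℕ} (h : i < (decode w).length) :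
    ∃ p, BlockAt w i p := by
  have h1 := length_decode_le w
  have h2 := length_add_two_lt w
  obtain ⟨p, hp⟩ := exists_startsAt (w := w) ⟨i, by omega⟩ h.le
  refine ⟨p, _, rfl, hp, exists_blockEnd p ?_⟩
  rw [decode_of_startsAt hp]
  simpa using h

theorem IsTerm.blockAt (hf : IsTerm f) (j : κ) : Dec fun w σ => BlockAt w (f w σ) (σ j) := by
  unfold BlockAt
  refine .ex (.and (Dec.congr hf fun _ _ => Iff.rfl) (.and (.startsAt _ _) (.ex (.blockEnd _ _))))

/-- A position of a word at which the number with index `i` can be read; this is the end of the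
word if there is no such number. -/
def EntryAt (w : List Letter) (i : ℕ) (p : Word w) : Prop :=
  BlockAt w i p ∨ (¬ ∃ q, BlockAt w i q) ∧ w[(p : ℕ)]? = none

theorem EntryAt.entry_eq {w : List Letter} {i : ℕ} {p : Word w} (h : EntryAt w i p) :
    entry w i = blockVal (w.drop p) := by
  obtain h | ⟨h1, h2⟩ := h
  · exact h.entry_eq.2
  · have h3 : (decode w)[i]? = none := by
      rw [List.getElem?_eq_none_iff]
      by_contra hc
      exact h1 (exists_blockAt (not_le.1 hc))
    rw [entry, h3, blockVal_of_separator (by simp [h2])]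
    rfl

theorem exists_entryAt (w : List Letter) (i : ℕ) : ∃ p, EntryAt w i p := by
  by_cases h : ∃ q, BlockAt w i q
  · exact h.imp fun _ => .inl
  · have h2 := length_add_two_lt w
    exact ⟨⟨w.length, by omega⟩, .inr ⟨h, by simp⟩⟩

theorem IsTerm.entryAt (hf : IsTerm f) (j : κ) : Dec fun w σ => EntryAt w (f w σ) (σ j) :=
  .or (hf.blockAt j) (.and (.not (.ex ((hf.subst some).blockAt none))) (.getElem j none))

/-- An index too large for a register exceeds the length of the list. The entry is then `0`, which
is also what `EntryAt` reads at the end of the word. -/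
theorem IsTerm.entry_apply (hf : IsTerm f) : IsTerm fun w σ => entry w (f w σ) := by
  refine (Dec.ex (P := fun w (σ : Option κ → Word w) p => EntryAt w (f w fun i => σ (some i)) p ∧
    blockVal (w.drop p) = σ none) (.and (((hf.subst some).subst some).entryAt none)
    ((isTerm_blockVal none).dec_eq (some none)))).congr fun w σ => ⟨?_, fun h => ?_⟩
  · rintro ⟨p, h1, h2⟩
    exact h1.entry_eq.trans h2
  · obtain ⟨p, hp⟩ := exists_entryAt w (f w fun i => σ (some i))
    exact ⟨p, hp, hp.entry_eq.symm.trans h⟩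

/-- Only the positions of the two entries are kept in registers, so entries of any size can be
compared. -/
theorem IsTerm.entry_rel {r : ℕ → ℕ → Prop} (hr : Dec fun w (σ : Bool → Word w) =>
    r (blockVal (w.drop (σ false)))
      (blockVal (w.drop (σ true))))
    (hf : IsTerm f) (hg : IsTerm g) :
    Dec fun w σ => r (entry w (f w σ)) (entry w (g w σ)) := by
  refine (Dec.ex (P := fun w (σ : κ → Word w) p => EntryAt w (f w σ) p ∧ ∃ q : Word w,
    EntryAt w (g w σ) q ∧ r (blockVal (w.drop p))
    (blockVal (w.drop q)))
    (.and ((hf.subst some).entryAt none) (.ex (.and (((hg.subst some).subst some).entryAt none)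
    (hr.subst fun | false => some none | true => none))))).congr fun w σ => ⟨?_, fun h => ?_⟩
  · rintro ⟨p, h1, q, h2, h3⟩
    rwa [h1.entry_eq, h2.entry_eq]
  · obtain ⟨p, hp⟩ := exists_entryAt w (f w σ)
    obtain ⟨q, hq⟩ := exists_entryAt w (g w σ)
    refine ⟨p, hp, q, hq, ?_⟩
    rw [← hp.entry_eq, ← hq.entry_eq]
    exact h

theorem IsTerm.entry_eq_entry (hf : IsTerm f) (hg : IsTerm g) :
    Dec fun w σ => entry w (f w σ) = entry w (g w σ) :=
  entry_rel (r := (· = ·)) (.blockVal_eq _ _) hf hg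

theorem IsTerm.entry_lt_entry (hf : IsTerm f) (hg : IsTerm g) :
    Dec fun w σ => entry w (f w σ) < entry w (g w σ) :=
  entry_rel (r := (· < ·)) (.blockVal_lt _ _) hf hg

/-- The length is the index reached behind the last complete block, at a position from which no
further block can be completed. -/
theorem isTerm_length : IsTerm fun (w : List Letter) (_ : κ → Word w) => (decode w).length := by
  refine (Dec.ex (P := fun w (σ : Option κ → Word w) p => StartsAt w p (σ none) ∧
    ¬ ∃ q, BlockEnd w p q) (.and (.startsAt _ _) (.not (.ex (.blockEnd _ _))))).congr
    fun w σ => ⟨?_, fun h => ?_⟩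
  · rintro ⟨p, h1, h2⟩
    have h3 : (decode w).drop (σ none) = [] := by
      rw [← decode_of_startsAt h1]
      by_contra hc
      exact h2 (exists_blockEnd p hc)
    exact le_antisymm (List.drop_eq_nil_iff.1 h3) (startsAt_le h1)
  · obtain ⟨p, hp⟩ := exists_startsAt (σ none) h.ge
    refine ⟨p, hp, ?_⟩
    rintro ⟨q, hq⟩
    have h1 := decode_of_startsAt hp
    rw [decode_of_blockEnd hq, List.drop_eq_nil_of_le h.le] at h1
    simp at h1

theorem Dec.canonical : Dec fun (w : List Letter) (_ : κ → Word w) => Canonical w := by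
  refine (Dec.ex (P := fun w (_ : κ → Word w) p => ∃ q : Word w, (p : ℕ) + 1 = q ∧
    ∃ b, w[(p : ℕ)]? = some (some b) ∧ (w[(q : ℕ)]? = none ∨ b = false ∧ w[(q : ℕ)]? = some none))
    (.ex (.and (.succ _ _) (.exists_finite fun b => .and (.getElem _ (some (some b)))
    (.or (.getElem _ none) (.and (.const (b = false)) (.getElem _ (some none)))))))).not.congr
    fun w σ => ?_
  constructor
  · intro h p b hb
    have h1 := (List.getElem?_eq_some_iff.1 hb).1
    have h2 := length_add_two_lt w
    refine ⟨fun h3 => h ?_, fun h3 => h ?_⟩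
    · exact ⟨⟨p, by omega⟩, ⟨p + 1, by omega⟩, rfl, b, hb, .inl h3⟩
    · exact ⟨⟨p, by omega⟩, ⟨p + 1, by omega⟩, rfl, b, hb, .inr h3⟩
  · rintro h ⟨p, q, hq, b, hb, h1⟩
    rw [← hq] at h1
    exact h1.elim (h p b hb).1 (h p b hb).2

end

end SpaceComplexity

/-! ### Uniformity and security as properties of pairs of runs -/

namespace Noninterference.System

open Relation

variable {S A D O : Type*} {M : System S A D O} {P : Policy S D}

theorem run_append (s : S) (α β : List A) : M.run s (α ++ β) = M.run (M.run s α) β :=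
  List.foldl_append

theorem src_subset_src_cons {a : A} {α : List A} {u : D} {s : S} :
    M.src P α u (M.step s a) ⊆ M.src P (a :: α) u s := by
  rw [src]
  split
  · exact Set.subset_union_left
  · exact subset_rfl

/-- If the domain of `a` is already a source of the remaining run, reflexivity of the policy
supplies the edge. -/
theorem dom_mem_src_cons {a : A} {α : List A} {u : D} {s : S} :
    M.dom a ∈ M.src P (a :: α) u s ↔ ∃ v ∈ M.src P α u (M.step s a), P.edge s (M.dom a) v := by
  rw [src]
  split
  · rename_i h
    simp [h]
  · rename_i h
    refine ⟨fun h' => absurd ⟨_, h', P.refl _ _⟩ h, fun h' => absurd h' h⟩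

theorem mem_src_cons {a : A} {α : List A} {u v : D} {s : S} :
    v ∈ M.src P (a :: α) u s ↔ v ∈ M.src P α u (M.step s a) ∨
      v = M.dom a ∧ ∃ x ∈ M.src P α u (M.step s a), P.edge s (M.dom a) x := by
  rw [src]
  split
  · rename_i h
    simp [h, or_comm]
  · rename_i h
    simp [h]

theorem self_mem_src (α : List A) (u : D) (s : S) : u ∈ M.src P α u s := by
  induction α generalizing s with
  | nil => rfl
  | cons a α ih => exact src_subset_src_cons (ih _)

/-- Transmission composes along a split run; this traces a source at an inner place back to the
start. -/
theorem src_trans {γ δ : List A} {u v x : D} {s : S} (hv : v ∈ M.src P δ u (M.run s γ))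
    (hx : x ∈ M.src P γ v s) : x ∈ M.src P (γ ++ δ) u s := by
  induction γ generalizing s x with
  | nil =>
    obtain rfl : x = v := hx
    exact hv
  | cons a γ ih =>
    rw [List.cons_append, mem_src_cons]
    rcases mem_src_cons.1 hx with h | ⟨h, y, hy, hxy⟩
    · exact .inl (ih hv h)
    · exact .inr ⟨h, y, ih hv hy, hxy⟩

theorem src_subset_of_forall {T : Set D} {α : List A} {u : D} (hu : u ∈ T)
    (h : ∀ b ∈ α, M.dom b ∈ T) (s : S) : M.src P α u s ⊆ T := by
  induction α generalizing s with
  | nil => simpa [src] using hu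
  | cons b α ih =>
    intro v hv
    rcases mem_src_cons.1 hv with hv | ⟨rfl, -⟩
    · exact ih (fun c hc => h c (List.mem_cons_of_mem _ hc)) _ hv
    · exact h b (by simp)

variable (M P)

/-- If `a` may not interfere in `s` with `u` and the domains of the actions of `α`, then omitting
`a` from the run `a :: α` from `s` is not visible to `u` through `F`. -/
def RestrictedAgree {X : Type*} (F : D → S → X) : Prop :=
  ∀ (s : S) (a : A) (u : D) (α : List A), ¬ P.edge s (M.dom a) u →
    (∀ b ∈ α, ¬ P.edge s (M.dom a) (M.dom b)) →
    F u (M.run s (a :: α)) = F u (M.run s α)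

/-- Performing an action that is not transmitted to `u` is not visible to `u` through `F`. -/
def SourceAgree {X : Type*} (F : D → S → X) : Prop :=
  ∀ (u : D) (s : S) (a : A) (α : List A), M.dom a ∉ M.src P (a :: α) u s →
    F u (M.run s (a :: α)) = F u (M.run s α)

variable {M P}

/-- All sources lie among `u` and the domains of actions of `α`, and `dom a` may interfere with none
of these in `s`. -/
theorem SourceAgree.restricted {X : Type*} {F : D → S → X} (h : M.SourceAgree P F) :
    M.RestrictedAgree P F := by
  intro s a u α hu hα
  refine h u s a α fun hm => ?_
  obtain ⟨v, hv, hav⟩ := dom_mem_src_cons.1 hm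
  exact src_subset_of_forall (T := {v | ¬ P.edge s (M.dom a) v}) hu hα _ hv hav

/-- `SourceAgree` for the local policies, restricted to lists with fewer than `n` actions. -/
def UniformBelow (M : System S A D O) (P : Policy S D) (n : ℕ) : Prop :=
  ∀ (u : D) (s : S) (a : A) (α : List A), α.length < n → M.dom a ∉ M.src P (a :: α) u s →
    P.mayInterfere u (M.run s (a :: α)) = P.mayInterfere u (M.run s α)

/-- Induction on the remaining run `δ`, whose first action moves over to `γ`. For a source `v` of
the rest, `b` is not transmitted to `v` along `γ`, as it would then reach `u`. So uniformity for the
shorter run gives `v` the same incoming edges in both states. -/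
theorem UniformBelow.src_eq {n : ℕ} (hP : M.UniformBelow P n) {u : D} {s : S} {b : A}
    (γ δ : List A) (hn : (γ ++ δ).length ≤ n) (hb : M.dom b ∉ M.src P (b :: (γ ++ δ)) u s) :
    M.src P δ u (M.run s (b :: γ)) = M.src P δ u (M.run s γ) := by
  induction δ generalizing γ with
  | nil => rfl
  | cons c δ ih =>
    have h1 := ih (γ ++ [c]) (by simpa using hn) (by simpa using hb)
    rw [← List.cons_append, run_append, run_append] at h1
    change M.src P δ u (M.step _ c) = M.src P δ u (M.step _ c) at h1
    have h2 : ∀ v ∈ M.src P δ u (M.step (M.run s (b :: γ)) c),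
        P.edge (M.run s (b :: γ)) (M.dom c) v ↔ P.edge (M.run s γ) (M.dom c) v := by
      intro v hv
      have h3 := hP v s b γ (by simp at hn; omega) fun h => hb
        (src_trans (γ := b :: γ) (src_subset_src_cons hv) h)
      exact Set.ext_iff.1 h3 (M.dom c)
    ext v
    rw [mem_src_cons, mem_src_cons, ← h1]
    exact or_congr_right (and_congr_right fun _ => exists_congr fun y =>
      and_congr_right fun hy => h2 y hy)

theorem src_append_congr {β γ δ : List A} {u : D} {s : S}
    (h : M.src P γ u (M.run s β) = M.src P δ u (M.run s β)) :
    M.src P (β ++ γ) u s = M.src P (β ++ δ) u s := by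
  induction β generalizing s with
  | nil => exact h
  | cons b β ih =>
    ext v
    rw [List.cons_append, List.cons_append, mem_src_cons, mem_src_cons, ih h]

theorem src_cons_of_notMem {b : A} {γ : List A} {u : D} {s : S}
    (h : M.dom b ∉ M.src P (b :: γ) u s) : M.src P (b :: γ) u s = M.src P γ u (M.step s b) := by
  ext v
  rw [mem_src_cons, or_iff_left]
  rintro ⟨rfl, hv⟩
  exact h (dom_mem_src_cons.2 hv)

/-- If in `s` the agent `dom a` may interfere with the domain of some `b`, where `α = β ++ b :: γ`,
then `b` is not transmitted to `u`, since otherwise `a` would be. Both runs can then be compared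
with the run of `β ++ γ`, which is shorter than `α`. -/
theorem RestrictedAgree.of_le {X : Type*} {F : D → S → X} (h : M.RestrictedAgree P F) {n : ℕ}
    (hP : M.UniformBelow P n)
    (hF : ∀ (u : D) (s : S) (a : A) (α : List A), α.length < n → M.dom a ∉ M.src P (a :: α) u s →
      F u (M.run s (a :: α)) = F u (M.run s α))
    (u : D) (s : S) (a : A) (α : List A) (hn : α.length ≤ n)
    (hs : M.dom a ∉ M.src P (a :: α) u s) : F u (M.run s (a :: α)) = F u (M.run s α) := by
  have hs' : ∀ v ∈ M.src P α u (M.step s a), ¬ P.edge s (M.dom a) v := by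
    simpa [dom_mem_src_cons] using hs
  by_cases hα : ∀ b ∈ α, ¬ P.edge s (M.dom a) (M.dom b)
  · exact h s a u α (hs' _ (self_mem_src _ _ _)) hα
  push Not at hα
  obtain ⟨b, hb, hab⟩ := hα
  obtain ⟨β, γ, rfl⟩ := List.append_of_mem hb
  have hl : β.length + γ.length + 1 ≤ n := by simp at hn; omega
  have h1 : M.dom b ∉ M.src P (b :: γ) u (M.run s (a :: β)) := fun h' =>
    hs' _ (src_trans (γ := β) h' (self_mem_src _ _ _)) hab
  have h2 : M.dom b ∉ M.src P (b :: γ) u (M.run s β) := by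
    rwa [← hP.src_eq β (b :: γ) hn hs]
  -- Omitting `b`, which is not transmitted, leaves the sources as they are, so `a` is still not
  -- transmitted on the shorter run.
  have h3 : M.dom a ∉ M.src P (a :: (β ++ γ)) u s := by
    have h4 : M.src P γ u (M.run s (a :: β)) = M.src P (b :: γ) u (M.run s (a :: β)) := by
      rw [src_cons_of_notMem h1]
      exact (hP.src_eq [] γ (by simp; omega) h1).symm
    rwa [← List.cons_append, src_append_congr h4]
  have e1 := hF u _ b γ (by omega) h1
  have e2 := hF u s a (β ++ γ) (by simp; omega) h3
  have e3 := hF u _ b γ (by omega) h2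
  rw [← run_append] at e1 e3
  rw [← run_append] at e1 e3
  -- Delete `b` after `a`, then delete `a`, then put `b` back.
  exact e1.trans (e2.trans e3.symm)

/-- When `F` is the local policy, `of_le` yields its own uniformity assumption for one more action,
so the induction feeds itself. -/
theorem RestrictedAgree.uniformBelow (h : M.RestrictedAgree P P.mayInterfere) (n : ℕ) :
    M.UniformBelow P n := by
  induction n with
  | zero => exact fun u s a α hn => absurd hn (Nat.not_lt_zero _)
  | succ n ih => exact fun u s a α hn => h.of_le ih ih u s a α (Nat.lt_succ_iff.1 hn)

theorem RestrictedAgree.sourceAgree {X : Type*} {F : D → S → X} (h : M.RestrictedAgree P F)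
    (hP : M.RestrictedAgree P P.mayInterfere) : M.SourceAgree P F := by
  have key : ∀ n u s a (α : List A), α.length < n → M.dom a ∉ M.src P (a :: α) u s →
      F u (M.run s (a :: α)) = F u (M.run s α) := by
    intro n
    induction n with
    | zero => exact fun u s a α hn => absurd hn (Nat.not_lt_zero _)
    | succ n ih =>
      exact fun u s a α hn => h.of_le (hP.uniformBelow n) ih u s a α (Nat.lt_succ_iff.1 hn)
  exact fun u s a α => key _ u s a α (Nat.lt_succ_self _)

/-- Passing to the generated equivalence adds nothing, because equality of local policies is itself
an equivalence. -/
theorem intransitivelyUniform_iff_sourceAgree :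
    M.IntransitivelyUniform P ↔ M.SourceAgree P P.mayInterfere := by
  constructor
  · exact fun h u s a α hs => h u _ _ (.rel _ _ ⟨s, a, α, hs, rfl, rfl⟩)
  · intro h u s t hst
    induction hst with
    | rel x y h' =>
      obtain ⟨s, a, α, hs, rfl, rfl⟩ := h'
      exact h u s a α hs
    | refl => rfl
    | symm _ _ _ ih => exact ih.symm
    | trans _ _ _ _ _ ih1 ih2 => exact ih1.trans ih2

theorem intransitivelyUniform_iff :
    M.IntransitivelyUniform P ↔ M.RestrictedAgree P P.mayInterfere :=
  intransitivelyUniform_iff_sourceAgree.trans ⟨SourceAgree.restricted, fun h => h.sourceAgree h⟩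

theorem IntransitivelyUniform.iSecure_iff (h : M.IntransitivelyUniform P) :
    M.ISecure P ↔ M.RestrictedAgree P fun u s => M.obs s u :=
  ⟨fun h' => SourceAgree.restricted h', fun h' => h'.sourceAgree (intransitivelyUniform_iff.1 h)⟩

/-! ### Violations as reachability in the product of the system with itself -/

variable (M P)

/-- Simultaneous steps by an action with domain outside the agents that `d` may interfere with
in state `s`. -/
def PairStep (s : S) (d : D) (x y : S × S) : Prop :=
  ∃ b, ¬ P.edge s d (M.dom b) ∧ M.step x.1 b = y.1 ∧ M.step x.2 b = y.2

variable {M P}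

theorem reflTransGen_pairStep_iff {s : S} {d : D} {x y : S × S} :
    ReflTransGen (M.PairStep P s d) x y ↔ ∃ α : List A, (∀ b ∈ α, ¬ P.edge s d (M.dom b)) ∧
      M.run x.1 α = y.1 ∧ M.run x.2 α = y.2 := by
  constructor
  · intro h
    induction h with
    | refl => exact ⟨[], by simp, rfl, rfl⟩
    | tail _ h ih =>
      obtain ⟨α, h1, h2, h3⟩ := ih
      obtain ⟨b, hb, h4, h5⟩ := h
      refine ⟨α ++ [b], ?_, ?_, ?_⟩
      · intro c hc
        rcases List.mem_append.1 hc with hc | hc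
        · exact h1 c hc
        · obtain rfl : c = b := by simpa using hc
          exact hb
      · rw [run_append, h2]
        exact h4
      · rw [run_append, h3]
        exact h5
  · rintro ⟨α, h1, h2, h3⟩
    obtain ⟨x1, x2⟩ := x
    obtain ⟨y1, y2⟩ := y
    simp only at h2 h3
    induction α generalizing x1 x2 with
    | nil =>
      obtain rfl : x1 = y1 := h2
      obtain rfl : x2 = y2 := h3
      exact .refl
    | cons b α ih =>
      exact .head ⟨b, h1 b (by simp), rfl, rfl⟩
        (ih (fun c hc => h1 c (List.mem_cons_of_mem _ hc)) _ _ h2 h3)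

/-- The state `s` and the agent `dom a` are constant along the path, so a search stores a pair of
states and a few parameters, but neither the run nor its sources. -/
theorem not_restrictedAgree_iff {X : Type*} {F : D → S → X} : ¬ M.RestrictedAgree P F ↔
    ∃ s a u x y, ¬ P.edge s (M.dom a) u ∧
      ReflTransGen (M.PairStep P s (M.dom a)) (M.step s a, s) (x, y) ∧ F u x ≠ F u y := by
  unfold RestrictedAgree
  push Not
  constructor
  · rintro ⟨s, a, u, α, hu, hα, h⟩
    exact ⟨s, a, u, _, _, hu, reflTransGen_pairStep_iff.2 ⟨α, hα, rfl, rfl⟩, h⟩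
  · rintro ⟨s, a, u, x, y, hu, h', h⟩
    obtain ⟨α, hα, h1, h2⟩ := reflTransGen_pairStep_iff.1 h'
    simp only at h1 h2
    subst h1 h2
    exact ⟨s, a, u, α, hu, hα, h⟩

end Noninterference.System

/-! ### Recognizing tables of instances -/

namespace Noninterference

theorem mul_add_lt_mul {n m i j : ℕ} (hi : i < n) (hj : j < m) : i * m + j < n * m := by
  have h := Nat.mul_le_mul_right m (Nat.succ_le_of_lt hi)
  rw [Nat.succ_mul] at h
  omega

theorem exists_eq_mul_add {n m k : ℕ} (h : k < n * m) : ∃ i < n, ∃ j < m, k = i * m + j := by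
  have hm : 0 < m := Nat.pos_of_ne_zero (by rintro rfl; simp at h)
  exact ⟨k / m, (Nat.div_lt_iff_lt_mul hm).2 h, k % m, Nat.mod_lt _ hm, by
    rw [mul_comm, Nat.div_add_mod]⟩

section

variable {β γ : Type*} {g : β → List γ} {m : ℕ}

theorem length_flatMap_of_length_eq (l : List β) (h : ∀ b, (g b).length = m) :
    (l.flatMap g).length = l.length * m := by
  induction l with
  | nil => simp
  | cons b l ih => rw [List.flatMap_cons, List.length_append, ih, h, List.length_cons, Nat.succ_mul,
      add_comm]

theorem getElem?_flatMap_of_length_eq (l : List β) (h : ∀ b, (g b).length = m) {i j : ℕ}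
    (hi : i < l.length) (hj : j < m) : (l.flatMap g)[i * m + j]? = (g l[i])[j]? := by
  induction l generalizing i with
  | nil => simp at hi
  | cons b l ih =>
    rw [List.flatMap_cons]
    cases i with
    | zero =>
      rw [zero_mul, zero_add, List.getElem?_append_left (by rw [h]; exact hj)]
      rfl
    | succ i =>
      have hs : (i + 1) * m + j - (g b).length = i * m + j := by rw [h, Nat.succ_mul]; omega
      rw [List.getElem?_append_right (by rw [h, Nat.succ_mul]; omega), hs,
        ih (by simpa using hi)]
      rfl

end

/-- The position of the entry of the transition table for the state `s` and the action `a`. -/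
def stepIndex (nA s a : ℕ) : ℕ := 4 + (s * nA + a)

/-- The position of the domain of the action `a`. -/
def domIndex (nS nA a : ℕ) : ℕ := 4 + nS * nA + a

/-- The position of the observation of the agent `u` in the state `s`. -/
def obsIndex (nS nA nD s u : ℕ) : ℕ := 4 + nS * nA + nA + (s * nD + u)

/-- The position of the entry of the policy for the state `s` and the agents `u` and `v`. -/
def edgeIndex (nS nA nD s u v : ℕ) : ℕ := 4 + nS * nA + nA + nS * nD + ((s * nD + u) * nD + v)

/-- The length of the table of an instance. -/
def tableLength (nS nA nD : ℕ) : ℕ := 4 + nS * nA + nA + nS * nD + nS * (nD * nD)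

section

variable {β : Type*} {l₀ l₁ l₂ l₃ l₄ : List β} {k : ℕ}

theorem getElem?_append_one (h₀ : l₀.length = 4) (hk : k < l₁.length) :
    (l₀ ++ l₁ ++ l₂ ++ l₃ ++ l₄)[4 + k]? = l₁[k]? := by
  rw [List.append_assoc, List.append_assoc, List.append_assoc,
    List.getElem?_append_right (by omega), h₀, Nat.add_sub_cancel_left,
    List.getElem?_append_left hk]

theorem getElem?_append_two (h : (l₀ ++ l₁).length = m) (hk : k < l₂.length) :
    (l₀ ++ l₁ ++ l₂ ++ l₃ ++ l₄)[m + k]? = l₂[k]? := by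
  rw [List.append_assoc, List.append_assoc, List.getElem?_append_right (by omega), h,
    Nat.add_sub_cancel_left, List.getElem?_append_left hk]

theorem getElem?_append_three (h : (l₀ ++ l₁ ++ l₂).length = m) (hk : k < l₃.length) :
    (l₀ ++ l₁ ++ l₂ ++ l₃ ++ l₄)[m + k]? = l₃[k]? := by
  rw [List.append_assoc, List.getElem?_append_right (by omega), h,
    Nat.add_sub_cancel_left, List.getElem?_append_left hk]

end

namespace Instance

variable (I : Instance)

/-- The first part of the table of an instance. -/
def header : List ℕ := [I.numStates, I.numActions, I.numAgents, (I.system.init : ℕ)]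

/-- The table of the transition function. -/
def stepTable : List ℕ := (List.finRange I.numStates).flatMap fun s =>
  (List.finRange I.numActions).map fun a => (I.system.step s a : ℕ)

/-- The table of the domains. -/
def domTable : List ℕ := (List.finRange I.numActions).map fun a => (I.system.dom a : ℕ)

/-- The table of the observations. -/
def obsTable : List ℕ := (List.finRange I.numStates).flatMap fun s =>
  (List.finRange I.numAgents).map fun u => I.system.obs s u

open Classical in
/-- The table of the local policies. -/
noncomputable def edgeTable : List ℕ := (List.finRange I.numStates).flatMap fun s =>
  (List.finRange I.numAgents).flatMap fun u =>
    (List.finRange I.numAgents).map fun v => if I.policy.edge s u v then 1 else 0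

theorem table_eq : I.table = I.header ++ I.stepTable ++ I.domTable ++ I.obsTable ++ I.edgeTable :=
  rfl

theorem length_stepTable : I.stepTable.length = I.numStates * I.numActions :=
  (length_flatMap_of_length_eq _ (m := I.numActions) (by simp)).trans (by simp)

theorem length_domTable : I.domTable.length = I.numActions := by simp [domTable]

theorem length_obsTable : I.obsTable.length = I.numStates * I.numAgents :=
  (length_flatMap_of_length_eq _ (m := I.numAgents) (by simp)).trans (by simp)

theorem length_edgeTable : I.edgeTable.length = I.numStates * (I.numAgents * I.numAgents) :=
  (length_flatMap_of_length_eq _ (m := I.numAgents * I.numAgents) fun _ =>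
    (length_flatMap_of_length_eq _ (m := I.numAgents) (by simp)).trans (by simp)).trans (by simp)

theorem length_table : I.table.length = tableLength I.numStates I.numActions I.numAgents := by
  simp only [table_eq, List.length_append, length_stepTable, length_domTable, length_obsTable,
    length_edgeTable]
  rfl

theorem table_step (s : Fin I.numStates) (a : Fin I.numActions) :
    I.table[stepIndex I.numActions s a]? = some (I.system.step s a : ℕ) := by
  rw [table_eq, stepIndex, getElem?_append_one rfl
    (by rw [length_stepTable]; exact mul_add_lt_mul s.2 a.2), stepTable,
    getElem?_flatMap_of_length_eq _ (by simp) (by simp) a.2]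
  simp

theorem table_dom (a : Fin I.numActions) :
    I.table[domIndex I.numStates I.numActions a]? = some (I.system.dom a : ℕ) := by
  rw [table_eq, domIndex, getElem?_append_two
    (by rw [List.length_append, length_stepTable]; rfl) (by rw [length_domTable]; exact a.2)]
  simp [domTable]

theorem table_obs (s : Fin I.numStates) (u : Fin I.numAgents) :
    I.table[obsIndex I.numStates I.numActions I.numAgents s u]? = some (I.system.obs s u) := by
  rw [table_eq, obsIndex, getElem?_append_three
    (by rw [List.length_append, List.length_append, length_stepTable, length_domTable]; rfl)
    (by rw [length_obsTable]; exact mul_add_lt_mul s.2 u.2), obsTable,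
    getElem?_flatMap_of_length_eq _ (by simp) (by simp) u.2]
  simp

open Classical in
theorem table_edge (s : Fin I.numStates) (u v : Fin I.numAgents) :
    I.table[edgeIndex I.numStates I.numActions I.numAgents s u v]? =
      some (if I.policy.edge s u v then 1 else 0) := by
  have h : (s * I.numAgents + u) * I.numAgents + v =
      s * (I.numAgents * I.numAgents) + (u * I.numAgents + v : ℕ) := by ring
  have h1 : (I.header ++ I.stepTable ++ I.domTable ++ I.obsTable).length =
      4 + I.numStates * I.numActions + I.numActions + I.numStates * I.numAgents := by
    simp only [List.length_append, length_stepTable, length_domTable, length_obsTable]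
    rfl
  rw [table_eq, edgeIndex, List.getElem?_append_right (by omega), h1, Nat.add_sub_cancel_left, h,
    edgeTable, getElem?_flatMap_of_length_eq _ (fun _ =>
    (length_flatMap_of_length_eq _ (m := I.numAgents) (by simp)).trans (by simp)) (by simp)
    (mul_add_lt_mul u.2 v.2), getElem?_flatMap_of_length_eq _ (by simp) (by simp) v.2]
  simp

end Instance

/-- The entry of a list with index `i`, or `0`. -/
def at0 (l : List ℕ) (i : ℕ) : ℕ := l[i]?.getD 0

/-- The list describes an instance with the given sizes. -/
def IsTableOf (l : List ℕ) (nS nA nD : ℕ) : Prop :=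
  l.length = tableLength nS nA nD ∧ at0 l 3 < nS ∧
  (∀ s < nS, ∀ a < nA, at0 l (stepIndex nA s a) < nS) ∧
  (∀ a < nA, at0 l (domIndex nS nA a) < nD) ∧
  ∀ s < nS, ∀ u < nD, ∀ v < nD, (at0 l (edgeIndex nS nA nD s u v) = 0 ∧ u ≠ v) ∨
    at0 l (edgeIndex nS nA nD s u v) = 1

/-- The list describes an instance. -/
def IsTable (l : List ℕ) : Prop := IsTableOf l (at0 l 0) (at0 l 1) (at0 l 2)

namespace Instance

variable (I : Instance)

theorem at0_step (s : Fin I.numStates) (a : Fin I.numActions) :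
    at0 I.table (stepIndex I.numActions s a) = (I.system.step s a : ℕ) := by
  rw [at0, I.table_step, Option.getD_some]

theorem at0_dom (a : Fin I.numActions) :
    at0 I.table (domIndex I.numStates I.numActions a) = (I.system.dom a : ℕ) := by
  rw [at0, I.table_dom, Option.getD_some]

theorem at0_obs (s : Fin I.numStates) (u : Fin I.numAgents) :
    at0 I.table (obsIndex I.numStates I.numActions I.numAgents s u) = I.system.obs s u := by
  rw [at0, I.table_obs, Option.getD_some]

open Classical in
theorem at0_edge (s : Fin I.numStates) (u v : Fin I.numAgents) :
    at0 I.table (edgeIndex I.numStates I.numActions I.numAgents s u v) =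
      if I.policy.edge s u v then 1 else 0 := by
  rw [at0, I.table_edge, Option.getD_some]

theorem at0_edge_eq_zero (s : Fin I.numStates) (u v : Fin I.numAgents) :
    at0 I.table (edgeIndex I.numStates I.numActions I.numAgents s u v) = 0 ↔
      ¬ I.policy.edge s u v := by
  classical
  simp [at0_edge]

end Instance

theorem Instance.isTable (I : Instance) : IsTable I.table := by
  refine ⟨I.length_table, I.system.init.2, fun s hs a ha => ?_, fun a ha => ?_,
    fun s hs u hu v hv => ?_⟩
  · exact (I.at0_step ⟨s, hs⟩ ⟨a, ha⟩).trans_lt (Fin.is_lt _)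
  · exact (I.at0_dom ⟨a, ha⟩).trans_lt (Fin.is_lt _)
  · change (at0 I.table (edgeIndex I.numStates I.numActions I.numAgents s u v) = 0 ∧ u ≠ v) ∨
      at0 I.table (edgeIndex I.numStates I.numActions I.numAgents s u v) = 1
    rw [I.at0_edge ⟨s, hs⟩ ⟨u, hu⟩ ⟨v, hv⟩]
    by_cases he : I.policy.edge ⟨s, hs⟩ ⟨u, hu⟩ ⟨v, hv⟩
    · simp [he]
    · refine .inl ⟨by simp [he], ?_⟩
      rintro rfl
      exact he (I.policy.refl _ _)

theorem index_cases {nS nA nD k : ℕ} (hk : k < tableLength nS nA nD) :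
    k < 4 ∨ (∃ s < nS, ∃ a < nA, k = stepIndex nA s a) ∨ (∃ a < nA, k = domIndex nS nA a) ∨
    (∃ s < nS, ∃ u < nD, k = obsIndex nS nA nD s u) ∨
    ∃ s < nS, ∃ u < nD, ∃ v < nD, k = edgeIndex nS nA nD s u v := by
  rcases lt_or_ge k 4 with h | h
  · exact .inl h
  rcases lt_or_ge k (4 + nS * nA) with h | h
  · obtain ⟨s, hs, a, ha, h⟩ := exists_eq_mul_add (n := nS) (m := nA) (k := k - 4) (by omega)
    exact .inr (.inl ⟨s, hs, a, ha, by rw [stepIndex]; omega⟩)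
  rcases lt_or_ge k (4 + nS * nA + nA) with h | h
  · exact .inr (.inr (.inl ⟨k - (4 + nS * nA), by omega, by rw [domIndex]; omega⟩))
  rcases lt_or_ge k (4 + nS * nA + nA + nS * nD) with h | h
  · obtain ⟨s, hs, a, ha, h⟩ := exists_eq_mul_add (n := nS) (m := nD)
      (k := k - (4 + nS * nA + nA)) (by omega)
    exact .inr (.inr (.inr (.inl ⟨s, hs, a, ha, by rw [obsIndex]; omega⟩)))
  · unfold tableLength at hk
    obtain ⟨x, hx, v, hv, h⟩ := exists_eq_mul_add (n := nS * nD) (m := nD)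
      (k := k - (4 + nS * nA + nA + nS * nD)) (by rw [mul_assoc]; omega)
    obtain ⟨s, hs, u, hu, rfl⟩ := exists_eq_mul_add hx
    exact .inr (.inr (.inr (.inr ⟨s, hs, u, hu, v, hv, by rw [edgeIndex]; omega⟩)))

/-- The bounds in `IsTable` make the entries elements of the right finite types, and the condition
on the diagonal gives reflexivity. Observations are not restricted. -/
theorem IsTable.exists_instance {l : List ℕ} (h : IsTable l) : ∃ I : Instance, I.table = l := by
  classical
  obtain ⟨h1, h2, h3, h4, h5⟩ := h
  let I : Instance :=
    { numStates := at0 l 0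
      numActions := at0 l 1
      numAgents := at0 l 2
      system :=
        { init := ⟨at0 l 3, h2⟩
          step := fun s a => ⟨at0 l (stepIndex (at0 l 1) s a), h3 s s.2 a a.2⟩
          obs := fun s u => at0 l (obsIndex (at0 l 0) (at0 l 1) (at0 l 2) s u)
          dom := fun a => ⟨at0 l (domIndex (at0 l 0) (at0 l 1) a), h4 a a.2⟩ }
      policy :=
        { edge := fun s u v => at0 l (edgeIndex (at0 l 0) (at0 l 1) (at0 l 2) s u v) = 1
          refl := fun s u => (h5 s s.2 u u.2 u u.2).resolve_left fun h => h.2 rfl } }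
  have hl : I.table.length = l.length := I.length_table.trans h1.symm
  refine ⟨I, List.ext_getElem? fun k => ?_⟩
  rcases lt_or_ge k l.length with hk | hk
  · suffices h : I.table[k]? = some (at0 l k) by
      rw [h, at0, List.getElem?_eq_getElem hk]
      rfl
    rcases index_cases (h1 ▸ hk) with h | ⟨s, hs, a, ha, rfl⟩ | ⟨a, ha, rfl⟩ |
      ⟨s, hs, u, hu, rfl⟩ | ⟨s, hs, u, hu, v, hv, rfl⟩
    · interval_cases k <;> rfl
    · exact I.table_step ⟨s, hs⟩ ⟨a, ha⟩
    · exact I.table_dom ⟨a, ha⟩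
    · exact I.table_obs ⟨s, hs⟩ ⟨u, hu⟩
    · refine (I.table_edge ⟨s, hs⟩ ⟨u, hu⟩ ⟨v, hv⟩).trans ?_
      have he : I.policy.edge ⟨s, hs⟩ ⟨u, hu⟩ ⟨v, hv⟩ ↔
          at0 l (edgeIndex (at0 l 0) (at0 l 1) (at0 l 2) s u v) = 1 := Iff.rfl
      rcases h5 s hs u hu v hv with h | h <;> simp [he, h]
  · rw [List.getElem?_eq_none hk, List.getElem?_eq_none (hl ▸ hk)]

theorem exists_encode_iff {w : List Letter} :
    (∃ I : Instance, I.encode = w) ↔ SpaceComplexity.Canonical w ∧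
      IsTable (SpaceComplexity.decode w) := by
  rw [SpaceComplexity.canonical_iff]
  constructor
  · rintro ⟨I, rfl⟩
    rw [Instance.encode, SpaceComplexity.decode_encode]
    exact ⟨rfl, I.isTable⟩
  · rintro ⟨h1, h2⟩
    obtain ⟨I, hI⟩ := h2.exists_instance
    exact ⟨I, by rw [Instance.encode, hI, h1]⟩

end Noninterference

/-! ### Deciding uniformity and security -/

namespace Noninterference

open Relation SpaceComplexity

section

variable {κ : Type} {f g h : ∀ w : List Letter, (κ → Word w) → ℕ}

theorem isTerm_entry (n : ℕ) : IsTerm fun w (_ : κ → Word w) => entry w n :=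
  (IsTerm.const n).entry_apply

/-- The entry of the transition table of a word for the state `s` and the action `a`. -/
def stepEntry (w : List Letter) (s a : ℕ) : ℕ := entry w (stepIndex (entry w 1) s a)

/-- The domain of the action `a` according to a word. -/
def domEntry (w : List Letter) (a : ℕ) : ℕ := entry w (domIndex (entry w 0) (entry w 1) a)

/-- The entry of the policy for the state `s` and the agents `u` and `v` according to a word. -/
def edgeEntry (w : List Letter) (s u v : ℕ) : ℕ :=
  entry w (edgeIndex (entry w 0) (entry w 1) (entry w 2) s u v)

theorem isTerm_stepIndex (hf : IsTerm f) (hg : IsTerm g) :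
    IsTerm fun w σ => stepIndex (entry w 1) (f w σ) (g w σ) :=
  (IsTerm.const 4).add ((hf.mul (isTerm_entry 1)).add hg)

theorem isTerm_domIndex (hf : IsTerm f) :
    IsTerm fun w σ => domIndex (entry w 0) (entry w 1) (f w σ) :=
  ((IsTerm.const 4).add ((isTerm_entry 0).mul (isTerm_entry 1))).add hf

theorem isTerm_obsIndex (hf : IsTerm f) (hg : IsTerm g) :
    IsTerm fun w σ => obsIndex (entry w 0) (entry w 1) (entry w 2) (f w σ) (g w σ) :=
  (((IsTerm.const 4).add ((isTerm_entry 0).mul (isTerm_entry 1))).add (isTerm_entry 1)).add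
    ((hf.mul (isTerm_entry 2)).add hg)

theorem isTerm_edgeIndex (hf : IsTerm f) (hg : IsTerm g) (hh : IsTerm h) :
    IsTerm fun w σ => edgeIndex (entry w 0) (entry w 1) (entry w 2) (f w σ) (g w σ) (h w σ) :=
  ((((IsTerm.const 4).add ((isTerm_entry 0).mul (isTerm_entry 1))).add (isTerm_entry 1)).add
    ((isTerm_entry 0).mul (isTerm_entry 2))).add
    ((((hf.mul (isTerm_entry 2)).add hg).mul (isTerm_entry 2)).add hh)

theorem isTerm_tableLength :
    IsTerm fun w (_ : κ → Word w) => tableLength (entry w 0) (entry w 1) (entry w 2) :=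
  ((((IsTerm.const 4).add ((isTerm_entry 0).mul (isTerm_entry 1))).add (isTerm_entry 1)).add
    ((isTerm_entry 0).mul (isTerm_entry 2))).add
    ((isTerm_entry 0).mul ((isTerm_entry 2).mul (isTerm_entry 2)))

theorem isTerm_stepEntry (hf : IsTerm f) (hg : IsTerm g) :
    IsTerm fun w σ => stepEntry w (f w σ) (g w σ) :=
  (isTerm_stepIndex hf hg).entry_apply

theorem isTerm_domEntry (hf : IsTerm f) : IsTerm fun w σ => domEntry w (f w σ) :=
  (isTerm_domIndex hf).entry_apply

theorem isTerm_edgeEntry (hf : IsTerm f) (hg : IsTerm g) (hh : IsTerm h) :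
    IsTerm fun w σ => edgeEntry w (f w σ) (g w σ) (h w σ) :=
  (isTerm_edgeIndex hf hg hh).entry_apply

theorem dec_edge_zero (i j k : κ) :
    Dec fun w (σ : κ → Word w) => edgeEntry w (σ i) (σ j) (σ k) = 0 :=
  (isTerm_edgeEntry (.var i) (.var j) (.var k)).dec_eq_bool false

theorem dec_edge_one (i j k : κ) :
    Dec fun w (σ : κ → Word w) => edgeEntry w (σ i) (σ j) (σ k) = 1 :=
  (isTerm_edgeEntry (.var i) (.var j) (.var k)).dec_eq_bool true

theorem dec_lt_entry (i : κ) (n : ℕ) : Dec fun w (σ : κ → Word w) => (σ i : ℕ) < entry w n :=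
  (isTerm_entry n).dec_var_lt i

end

/-- The sizes are written in binary and could be exponential in the length of the input, for
instance the number of states when there are neither actions nor agents. In all cases that matter
they are bounded by the length of the table. -/
theorem le_tableLength {nS nA nD : ℕ} :
    (0 < nA → nS ≤ tableLength nS nA nD) ∧ nA ≤ tableLength nS nA nD ∧
    (0 < nD → nS ≤ tableLength nS nA nD) ∧ (0 < nS → nD ≤ tableLength nS nA nD) := by
  unfold tableLength
  refine ⟨fun h => ?_, ?_, fun h => ?_, fun h => ?_⟩
  · have := Nat.le_mul_of_pos_right nS h
    omega
  · omega
  · have := Nat.le_mul_of_pos_right nS h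
    omega
  · have := Nat.le_mul_of_pos_left nD h
    omega

theorem dec_isTable {κ : Type} : Dec fun w (_ : κ → Word w) => IsTable (decode w) := by
  have hd : ∀ w : List Letter, (decode w).length < 2 ^ width w := fun w => by
    have h1 := length_decode_le w
    have h2 := length_add_two_lt w
    omega
  -- The prescribed length may be too large for a register, but the actual one never is, so they can
  -- be compared.
  refine (Dec.and (isTerm_tableLength.dec_eq_of_lt isTerm_length fun w _ => hd w)
    (.and (IsTerm.entry_lt_entry (.const 3) (.const 0))
    (.and (Dec.all (P := fun w (_ : κ → Word w) s => ∀ a : Word w, (s : ℕ) < entry w 0 →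
      (a : ℕ) < entry w 1 → stepEntry w s a < entry w 0)
      (.all (.imp (dec_lt_entry _ _) (.imp (dec_lt_entry _ _)
        (IsTerm.entry_lt_entry (isTerm_stepIndex (.var _) (.var _)) (.const 0))))))
    (.and (Dec.all (P := fun w (_ : κ → Word w) a => (a : ℕ) < entry w 1 →
      domEntry w a < entry w 2)
      (.imp (dec_lt_entry _ _) (IsTerm.entry_lt_entry (isTerm_domIndex (.var _)) (.const 2))))
    (Dec.all (P := fun w (_ : κ → Word w) s => ∀ u v : Word w, (s : ℕ) < entry w 0 →
      (u : ℕ) < entry w 2 → (v : ℕ) < entry w 2 →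
      (edgeEntry w s u v = 0 ∧ ¬ u = v) ∨ edgeEntry w s u v = 1)
      (.all (.all (.imp (dec_lt_entry _ _) (.imp (dec_lt_entry _ _) (.imp (dec_lt_entry _ _)
        (.or (.and (dec_edge_zero _ _ _) (.not (.eq _ _))) (dec_edge_one _ _ _)))))))))))).congr
    fun w σ => ?_
  constructor
  · rintro ⟨h1, h2, h3, h4, h5⟩
    have hl := hd w
    rw [← h1] at hl
    obtain ⟨b1, b2, b3, b4⟩ := @le_tableLength (entry w 0) (entry w 1) (entry w 2)
    refine ⟨h1.symm, h2, fun s hs a ha => ?_, fun a ha => ?_, fun s hs u hu v hv => ?_⟩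
    · change s < entry w 0 at hs
      change a < entry w 1 at ha
      have := b1 (by omega)
      exact h3 ⟨s, by omega⟩ ⟨a, by omega⟩ hs ha
    · change a < entry w 1 at ha
      exact h4 ⟨a, by omega⟩ ha
    · change s < entry w 0 at hs
      change u < entry w 2 at hu
      change v < entry w 2 at hv
      have := b3 (by omega)
      have := b4 (by omega)
      have h := h5 ⟨s, by omega⟩ ⟨u, by omega⟩ ⟨v, by omega⟩ hs hu hv
      rwa [Fin.ext_iff] at h
  · rintro ⟨h1, h2, h3, h4, h5⟩
    refine ⟨h1.symm, h2, fun s a hs ha => h3 s hs a ha, fun a ha => h4 a ha,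
      fun s u v hs hu hv => ?_⟩
    rw [Fin.ext_iff]
    exact h5 s hs u hu v hv

/-- Simultaneous steps of two states in the system described by a word, by an action whose domain
the agent `d` may not interfere with in state `s`. -/
def WordPairStep (w : List Letter) (s d : Word w) (p q : Word w × Word w) : Prop :=
  ∃ b c : Word w, (b : ℕ) < entry w 1 ∧ domEntry w b = c ∧ edgeEntry w s d c = 0 ∧
    stepEntry w p.1 b = q.1 ∧ stepEntry w p.2 b = q.2

/-- In the system described by a word, `Q` holds for two states and an agent `u` although the
states can be reached by a run that differs in one action, not to be transmitted to `u`. -/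
def Distinguishable (Q : ∀ w : List Letter, Word w → Word w → Word w → Prop)
    (w : List Letter) : Prop :=
  ∃ s a d t u x y : Word w, (s : ℕ) < entry w 0 ∧ (a : ℕ) < entry w 1 ∧ (u : ℕ) < entry w 2 ∧
    domEntry w a = d ∧ stepEntry w s a = t ∧ edgeEntry w s d u = 0 ∧
    ReflTransGen (WordPairStep w s d) (t, s) (x, y) ∧ Q w u x y

theorem dec_distinguishable {κ : Type} {Q : ∀ w : List Letter, Word w → Word w → Word w → Prop}
    (hQ : Dec fun w (σ : Fin 3 → Word w) => Q w (σ 0) (σ 1) (σ 2)) :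
    Dec fun w (_ : κ → Word w) => Distinguishable Q w := by
  unfold Distinguishable
  refine .ex (.ex (.ex (.ex (.ex (.ex (.ex (.and (dec_lt_entry _ _) (.and (dec_lt_entry _ _)
    (.and (dec_lt_entry _ _) (.and ((isTerm_domEntry (.var _)).dec_eq _)
    (.and ((isTerm_stepEntry (.var _) (.var _)).dec_eq _) (.and (dec_edge_zero _ _ _)
    (.and ?_ (hQ.subst ![some (some none), some none, none]))))))))))))))
  refine .tc (R := fun w σ => WordPairStep w (σ (some (some (some (some (some (some none)))))))
    (σ (some (some (some (some none)))))) ?_ _ _ _ _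
  unfold WordPairStep
  exact .ex (.ex (.and (dec_lt_entry _ _) (.and ((isTerm_domEntry (.var _)).dec_eq _)
    (.and (dec_edge_zero _ _ _) (.and ((isTerm_stepEntry (.var _) (.var _)).dec_eq _)
    ((isTerm_stepEntry (.var _) (.var _)).dec_eq _))))))

end Noninterference

/-! ### The main theorem -/

namespace Noninterference

open Relation SpaceComplexity

section

variable (I : Instance)

theorem entry_encode (i : ℕ) : entry I.encode i = at0 I.table i := by
  rw [entry, Instance.encode, decode_encode]
  rfl

theorem entry_encode_zero : entry I.encode 0 = I.numStates := entry_encode I 0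

theorem entry_encode_one : entry I.encode 1 = I.numActions := entry_encode I 1

theorem entry_encode_two : entry I.encode 2 = I.numAgents := entry_encode I 2

theorem stepEntry_encode (s : Fin I.numStates) (a : Fin I.numActions) :
    stepEntry I.encode s a = (I.system.step s a : ℕ) := by
  rw [stepEntry, entry_encode_one, entry_encode, I.at0_step]

theorem domEntry_encode (a : Fin I.numActions) :
    domEntry I.encode a = (I.system.dom a : ℕ) := by
  rw [domEntry, entry_encode_zero, entry_encode_one, entry_encode, I.at0_dom]

theorem edgeEntry_encode_eq_zero (s : Fin I.numStates) (u v : Fin I.numAgents) :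
    edgeEntry I.encode s u v = 0 ↔ ¬ I.policy.edge s u v := by
  rw [edgeEntry, entry_encode_zero, entry_encode_one, entry_encode_two, entry_encode,
    I.at0_edge_eq_zero]

theorem edgeEntry_encode_eq_iff (s t : Fin I.numStates) (u v : Fin I.numAgents) :
    edgeEntry I.encode s u v = edgeEntry I.encode t u v ↔
      (I.policy.edge s u v ↔ I.policy.edge t u v) := by
  classical
  rw [edgeEntry, edgeEntry, entry_encode_zero, entry_encode_one, entry_encode_two, entry_encode,
    entry_encode, I.at0_edge, I.at0_edge]
  split <;> split <;> simp_all

theorem tableLength_lt :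
    tableLength I.numStates I.numActions I.numAgents < 2 ^ width I.encode := by
  have h1 := length_decode_le I.encode
  have h2 := length_add_two_lt I.encode
  have h3 : (decode I.encode).length = _ := congrArg List.length (decode_encode I.table)
  rw [I.length_table] at h3
  omega

theorem distinguishable_encode {X : Type*} {F : Fin I.numAgents → Fin I.numStates → X}
    {Q : ∀ w : List Letter, Word w → Word w → Word w → Prop}
    (hQ : ∀ (u x y : Word I.encode) (hu : (u : ℕ) < I.numAgents) (hx : (x : ℕ) < I.numStates)
      (hy : (y : ℕ) < I.numStates),
      Q I.encode u x y ↔ F ⟨u, hu⟩ ⟨x, hx⟩ ≠ F ⟨u, hu⟩ ⟨y, hy⟩) :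
    Distinguishable Q I.encode ↔ ¬ I.system.RestrictedAgree I.policy F := by
  rw [System.not_restrictedAgree_iff]
  have hl := tableLength_lt I
  obtain ⟨-, b2, b3, b4⟩ := @le_tableLength I.numStates I.numActions I.numAgents
  constructor
  · rintro ⟨s, a, d, t, u, x, y, hs, ha, hu, hd, ht, he, hr, hq⟩
    rw [entry_encode_zero] at hs
    rw [entry_encode_one] at ha
    rw [entry_encode_two] at hu
    have hd := hd.symm.trans (domEntry_encode I ⟨a, ha⟩)
    rw [hd] at he
    -- Words that are not numbers of states are never reached, so the walk on words is a walk in the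
    -- product system.
    have key : ∀ q, ReflTransGen (WordPairStep I.encode s d) (t, s) q →
        ∃ (hx : (q.1 : ℕ) < I.numStates) (hy : (q.2 : ℕ) < I.numStates),
          ReflTransGen (I.system.PairStep I.policy ⟨s, hs⟩ (I.system.dom ⟨a, ha⟩))
            (I.system.step ⟨s, hs⟩ ⟨a, ha⟩, ⟨s, hs⟩) (⟨q.1, hx⟩, ⟨q.2, hy⟩) := by
      intro q hq
      induction hq with
      | refl =>
        have ht := ht.symm.trans (stepEntry_encode I ⟨s, hs⟩ ⟨a, ha⟩)
        refine ⟨ht.trans_lt (Fin.is_lt _), hs, ?_⟩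
        convert ReflTransGen.refl using 2
        exact Fin.ext ht
      | @tail p q _ h ih =>
        obtain ⟨hx, hy, hr⟩ := ih
        obtain ⟨b, c, hb, hc, he, h1, h2⟩ := h
        rw [entry_encode_one] at hb
        have hc := hc.symm.trans (domEntry_encode I ⟨b, hb⟩)
        have h1 := h1.symm.trans (stepEntry_encode I ⟨p.1, hx⟩ ⟨b, hb⟩)
        have h2 := h2.symm.trans (stepEntry_encode I ⟨p.2, hy⟩ ⟨b, hb⟩)
        rw [hc, hd] at he
        exact ⟨h1.trans_lt (Fin.is_lt _), h2.trans_lt (Fin.is_lt _), hr.tail ⟨⟨b, hb⟩,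
          (edgeEntry_encode_eq_zero I ⟨s, hs⟩ _ _).1 he, Fin.ext h1.symm, Fin.ext h2.symm⟩⟩
    obtain ⟨hx, hy, hr⟩ := key _ hr
    exact ⟨⟨s, hs⟩, ⟨a, ha⟩, ⟨u, hu⟩, _, _,
      (edgeEntry_encode_eq_zero I ⟨s, hs⟩ _ ⟨u, hu⟩).1 he, hr, (hQ u x y hu hx hy).1 hq⟩
  · rintro ⟨s, a, u, x, y, hu, hr, hF⟩
    -- The presence of `u` and `s` makes the numbers of agents and of states positive, hence all
    -- sizes fit into registers.
    have hS := (b3 u.pos).trans hl.le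
    have hD := (b4 s.pos).trans hl.le
    have hA := b2.trans hl.le
    let W : Fin I.numStates → Word I.encode := Fin.castLE hS
    refine ⟨W s, Fin.castLE hA a, Fin.castLE hD (I.system.dom a), W (I.system.step s a),
      Fin.castLE hD u, W x, W y, ?_, ?_, ?_, domEntry_encode I a, stepEntry_encode I s a,
      (edgeEntry_encode_eq_zero I s _ u).2 hu, ?_, (hQ _ _ _ u.2 x.2 y.2).2 hF⟩
    · exact s.2.trans_eq (entry_encode_zero I).symm
    · exact a.2.trans_eq (entry_encode_one I).symm
    · exact u.2.trans_eq (entry_encode_two I).symm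
    · refine ReflTransGen.lift (r := I.system.PairStep I.policy s (I.system.dom a))
        (p := WordPairStep I.encode (W s) (Fin.castLE hD (I.system.dom a)))
        (fun p => (W p.1, W p.2)) ?_ _ _ hr
      rintro ⟨p1, p2⟩ ⟨q1, q2⟩ ⟨b, hb, h1, h2⟩
      simp only at h1 h2
      subst h1 h2
      exact ⟨Fin.castLE hA b, Fin.castLE hD (I.system.dom b),
        b.2.trans_eq (entry_encode_one I).symm, domEntry_encode I b,
        (edgeEntry_encode_eq_zero I s _ _).2 hb, stepEntry_encode I p1 b, stepEntry_encode I p2 b⟩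

end

/-- The agent `u` is subject to different policies in the states `x` and `y`. -/
def PolicyDiffers (w : List Letter) (u x y : Word w) : Prop :=
  ∃ v : Word w, (v : ℕ) < entry w 2 ∧ ¬ edgeEntry w x v u = edgeEntry w y v u

/-- The agent `u` makes different observations in the states `x` and `y`. -/
def ObsDiffers (w : List Letter) (u x y : Word w) : Prop :=
  ¬ entry w (obsIndex (entry w 0) (entry w 1) (entry w 2) x u) =
    entry w (obsIndex (entry w 0) (entry w 1) (entry w 2) y u)

theorem dec_policyDiffers :
    Dec fun w (σ : Fin 3 → Word w) => PolicyDiffers w (σ 0) (σ 1) (σ 2) := by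
  unfold PolicyDiffers
  exact .ex (.and (dec_lt_entry _ _) (.not (IsTerm.entry_eq_entry
    (isTerm_edgeIndex (.var _) (.var _) (.var _)) (isTerm_edgeIndex (.var _) (.var _) (.var _)))))

theorem dec_obsDiffers :
    Dec fun w (σ : Fin 3 → Word w) => ObsDiffers w (σ 0) (σ 1) (σ 2) :=
  .not (IsTerm.entry_eq_entry (isTerm_obsIndex (.var _) (.var _))
    (isTerm_obsIndex (.var _) (.var _)))

theorem distinguishable_policy_iff (I : Instance) :
    Distinguishable PolicyDiffers I.encode ↔ ¬ I.system.IntransitivelyUniform I.policy := by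
  rw [System.intransitivelyUniform_iff]
  refine distinguishable_encode I fun u x y hu hx hy => ?_
  rw [ne_eq, Set.ext_iff, not_forall, PolicyDiffers, entry_encode_two]
  constructor
  · rintro ⟨v, hv, h⟩
    exact ⟨⟨v, hv⟩, fun h' => h ((edgeEntry_encode_eq_iff I ⟨x, hx⟩ ⟨y, hy⟩ ⟨v, hv⟩ ⟨u, hu⟩).2 h')⟩
  · rintro ⟨v, h⟩
    have h1 := tableLength_lt I
    have h2 := (@le_tableLength I.numStates I.numActions I.numAgents).2.2.2 (by omega)
    exact ⟨⟨v, by omega⟩, v.2,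
      fun h' => h ((edgeEntry_encode_eq_iff I ⟨x, hx⟩ ⟨y, hy⟩ v ⟨u, hu⟩).1 h')⟩

theorem distinguishable_obs_iff (I : Instance) (h : I.system.IntransitivelyUniform I.policy) :
    Distinguishable ObsDiffers I.encode ↔ ¬ I.system.ISecure I.policy := by
  rw [h.iSecure_iff]
  refine distinguishable_encode I fun u x y hu hx hy => not_congr ?_
  rw [entry_encode_zero, entry_encode_one, entry_encode_two, entry_encode, entry_encode,
    I.at0_obs ⟨x, hx⟩ ⟨u, hu⟩, I.at0_obs ⟨y, hy⟩ ⟨u, hu⟩]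

theorem uniformPolicies_mem_NL : UniformPolicies ∈ NL Letter := by
  have h := ((Dec.canonical.and dec_isTable).and (dec_distinguishable dec_policyDiffers).not).mem_NL
  suffices e : UniformPolicies =
      {w | (Canonical w ∧ IsTable (decode w)) ∧ ¬ Distinguishable PolicyDiffers w} by
    rw [e]
    exact h
  refine Set.ext fun w => ?_
  change (∃ I : Instance, I.encode = w ∧ I.system.IntransitivelyUniform I.policy) ↔
    (Canonical w ∧ IsTable (decode w)) ∧ ¬ Distinguishable PolicyDiffers w
  rw [← exists_encode_iff]
  constructor
  · rintro ⟨I, rfl, hI⟩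
    exact ⟨⟨I, rfl⟩, fun h => (distinguishable_policy_iff I).1 h hI⟩
  · rintro ⟨⟨I, rfl⟩, h⟩
    exact ⟨I, rfl, not_not.1 fun hI => h ((distinguishable_policy_iff I).2 hI)⟩

theorem exists_mem_NL_iSecure : ∃ L ∈ NL Letter, ∀ I : Instance,
    I.system.IntransitivelyUniform I.policy → (I.encode ∈ L ↔ I.system.ISecure I.policy) := by
  -- The claim only concerns encodings with uniform policies; elsewhere membership may be anything,
  -- so no check of the syntax is needed.
  refine ⟨{w | ¬ Distinguishable ObsDiffers w}, (dec_distinguishable dec_obsDiffers).not.mem_NL,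
    fun I hI => ?_⟩
  change ¬ Distinguishable ObsDiffers I.encode ↔ _
  rw [distinguishable_obs_iff I hI, not_not]

end Noninterference

theorem corollary8 :
    Noninterference.UniformPolicies ∈ SpaceComplexity.NL Noninterference.Letter ∧
    ∃ L ∈ SpaceComplexity.NL Noninterference.Letter, ∀ I : Noninterference.Instance,
      I.system.IntransitivelyUniform I.policy → (I.encode ∈ L ↔ I.system.ISecure I.policy) :=
  ⟨Noninterference.uniformPolicies_mem_NL, Noninterference.exists_mem_NL_iSecure⟩
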